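/- **Setting.** Scalar products are linear in the first entry. Let $\mathcal H,\mathfrak H$ be complex separable Hilbert spaces and let $A$ be a densely defined, closed, symmetric operator in $\mathcal H$ with equal deficiency indices, $\dim\ker(A^*-\mathbf i)=\dim\ker(A^*+\mathbf i)$. The space $\operatorname{dom}(A^*)$ carries the graph norm $\|u\|_{A^*}^2=\|u\|^2+\|A^*u\|^2$. A *boundary triple* $(\mathfrak H,\Gamma_1,\Gamma_2)$ for $A$ consists of linear maps $\Gamma_1,\Gamma_2:\operatorname{dom}(A^*)\to\mathfrak H$ such that $$\langle A^*f,g\rangle-\langle f,A^*g\rangle=\langle\Gamma_1f,\Gamma_2g\rangle-\langle\Gamma_2f,\Gamma_1g\rangle,\qquad f,g\in\operatorname{dom}(A^*),$$ and $(\Gamma_1,\Gamma_2):\operatorname{dom}(A^*)\to\mathfrak H\times\mathfrak H$ is onto. On the Hilbert space $\mathfrak H\times\mathfrak H$ let $\omega((f_1,g_1),(f_2,g_2))=\langle f_1,g_2\rangle-\langle g_1,f_2\rangle=\langle J(f_1,g_1),(f_2,g_2)\rangle$, so that $J(f,g)=(-g,f)$. A subspace $\mathcal F$ of a symplectic Hilbert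 space is *Lagrangian* if it equals its annihilator with respect to the symplectic form. A path of Lagrangian planes is continuous (resp. $C^1$) if the orthogonal projections onto the planes depend continuously (resp. continuously differentiably) on the parameter in operator norm. Two Lagrangian planes $\mathcal F,\mathcal Z$ form a *Fredholm pair* if $\dim(\mathcal F\cap\mathcal Z)<\infty$ and $\mathcal F+\mathcal Z$ is closed and of finite codimension. **Maslov index.** Let $\mathcal X$ be a complex Hilbert space with a bounded operator $J$, $J^2=-I$, $J^*=-J$, and the symplectic form $\langle J\cdot,\cdot\rangle$. Every Lagrangian plane is $\mathcal F=\{y+Uy:y\in\ker(J+\mathbf i)\}$ for a unique bounded (in fact unitary) operator $U:\ker(J+\mathbf i)\to\ker(J-\mathbf i)$. For a fixed Lagrangian plane $\mathcal Z$ with operator $V$, and a continuous path $\mathcal F_s$, $s\in[a,b]$, of Lagrangian planes with operators $U_s$ such that all pairs $(\mathcal F_s,\mathcal Z)$ are Fredholm, choose a partition $a=s_0<\dots<s_N=b$ and $\varepsilon_j\in(0,\pi)$ such that, for all $s\in[s_{j-1},s_j]$, $e^{\pm\mathbf i\varepsilon_j}\notin\operatorname{Spec}(U_sV^{-1})$ and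 the part of $\operatorname{Spec}(U_sV^{-1})$ in the arc $\{e^{\mathbf i\varkappa}:|\varkappa|\le\varepsilon_j\}$ consists of finitely many eigenvalues of finite multiplicity. With $k(s,\varepsilon)=\sum_{0\le\varkappa\le\varepsilon}\dim\ker(U_sV^{-1}-e^{\mathbf i\varkappa})$, put $$\operatorname{Mas}(\mathcal F,\mathcal Z)=\sum_{j=1}^N\bigl(k(s_j,\varepsilon_j)-k(s_{j-1},\varepsilon_j)\bigr);$$ such choices exist and the number does not depend on them. For two continuous paths $\mathcal F_s,\mathcal G_s$ of Lagrangian planes forming Fredholm pairs, $\operatorname{Mas}(\mathcal F,\mathcal G)$ is the Maslov index of the path $\mathcal F_s\oplus\mathcal G_s$ in $\mathcal X\oplus\mathcal X$, with complex structure $J\oplus(-J)$, relative to the diagonal $\{(p,p):p\in\mathcal X\}$. **Theorem.** Let $\alpha<\beta$ and assume the following. 1. $t\mapsto V_t$ is in $C^1([\alpha,\beta],\mathcal B(\mathcal H))$ and $V_t^*=V_t$ for all $t$. 2. For some $\kappa<0$, $\ker(A^*+V_t-\lambda)\cap\operatorname{dom}(A)=\{0\}$ for all $t\in[\alpha,\beta]$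 and all real $\lambda\ge\kappa$. 3. $(\mathfrak H,\Gamma_{1,t},\Gamma_{2,t})$, $t\in[\alpha,\beta]$, are boundary triples for $A$, and $t\mapsto\operatorname{Tr}_t:=(\Gamma_{1,t},\Gamma_{2,t})$ is in $C^1([\alpha,\beta],\mathcal B(\operatorname{dom}(A^*),\mathfrak H\times\mathfrak H))$. 4. $t\mapsto\mathcal G_t$, $t\in[\alpha,\beta]$, is a $C^1$ path of Lagrangian planes in $\mathfrak H\times\mathfrak H$. 5. For all $t\in[\alpha,\beta]$ the self-adjoint extension $A_{\mathscr D_t}$ of $A$, that is, the restriction of $A^*$ to $\mathscr D_t:=\operatorname{Tr}_t^{-1}(\mathcal G_t)$, has compact resolvent. 6. There is $\lambda_\infty\in[\kappa,0)$ such that $\ker(A_{\mathscr D_t}+V_t-\lambda)=\{0\}$ for all $t\in[\alpha,\beta]$ and all real $\lambda<\lambda_\infty$. For $t\in[\alpha,\beta]$ let $\mathbb K_{0,t}:=\operatorname{Tr}_t(\ker(A^*+V_t))$, and let $\operatorname{Mor}(T)$ denote the number of negative eigenvalues of $T$, counted with multiplicity. Then $\operatorname{Mor}(A_{\mathscr D_\alpha}+V_\alpha)$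 and $\operatorname{Mor}(A_{\mathscr D_\beta}+V_\beta)$ are finite, $t\mapsto\mathbb K_{0,t}$ is a continuous path of Lagrangian planes, each $(\mathbb K_{0,t},\mathcal G_t)$ is a Fredholm pair, and $$\operatorname{Mor}(A_{\mathscr D_\alpha}+V_\alpha)-\operatorname{Mor}(A_{\mathscr D_\beta}+V_\beta)=\operatorname{Mas}\bigl((\mathbb K_{0,t},\mathcal G_t)|_{t\in[\alpha,\beta]}\bigr).$$ -/

import Mathlib

open scoped LinearPMap

noncomputable section

/-! ## Symplectic Hilbert spaces, Lagrangian planes, Fredholm pairs -/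

section Symplectic

variable {X : Type*} [NormedAddCommGroup X] [InnerProductSpace ℂ X]

/-- The symplectic form `ω(u, v) = ⟨J u, v⟩` with the scalar product linear in its first entry
(Mathlib's `inner ℂ` is linear in its second entry, so the entries are swapped). Here `J` is a
complex structure: `J² = -1`, `J* = -J`. -/
def sympForm (J : X →L[ℂ] X) (u v : X) : ℂ := inner ℂ v (J u)

/-- `F` equals its annihilator with respect to `ω`. -/
def IsLagrangian (J : X →L[ℂ] X) (F : Submodule ℂ X) : Prop :=
  ∀ u : X, u ∈ F ↔ ∀ v ∈ F, sympForm J u v = 0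

/-- Fredholm pair of subspaces. -/
def IsFredholmPair (F Z : Submodule ℂ X) : Prop :=
  FiniteDimensional ℂ (F ⊓ Z : Submodule ℂ X) ∧
  IsClosed ((F ⊔ Z : Submodule ℂ X) : Set X) ∧
  FiniteDimensional ℂ (X ⧸ (F ⊔ Z))

/-- The orthogonal projection onto `F`. (A Lagrangian plane is closed, so that the closure, taken
here to have the projection for every subspace, changes nothing.) -/
def planeProj [CompleteSpace X] (F : Submodule ℂ X) : X →L[ℂ] X :=
  F.topologicalClosure.starProjection

/-- Continuous path of Lagrangian planes over `[a, b]`, for the metric `‖P_F - P_G‖`. -/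
def IsContLagrangianPath [CompleteSpace X] (J : X →L[ℂ] X) (F : ℝ → Submodule ℂ X)
    (a b : ℝ) : Prop :=
  (∀ s ∈ Set.Icc a b, IsLagrangian J (F s)) ∧
  ContinuousOn (fun s => planeProj (F s)) (Set.Icc a b)

/-- `C¹` path of Lagrangian planes over `[a, b]`: the orthogonal projections are `C¹`. -/
def IsC1LagrangianPath [CompleteSpace X] (J : X →L[ℂ] X) (F : ℝ → Submodule ℂ X)
    (a b : ℝ) : Prop :=
  (∀ s ∈ Set.Icc a b, IsLagrangian J (F s)) ∧
  ContDiffOn ℝ 1 (fun s => planeProj (F s)) (Set.Icc a b)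

end Symplectic

/-! ## The Maslov index -/

section Maslov

variable {X : Type*} [NormedAddCommGroup X] [InnerProductSpace ℂ X]

/-- `ker (J - i)`. -/
def kerSubI (J : X →L[ℂ] X) : Submodule ℂ X :=
  LinearMap.ker ((J - Complex.I • ContinuousLinearMap.id ℂ X : X →L[ℂ] X) : X →ₗ[ℂ] X)

/-- `ker (J + i)`. -/
def kerAddI (J : X →L[ℂ] X) : Submodule ℂ X :=
  LinearMap.ker ((J + Complex.I • ContinuousLinearMap.id ℂ X : X →L[ℂ] X) : X →ₗ[ℂ] X)

/-- `F = {y + U y : y ∈ ker (J + i)}`. -/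
def IsGraphOf (J : X →L[ℂ] X) (F : Submodule ℂ X) (U : kerAddI J →L[ℂ] kerSubI J) : Prop :=
  ∀ x : X, x ∈ F ↔ ∃ y : kerAddI J, x = (y : X) + (U y : X)

open Classical in
/-- The operator `U` with `F = graph U`. It exists and is unique (and is unitary) for every
Lagrangian plane `F`; the value `0` for other subspaces is never used. -/
def graphOperator (J : X →L[ℂ] X) (F : Submodule ℂ X) : kerAddI J →L[ℂ] kerSubI J :=
  if h : ∃ U : kerAddI J →L[ℂ] kerSubI J, IsGraphOf J F U then h.choose else 0

/-- The operator `U V⁻¹` in `ker (J - i)`, where `F = graph U` and `Z = graph V`. -/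
def souriau (J : X →L[ℂ] X) (F Z : Submodule ℂ X) : kerSubI J →L[ℂ] kerSubI J :=
  (graphOperator J F).comp (graphOperator J Z).inverse

/-- The point `e^{iκ}` of the unit circle. -/
def circlePt (κ : ℝ) : ℂ := Complex.exp (κ * Complex.I)

/-- `ker (W - e^{iκ})`. -/
def circleEigenspace {Y : Type*} [NormedAddCommGroup Y] [NormedSpace ℂ Y] (W : Y →L[ℂ] Y)
    (κ : ℝ) : Submodule ℂ Y :=
  LinearMap.ker ((W - circlePt κ • ContinuousLinearMap.id ℂ Y : Y →L[ℂ] Y) : Y →ₗ[ℂ] Y)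

/-- The end points of the closed arc `{e^{iκ} : |κ| ≤ ε}` are not in the spectrum of `W`, and the
part of the spectrum in the arc is a finite set of points with finite-dimensional eigenspaces
(for a unitary `W`: `W - e^{iκ}` is Fredholm for `|κ| ≤ ε`). -/
def IsAdmissibleArc {Y : Type*} [NormedAddCommGroup Y] [NormedSpace ℂ Y] (W : Y →L[ℂ] Y)
    (ε : ℝ) : Prop :=
  circlePt ε ∉ spectrum ℂ W ∧ circlePt (-ε) ∉ spectrum ℂ W ∧
  {κ : ℝ | κ ∈ Set.Icc (-ε) ε ∧ circlePt κ ∈ spectrum ℂ W}.Finite ∧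
  ∀ κ ∈ Set.Icc (-ε) ε, FiniteDimensional ℂ (circleEigenspace W κ)

/-- `∑_{0 ≤ κ ≤ ε} dim ker (W - e^{iκ})`; a finite sum on an admissible arc. -/
def arcCount {Y : Type*} [NormedAddCommGroup Y] [NormedSpace ℂ Y] (W : Y →L[ℂ] Y)
    (ε : ℝ) : ℕ :=
  ∑ᶠ κ ∈ Set.Icc (0 : ℝ) ε, Module.finrank ℂ (circleEigenspace W κ)

/-- A partition `a = s₀ < s₁ < ⋯ < s_N = b` with `ε₁, …, ε_N ∈ (0, π)` that is admissible for the
path `F` relative to `Z`. -/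
structure MaslovPartition (J : X →L[ℂ] X) (F : ℝ → Submodule ℂ X) (Z : Submodule ℂ X)
    (a b : ℝ) where
  N : ℕ
  s : Fin (N + 1) → ℝ
  ε : Fin N → ℝ
  strictMono_s : StrictMono s
  s_zero : s 0 = a
  s_last : s (Fin.last N) = b
  ε_mem : ∀ j, ε j ∈ Set.Ioo 0 Real.pi
  admissible : ∀ j, ∀ r ∈ Set.Icc (s j.castSucc) (s j.succ),
    IsAdmissibleArc (souriau J (F r) Z) (ε j)

/-- `∑ⱼ (k(sⱼ, εⱼ) - k(sⱼ₋₁, εⱼ))`. -/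
def MaslovPartition.flow {J : X →L[ℂ] X} {F : ℝ → Submodule ℂ X} {Z : Submodule ℂ X}
    {a b : ℝ} (p : MaslovPartition J F Z a b) : ℤ :=
  ∑ j : Fin p.N, ((arcCount (souriau J (F (p.s j.succ)) Z) (p.ε j) : ℤ) -
    (arcCount (souriau J (F (p.s j.castSucc)) Z) (p.ε j) : ℤ))

/-- `Mas(F, Z) = m`, including all that this notation presupposes: `F` is a continuous path in the
Fredholm-Lagrangian Grassmannian of the Lagrangian plane `Z`, admissible partitions exist, and each
of them has flow `m`. -/
def HasMaslovIndex [CompleteSpace X] (J : X →L[ℂ] X) (F : ℝ → Submodule ℂ X)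
    (Z : Submodule ℂ X) (a b : ℝ) (m : ℤ) : Prop :=
  IsLagrangian J Z ∧ IsContLagrangianPath J F a b ∧
  (∀ s ∈ Set.Icc a b, IsFredholmPair (F s) Z) ∧
  Nonempty (MaslovPartition J F Z a b) ∧
  ∀ p : MaslovPartition J F Z a b, p.flow = m

/-- The complex structure `J ⊕ (-J)` on the Hilbert space `X ⊕ X`. -/
def doubleJ (J : X →L[ℂ] X) : WithLp 2 (X × X) →L[ℂ] WithLp 2 (X × X) :=
  ((WithLp.prodContinuousLinearEquiv 2 ℂ X X).symm : X × X →L[ℂ] WithLp 2 (X × X)) ∘L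
    (J.prodMap (-J)) ∘L
    ((WithLp.prodContinuousLinearEquiv 2 ℂ X X) : WithLp 2 (X × X) →L[ℂ] X × X)

/-- The subspace `F ⊕ G` of `X ⊕ X`. -/
def planeSum (F G : Submodule ℂ X) : Submodule ℂ (WithLp 2 (X × X)) :=
  (F.prod G).comap (WithLp.linearEquiv 2 ℂ (X × X)).toLinearMap

/-- The diagonal of `X ⊕ X`. -/
def diagPlane (X : Type*) [NormedAddCommGroup X] [InnerProductSpace ℂ X] :
    Submodule ℂ (WithLp 2 (X × X)) :=
  (LinearMap.ker (LinearMap.fst ℂ X X - LinearMap.snd ℂ X X)).comap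
    (WithLp.linearEquiv 2 ℂ (X × X)).toLinearMap

/-- `Mas(F, G) = m` for two paths: they are continuous paths of Lagrangian planes forming a
Fredholm pair at every parameter, and `Mas(F ⊕ G, diag) = m`. -/
def HasMaslovIndexPair [CompleteSpace X] (J : X →L[ℂ] X) (F G : ℝ → Submodule ℂ X)
    (a b : ℝ) (m : ℤ) : Prop :=
  IsContLagrangianPath J F a b ∧ IsContLagrangianPath J G a b ∧
  (∀ s ∈ Set.Icc a b, IsFredholmPair (F s) (G s)) ∧
  HasMaslovIndex (doubleJ J) (fun s => planeSum (F s) (G s)) (diagPlane X) a b m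

end Maslov

/-! ## The standard symplectic structure on `𝔥 × 𝔥` -/

section Standard

variable {𝔥 : Type*} [NormedAddCommGroup 𝔥] [InnerProductSpace ℂ 𝔥]

/-- `J (f, g) = (-g, f)` on the Hilbert space `𝔥 × 𝔥`. -/
def stdJ (𝔥 : Type*) [NormedAddCommGroup 𝔥] [InnerProductSpace ℂ 𝔥] :
    WithLp 2 (𝔥 × 𝔥) →L[ℂ] WithLp 2 (𝔥 × 𝔥) :=
  ((WithLp.prodContinuousLinearEquiv 2 ℂ 𝔥 𝔥).symm : 𝔥 × 𝔥 →L[ℂ] WithLp 2 (𝔥 × 𝔥)) ∘L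
    ((-ContinuousLinearMap.snd ℂ 𝔥 𝔥).prod (ContinuousLinearMap.fst ℂ 𝔥 𝔥)) ∘L
    ((WithLp.prodContinuousLinearEquiv 2 ℂ 𝔥 𝔥) : WithLp 2 (𝔥 × 𝔥) →L[ℂ] 𝔥 × 𝔥)

/-- `ω((f₁, g₁), (f₂, g₂)) = ⟨f₁, g₂⟩ - ⟨g₁, f₂⟩`, with scalar products linear in the first
entry. -/
theorem sympForm_stdJ (x y : WithLp 2 (𝔥 × 𝔥)) :
    sympForm (stdJ 𝔥) x y = inner ℂ y.snd x.fst - inner ℂ y.fst x.snd := by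
  simp [sympForm, stdJ, WithLp.prod_inner_apply]
  ring

theorem stdJ_sq (x : WithLp 2 (𝔥 × 𝔥)) : stdJ 𝔥 (stdJ 𝔥 x) = -x := by
  apply (WithLp.linearEquiv 2 ℂ (𝔥 × 𝔥)).injective
  ext <;> simp [stdJ]

end Standard

/-! ## Unbounded operators -/

section Operators

variable {H : Type*} [NormedAddCommGroup H] [InnerProductSpace ℂ H]

/-- `T + B` for a bounded `B`, with the domain of `T`. -/
def addBounded (T : H →ₗ.[ℂ] H) (B : H →L[ℂ] H) : H →ₗ.[ℂ] H := (B : H →ₗ[ℂ] H) +ᵥ T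

/-- `ker (T - μ)` as a subspace of `H`. -/
def opEigenspace (T : H →ₗ.[ℂ] H) (μ : ℂ) : Submodule ℂ H :=
  (LinearMap.ker (T.toFun - μ • T.domain.subtype)).map T.domain.subtype

/-- `T` has compact resolvent: for some `z`, `T - z` has a compact everywhere defined inverse. -/
def HasCompactResolvent (T : H →ₗ.[ℂ] H) : Prop :=
  ∃ (z : ℂ) (R : H →L[ℂ] H), IsCompactOperator R ∧
    (∀ y : H, ∃ h : R y ∈ T.domain, T ⟨R y, h⟩ - z • R y = y) ∧
    ∀ x : T.domain, R (T x - z • (x : H)) = x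

/-- `Mor(T) = n`: `T` has finitely many negative eigenvalues, all of finite multiplicity, and `n`
is their number counted with multiplicity. -/
def HasMorseIndex (T : H →ₗ.[ℂ] H) (n : ℕ) : Prop :=
  {μ : ℝ | μ < 0 ∧ opEigenspace T μ ≠ ⊥}.Finite ∧
  (∀ μ : ℝ, μ < 0 → FiniteDimensional ℂ (opEigenspace T μ)) ∧
  ∑ᶠ μ ∈ Set.Iio (0 : ℝ), Module.finrank ℂ (opEigenspace T ((μ : ℝ) : ℂ)) = n

/-- The domain of `T`, as a space of its own that carries the graph norm. -/
def GraphDomain (T : H →ₗ.[ℂ] H) : Type _ := T.domain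

instance (T : H →ₗ.[ℂ] H) : AddCommGroup (GraphDomain T) :=
  inferInstanceAs (AddCommGroup T.domain)

instance (T : H →ₗ.[ℂ] H) : Module ℂ (GraphDomain T) :=
  inferInstanceAs (Module ℂ T.domain)

/-- The identity map `dom T → GraphDomain T`. -/
def GraphDomain.of (T : H →ₗ.[ℂ] H) : T.domain ≃ₗ[ℂ] GraphDomain T := LinearEquiv.refl ℂ T.domain

/-- `u ↦ (u, T u)`. -/
def GraphDomain.toGraph (T : H →ₗ.[ℂ] H) : GraphDomain T →ₗ[ℂ] WithLp 2 (H × H) :=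
  (WithLp.linearEquiv 2 ℂ (H × H)).symm.toLinearMap ∘ₗ
    (T.domain.subtype.prod T.toFun) ∘ₗ (GraphDomain.of T).symm.toLinearMap

theorem GraphDomain.toGraph_injective (T : H →ₗ.[ℂ] H) :
    Function.Injective (GraphDomain.toGraph T) := by
  intro x y h
  have h1 := congrArg (fun z => (WithLp.ofLp z).1) h
  exact (GraphDomain.of T).symm.injective (Subtype.ext h1)

instance (T : H →ₗ.[ℂ] H) : NormedAddCommGroup (GraphDomain T) :=
  NormedAddCommGroup.induced (GraphDomain T) (WithLp 2 (H × H)) (GraphDomain.toGraph T)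
    (GraphDomain.toGraph_injective T)

instance (T : H →ₗ.[ℂ] H) : NormedSpace ℂ (GraphDomain T) :=
  NormedSpace.induced ℂ (GraphDomain T) (WithLp 2 (H × H)) (GraphDomain.toGraph T)

/-- The graph norm. -/
theorem GraphDomain.norm_sq (T : H →ₗ.[ℂ] H) (u : T.domain) :
    ‖GraphDomain.of T u‖ ^ 2 = ‖(u : H)‖ ^ 2 + ‖T u‖ ^ 2 := by
  change ‖GraphDomain.toGraph T (GraphDomain.of T u)‖ ^ 2 = _
  rw [WithLp.prod_norm_sq_eq_of_L2]
  rfl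

/-- The family `t ↦ L t` of linear maps on `dom T` is contained in `C¹([a, b], 𝓑(dom T, Y))`,
where `dom T` carries the graph norm. -/
def IsC1GraphFamily {Y : Type*} [NormedAddCommGroup Y] [NormedSpace ℂ Y] (T : H →ₗ.[ℂ] H)
    (L : ℝ → T.domain →ₗ[ℂ] Y) (a b : ℝ) : Prop :=
  ∃ L' : ℝ → GraphDomain T →L[ℂ] Y,
    (∀ t ∈ Set.Icc a b, ∀ u : T.domain, L' t (GraphDomain.of T u) = L t u) ∧
    ContDiffOn ℝ 1 L' (Set.Icc a b)

end Operators

/-! ## Boundary triples -/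

section Triples

variable {H : Type*} [NormedAddCommGroup H] [InnerProductSpace ℂ H] [CompleteSpace H]
variable {𝔥 : Type*} [NormedAddCommGroup 𝔥] [InnerProductSpace ℂ 𝔥]

/-- Equal deficiency indices: `ker (A* - i)` and `ker (A* + i)` have the same Hilbert dimension,
that is, they are isometrically isomorphic. -/
def EqualDeficiencyIndices (A : H →ₗ.[ℂ] H) : Prop :=
  Nonempty (opEigenspace A† Complex.I ≃ₗᵢ[ℂ] opEigenspace A† (-Complex.I))

/-- The trace `u ↦ (Γ₁ u, Γ₂ u)`. -/
def boundaryTrace {A : H →ₗ.[ℂ] H} (Γ₁ Γ₂ : A†.domain →ₗ[ℂ] 𝔥) :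
    A†.domain →ₗ[ℂ] WithLp 2 (𝔥 × 𝔥) :=
  (WithLp.linearEquiv 2 ℂ (𝔥 × 𝔥)).symm.toLinearMap ∘ₗ (Γ₁.prod Γ₂)

/-- Boundary triple: the abstract second Green identity
`⟨A*f, g⟩ - ⟨f, A*g⟩ = ⟨Γ₁f, Γ₂g⟩ - ⟨Γ₂f, Γ₁g⟩` (scalar products linear in the first entry), and
surjectivity of the trace. -/
structure IsBoundaryTriple (A : H →ₗ.[ℂ] H) (Γ₁ Γ₂ : A†.domain →ₗ[ℂ] 𝔥) : Prop where
  green : ∀ f g : A†.domain,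
    inner ℂ (g : H) (A† f) - inner ℂ (A† g) (f : H) =
      inner ℂ (Γ₂ g) (Γ₁ f) - inner ℂ (Γ₁ g) (Γ₂ f)
  surjective : Function.Surjective (boundaryTrace Γ₁ Γ₂)

/-- The restriction of `A*` to the preimage of `G` under the trace `Tr`. -/
def extensionOf (A : H →ₗ.[ℂ] H) (Tr : A†.domain →ₗ[ℂ] WithLp 2 (𝔥 × 𝔥))
    (G : Submodule ℂ (WithLp 2 (𝔥 × 𝔥))) : H →ₗ.[ℂ] H :=
  A†.domRestrict ((G.comap Tr).map A†.domain.subtype)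

/-- The set of traces `Tr (ker (A* + B - μ))`. -/
def solutionTraces (A : H →ₗ.[ℂ] H) (B : H →L[ℂ] H)
    (Tr : A†.domain →ₗ[ℂ] WithLp 2 (𝔥 × 𝔥)) (μ : ℂ) : Submodule ℂ (WithLp 2 (𝔥 × 𝔥)) :=
  ((opEigenspace (addBounded A† B) μ).comap A†.domain.subtype).map Tr

end Triples

end

set_option linter.unusedSectionVars false

/-! Let `K(μ,t)` be the plane of traces of solutions of `(A* + V_t - μ)u = 0`, and let `W(μ,t)` be
the unitary operator `U V⁻¹` of `K(μ,t) ⊕ G_t` relative to the diagonal. Then `ker (W(μ,t) - 1)`,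
`K(μ,t) ∩ G_t` and the kernel of the boundary value problem with parameter `μ` are isomorphic. So
the Morse index counts the `μ < 0` at which `W(μ,t)` has eigenvalue `1`, and the Maslov index counts
the passages of eigenvalues of `W(0,t)` through `1` as `t` varies.

For fixed `t`, Green's identity with two spectral parameters gives `⟨W_ν y', W_μ y⟩ - ⟨y', y⟩ = -i(μ
- ν)⟨B_ν y', B_μ y⟩` (Mathlib's order of entries), where `B_μ y` is the solution attached to `y`.
Hence eigenvalues pass `1` only clockwise as `μ` grows (`MonotoneCurve.crossing`). While an arc `|κ|
≤ ε` stays admissible, the crossings so far plus the eigenvalues with `0 ≤ κ ≤ ε` therefore have a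
constant total (`MonotoneCurve.arcCount_add_crossCount`). Going from a `c` below all eigenvalues up
to `0`, one finds that `Mor(t) + k(t,ε)` is locally constant in `t` (`MonotoneFamily.locConst`,
`TraceFamily.eventually_morseCount_add`), and the Maslov sum telescopes (`MaslovPartition.flow_eq`).
This local bookkeeping replaces homotopy invariance of the Maslov index. Its analytic input is the
stability of eigenvalue counts in an admissible arc (`AdmArc.eventually`).

The remaining input is surjectivity of `A* + V_t - μ` for `μ ≥ κ`: compact resolvent makes the range
closed of finite codimension, and unique continuation kills its orthogonal complement
(`TraceSystem.surjective_perturbed`). Surjectivity makes `K(μ,t)` Lagrangian, makes the trace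
injective on solutions, and yields right inverses that are continuous in `(μ,t)`, hence continuity
of the planes. It is an open condition, so it persists slightly below `κ`, which provides the
starting point `c`. -/

noncomputable section

/-! ### Spectral projections of normal operators. -/

section SpectralProjection

open Filter Topology

variable {Y : Type*} [NormedAddCommGroup Y] [InnerProductSpace ℂ Y] [CompleteSpace Y]

/-- Membership in `s` is locally constant on `K`. -/
def RelClopen (K s : Set ℂ) : Prop :=
  ∀ x ∈ K, ∀ᶠ y in 𝓝[K] x, (y ∈ s ↔ x ∈ s)

/-- Near a point of `K` the indicator is either `f` or zero. This is what lets the continuous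
functional calculus produce spectral projections: only continuity on the spectrum is required. -/
theorem RelClopen.continuousOn_indicator {K s : Set ℂ} (h : RelClopen K s) {f : ℂ → ℂ}
    (hf : ContinuousOn f (K ∩ s)) : ContinuousOn (s.indicator f) K := by
  intro x hx
  by_cases hxs : x ∈ s
  · have h1 : s.indicator f =ᶠ[𝓝[K] x] f := by
      filter_upwards [h x hx] with y hy
      exact Set.indicator_of_mem (hy.2 hxs) f
    have h2 : 𝓝[K] x = 𝓝[K ∩ s] x := by
      apply le_antisymm
      · rw [nhdsWithin_inter', le_inf_iff]
        refine ⟨le_rfl, le_principal_iff.2 ?_⟩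
        filter_upwards [h x hx] with y hy using hy.2 hxs
      · exact nhdsWithin_mono _ Set.inter_subset_left
    have h3 : ContinuousWithinAt f K x := by
      unfold ContinuousWithinAt
      rw [h2]
      exact hf x ⟨hx, hxs⟩
    exact h3.congr_of_eventuallyEq h1 (Set.indicator_of_mem hxs f)
  · have h1 : s.indicator f =ᶠ[𝓝[K] x] fun _ => 0 := by
      filter_upwards [h x hx] with y hy
      exact Set.indicator_of_notMem (fun h => hxs (hy.1 h)) f
    exact continuousWithinAt_const.congr_of_eventuallyEq h1 (Set.indicator_of_notMem hxs f)

theorem RelClopen.compl {K s : Set ℂ} (h : RelClopen K s) : RelClopen K sᶜ := fun x hx => by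
  filter_upwards [h x hx] with y hy
  simp [hy]

theorem RelClopen.singleton {K s : Set ℂ} (h : RelClopen K s) (hfin : (K ∩ s).Finite) {z : ℂ}
    (hz : z ∈ s) : RelClopen K {z} := by
  intro x hx
  by_cases hxz : x = z
  · subst hxz
    have h1 : ∀ᶠ y in 𝓝[K] x, y ∉ (K ∩ s) \ {x} := by
      have : (K ∩ s) \ {x} ∈ {t : Set ℂ | IsClosed t} := (hfin.subset Set.sdiff_subset).isClosed
      exact nhdsWithin_le_nhds (this.isOpen_compl.mem_nhds (by simp))
    filter_upwards [h1, h x hx, self_mem_nhdsWithin] with y h1 h2 h3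
    simp only [Set.mem_singleton_iff, iff_true]
    by_contra hne
    exact h1 ⟨⟨h3, h2.2 hz⟩, hne⟩
  · filter_upwards [nhdsWithin_le_nhds (isOpen_compl_singleton.mem_nhds hxz)] with y hy
    simpa [hxz] using hy

/-- The spectral projection of `W` belonging to `s`. -/
def specProj (W : Y →L[ℂ] Y) (s : Set ℂ) : Y →L[ℂ] Y := cfc (s.indicator (1 : ℂ → ℂ)) W

/-- With `g = √(2 Re f)` one has `g(W)* g(W) = f(W) + f(W)*`, whose quadratic form is twice the real
part of that of `f(W)`. -/
theorem re_inner_cfc_nonneg (W : Y →L[ℂ] Y) [IsStarNormal W] {f : ℂ → ℂ}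
    (hf : ContinuousOn f (spectrum ℂ W)) (h : ∀ z ∈ spectrum ℂ W, 0 ≤ (f z).re) (v : Y) :
    0 ≤ (inner ℂ v (cfc f W v)).re := by
  set g : ℂ → ℂ := fun z => ((Real.sqrt (2 * (f z).re) : ℝ) : ℂ) with hg
  have hgc : ContinuousOn g (spectrum ℂ W) := by
    apply Complex.continuous_ofReal.comp_continuousOn
    apply Real.continuous_sqrt.comp_continuousOn
    exact continuousOn_const.mul (Complex.continuous_re.comp_continuousOn hf)
  have h1 : star (cfc g W) * cfc g W = cfc f W + star (cfc f W) := by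
    rw [← cfc_star, ← cfc_star, ← cfc_mul _ _ W hgc.star hgc,
      ← cfc_add W _ _ hf hf.star]
    apply cfc_congr
    intro z hz
    have := Real.mul_self_sqrt (mul_nonneg zero_le_two (h z hz))
    have key : star (g z) * g z = ((2 * (f z).re : ℝ) : ℂ) := by
      rw [hg, Complex.star_def, Complex.conj_ofReal, ← Complex.ofReal_mul, this]
    simp only [key]
    apply Complex.ext
    · simp [two_mul]
    · simp
  have h2 : (inner ℂ v ((star (cfc g W) * cfc g W) v)).re = ‖cfc g W v‖ ^ 2 := by
    rw [mul_apply_eq_comp, ContinuousLinearMap.star_eq_adjoint,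
      ContinuousLinearMap.adjoint_inner_right]
    have := inner_self_eq_norm_sq (𝕜 := ℂ) (cfc g W v)
    simpa using this
  rw [h1, add_apply, inner_add_right, ContinuousLinearMap.star_eq_adjoint,
    ContinuousLinearMap.adjoint_inner_right, ← inner_conj_symm (cfc f W v) v] at h2
  simp only [Complex.add_re, Complex.conj_re] at h2
  nlinarith [sq_nonneg ‖cfc g W v‖]

section

variable {W : Y →L[ℂ] Y} [IsStarNormal W] {s : Set ℂ}

theorem RelClopen.cont (hs : RelClopen (spectrum ℂ W) s) :
    ContinuousOn (s.indicator (1 : ℂ → ℂ)) (spectrum ℂ W) :=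
  hs.continuousOn_indicator continuousOn_const

theorem cfc_mul_specProj (hs : RelClopen (spectrum ℂ W) s) {f : ℂ → ℂ}
    (hf : ContinuousOn f (spectrum ℂ W)) : cfc f W * specProj W s = cfc (s.indicator f) W := by
  rw [specProj, ← cfc_mul _ _ W hf hs.cont]
  apply cfc_congr
  intro z _
  by_cases hz : z ∈ s <;> simp [hz]

theorem specProj_mul_self (hs : RelClopen (spectrum ℂ W) s) :
    specProj W s * specProj W s = specProj W s := by
  nth_rewrite 1 [specProj]
  rw [cfc_mul_specProj hs hs.cont, specProj]
  refine congrArg (fun f => cfc f W) (funext fun z => ?_)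
  by_cases hz : z ∈ s <;> simp [hz]

theorem specProj_apply_self (hs : RelClopen (spectrum ℂ W) s) (v : Y) :
    specProj W s (specProj W s v) = specProj W s v := by
  rw [← mul_apply_eq_comp, specProj_mul_self hs]

/-- For `z` in the spectrum, `(x - z)⁻¹` cut off to the complement of `s` is continuous on the
spectrum, and its product with `x - z` is the indicator of that complement. So `1 - P` factors
through `W - z`, which kills `y`. For `z` outside the spectrum, `y = 0`. -/
theorem specProj_apply_of_eigen (hs : RelClopen (spectrum ℂ W) s) {z : ℂ} (hz : z ∈ s) {y : Y}
    (hy : W y = z • y) : specProj W s y = y := by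
  by_cases hzs : z ∈ spectrum ℂ W
  swap
  · rw [spectrum.notMem_iff] at hzs
    have h0 : (algebraMap ℂ (Y →L[ℂ] Y) z - W) y = 0 := by
      simp [Algebra.algebraMap_eq_smul_one, hy]
    obtain ⟨u, hu⟩ := hzs
    have : y = 0 := by
      have h1 : (↑u⁻¹ * (u : Y →L[ℂ] Y)) y = 0 := by
        rw [mul_apply_eq_comp, hu, h0, map_zero]
      simpa using h1
    simp [this]
  have hc : ContinuousOn ((sᶜ).indicator fun x => (x - z)⁻¹) (spectrum ℂ W) := by
    apply hs.compl.continuousOn_indicator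
    apply ContinuousOn.inv₀ (by fun_prop)
    rintro x ⟨_, hx⟩ h0
    rw [sub_eq_zero] at h0
    exact hx (h0 ▸ hz)
  have h1 : cfc ((sᶜ).indicator fun x => (x - z)⁻¹) W * (W - algebraMap ℂ _ z) =
      1 - specProj W s := by
    have h2 : W - algebraMap ℂ _ z = cfc (fun x => x - z) W := by
      rw [cfc_sub _ _ W, cfc_id' ℂ W, cfc_const z W]
    rw [h2, ← cfc_mul _ _ W hc, specProj, ← cfc_one ℂ W, ← cfc_sub _ _ W (by fun_prop) hs.cont]
    apply cfc_congr
    intro x _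
    by_cases hx : x ∈ s
    · simp [hx]
    · have : x - z ≠ 0 := fun h0 => hx (by rw [sub_eq_zero.1 h0]; exact hz)
      simp [hx, this]
  have h3 := congrArg (fun T : Y →L[ℂ] Y => T y) h1
  simp only [mul_apply_eq_comp, sub_apply,
    one_apply_eq_self] at h3
  have h4 : W y - (algebraMap ℂ (Y →L[ℂ] Y) z) y = 0 := by
    simp [Algebra.algebraMap_eq_smul_one, hy]
  rw [h4, map_zero] at h3
  exact (sub_eq_zero.1 h3.symm).symm

theorem specProj_singleton_eigen {z : ℂ} (hs : RelClopen (spectrum ℂ W) {z}) (v : Y) :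
    W (specProj W {z} v) = z • specProj W {z} v := by
  have h1 : (W - algebraMap ℂ _ z) * specProj W {z} = 0 := by
    have h2 : W - algebraMap ℂ _ z = cfc (fun x => x - z) W := by
      rw [cfc_sub _ _ W, cfc_id' ℂ W, cfc_const z W]
    rw [h2, cfc_mul_specProj hs (by fun_prop), ← cfc_zero ℂ W]
    apply cfc_congr
    intro x _
    by_cases hx : x = z <;> simp [hx]
  have h3 := congrArg (fun T : Y →L[ℂ] Y => T v) h1
  simp only [mul_apply_eq_comp, sub_apply,
    Algebra.algebraMap_eq_smul_one, smul_apply,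
    one_apply_eq_self, zero_apply] at h3
  exact sub_eq_zero.1 h3

end

/-- `ker (W - z)`. -/
def eigSpace (W : Y →L[ℂ] Y) (z : ℂ) : Submodule ℂ Y :=
  LinearMap.ker ((W - z • ContinuousLinearMap.id ℂ Y : Y →L[ℂ] Y) : Y →ₗ[ℂ] Y)

theorem mem_eigSpace {W : Y →L[ℂ] Y} {z : ℂ} {y : Y} : y ∈ eigSpace W z ↔ W y = z • y := by
  simp [eigSpace, sub_eq_zero]

theorem eigSpace_eq_bot_of_notMem {W : Y →L[ℂ] Y} {z : ℂ} (hz : z ∉ spectrum ℂ W) :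
    eigSpace W z = ⊥ := by
  rw [spectrum.notMem_iff] at hz
  obtain ⟨u, hu⟩ := hz
  rw [eq_bot_iff]
  intro y hy
  rw [mem_eigSpace] at hy
  have h0 : (algebraMap ℂ (Y →L[ℂ] Y) z - W) y = 0 := by
    simp [Algebra.algebraMap_eq_smul_one, hy]
  have h1 : (↑u⁻¹ * (u : Y →L[ℂ] Y)) y = 0 := by
    rw [mul_apply_eq_comp, hu, h0, map_zero]
  simpa using h1

variable {W : Y →L[ℂ] Y} [IsStarNormal W] {s : Set ℂ}

theorem specProj_eq_sum (hs : RelClopen (spectrum ℂ W) s) {Z : Finset ℂ}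
    (hZ : (Z : Set ℂ) = spectrum ℂ W ∩ s) : specProj W s = ∑ z ∈ Z, specProj W {z} := by
  have hfin : (spectrum ℂ W ∩ s).Finite := hZ ▸ Z.finite_toSet
  have hc : ∀ z ∈ Z, ContinuousOn (({z} : Set ℂ).indicator (1 : ℂ → ℂ)) (spectrum ℂ W) := by
    intro z hz
    have : z ∈ spectrum ℂ W ∩ s := hZ ▸ hz
    exact (hs.singleton hfin this.2).cont
  simp only [specProj]
  rw [← cfc_sum _ W Z hc]
  apply cfc_congr
  intro x hx
  rw [Finset.sum_apply]
  by_cases hxs : x ∈ s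
  · have hxZ : x ∈ Z := by
      have : x ∈ (Z : Set ℂ) := hZ ▸ ⟨hx, hxs⟩
      exact this
    rw [Finset.sum_eq_single x]
    · simp [hxs]
    · intro z _ hzx
      simp [hzx.symm]
    · exact fun h => absurd hxZ h
  · rw [Finset.sum_eq_zero]
    · simp [hxs]
    · intro z hz
      have : z ∈ spectrum ℂ W ∩ s := hZ ▸ hz
      have hne : x ≠ z := fun h => hxs (h ▸ this.2)
      simp [hne]

theorem specProj_singleton_of_ne {z z' : ℂ} (hz : RelClopen (spectrum ℂ W) {z})
    (hne : z ≠ z') {y : Y} (hy : W y = z' • y) : specProj W {z} y = 0 := by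
  have h1 := specProj_singleton_eigen hz y
  have h2 : W (specProj W {z} y) = z' • specProj W {z} y := by
    have hcomm : Commute W (specProj W {z}) := by
      rw [specProj]
      have := cfc_commute_cfc (id : ℂ → ℂ) (({z} : Set ℂ).indicator (1 : ℂ → ℂ)) W
      rwa [cfc_id ℂ W] at this
    rw [← mul_apply_eq_comp, hcomm.eq, mul_apply_eq_comp, hy, map_smul]
  have h3 : (z - z') • specProj W {z} y = 0 := by rw [sub_smul, ← h1, ← h2, sub_self]
  exact (smul_eq_zero.1 h3).resolve_left (sub_ne_zero.2 hne)

/-- The range of a spectral projection is the direct sum of the eigenspaces. -/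
def rangeSpecProjEquiv (hs : RelClopen (spectrum ℂ W) s) {Z : Finset ℂ}
    (hZ : (Z : Set ℂ) = spectrum ℂ W ∩ s) :
    LinearMap.range (specProj W s : Y →ₗ[ℂ] Y) ≃ₗ[ℂ] (∀ z : Z, eigSpace W z) := by
  have hfin : (spectrum ℂ W ∩ s).Finite := hZ ▸ Z.finite_toSet
  have hmem : ∀ z : Z, (z : ℂ) ∈ spectrum ℂ W ∩ s := fun z => hZ ▸ z.2
  have hcl : ∀ z : Z, RelClopen (spectrum ℂ W) {(z : ℂ)} :=
    fun z => hs.singleton hfin (hmem z).2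
  let f : LinearMap.range (specProj W s : Y →ₗ[ℂ] Y) →ₗ[ℂ] (∀ z : Z, eigSpace W z) :=
    LinearMap.pi fun z => LinearMap.codRestrict _
      ((specProj W {(z : ℂ)} : Y →ₗ[ℂ] Y) ∘ₗ Submodule.subtype _)
      fun v => mem_eigSpace.2 (specProj_singleton_eigen (hcl z) _)
  have hf : ∀ v z, (f v z : Y) = specProj W {(z : ℂ)} (v : Y) := fun v z => rfl
  refine LinearEquiv.ofBijective f ⟨fun v w hvw => Subtype.ext ?_, fun v => ?_⟩
  · have h1 : ∀ v : LinearMap.range (specProj W s : Y →ₗ[ℂ] Y), (v : Y) = ∑ z : Z, (f v z : Y) := by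
      intro v
      obtain ⟨u, hu⟩ := v.2
      have h1 : specProj W s v = v := by
        rw [← hu]
        exact specProj_apply_self hs u
      have h2 := congrArg (fun T : Y →L[ℂ] Y => T v) (specProj_eq_sum hs hZ)
      simp only [sum_apply, h1] at h2
      exact h2.trans (Finset.sum_coe_sort Z fun z => specProj W {z} (v : Y)).symm
    rw [h1 v, h1 w, hvw]
  · refine ⟨⟨∑ z : Z, (v z : Y), ∑ z : Z, (v z : Y), ?_⟩, funext fun z => Subtype.ext ?_⟩
    · rw [map_sum]
      refine Finset.sum_congr rfl fun z _ => ?_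
      exact specProj_apply_of_eigen hs (hmem z).2 (mem_eigSpace.1 (v z).2)
    · rw [hf]
      simp only [map_sum]
      rw [Finset.sum_eq_single z]
      · exact specProj_apply_of_eigen (hcl z) rfl (mem_eigSpace.1 (v z).2)
      · intro z' _ hne
        exact specProj_singleton_of_ne (hcl z) (fun h => hne (Subtype.ext h.symm))
          (mem_eigSpace.1 (v z').2)
      · exact fun h => absurd (Finset.mem_univ z) h

theorem finiteDimensional_range_specProj (hs : RelClopen (spectrum ℂ W) s) {Z : Finset ℂ}
    (hZ : (Z : Set ℂ) = spectrum ℂ W ∩ s) (hf : ∀ z ∈ Z, FiniteDimensional ℂ (eigSpace W z)) :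
    FiniteDimensional ℂ (LinearMap.range (specProj W s : Y →ₗ[ℂ] Y)) := by
  have : ∀ z : Z, FiniteDimensional ℂ (eigSpace W z) := fun z => hf z z.2
  exact (rangeSpecProjEquiv hs hZ).symm.finiteDimensional

theorem finrank_range_specProj (hs : RelClopen (spectrum ℂ W) s) {Z : Finset ℂ}
    (hZ : (Z : Set ℂ) = spectrum ℂ W ∩ s) (hf : ∀ z ∈ Z, FiniteDimensional ℂ (eigSpace W z)) :
    Module.finrank ℂ (LinearMap.range (specProj W s : Y →ₗ[ℂ] Y)) =
      ∑ z ∈ Z, Module.finrank ℂ (eigSpace W z) := by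
  have : ∀ z : Z, FiniteDimensional ℂ (eigSpace W z) := fun z => hf z z.2
  rw [(rangeSpecProjEquiv hs hZ).finrank_eq, Module.finrank_pi_fintype]
  exact Finset.sum_coe_sort Z fun z => Module.finrank ℂ (eigSpace W z)

/-- Polynomials form an infinite-dimensional space, so some `q ≠ 0` has zero compression of `q(W)`
to the finite-dimensional range. Then `q` vanishes on the part of the spectrum in `s`, which thus
consists of roots of `q`. -/
theorem finite_spectrum_inter (hs : RelClopen (spectrum ℂ W) s)
    [hfd : FiniteDimensional ℂ (LinearMap.range (specProj W s : Y →ₗ[ℂ] Y))] :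
    (spectrum ℂ W ∩ s).Finite := by
  set E := LinearMap.range (specProj W s : Y →ₗ[ℂ] Y) with hE
  let Θ : Polynomial ℂ →ₗ[ℂ] (E →ₗ[ℂ] E) :=
    { toFun := fun q => (specProj W s : Y →ₗ[ℂ] Y).rangeRestrict ∘ₗ
        ((Polynomial.aeval W q : Y →L[ℂ] Y) : Y →ₗ[ℂ] Y) ∘ₗ E.subtype
      map_add' := by intro p q; ext; simp
      map_smul' := by intro p q; ext; simp }
  have hni : ¬ Function.Injective Θ := by
    intro hi
    have : FiniteDimensional ℂ (Polynomial ℂ) := FiniteDimensional.of_injective Θ hi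
    exact Polynomial.not_finite this
  obtain ⟨q, hq, hq0⟩ : ∃ q, Θ q = 0 ∧ q ≠ 0 := by
    rw [← LinearMap.ker_eq_bot, Submodule.eq_bot_iff] at hni
    push Not at hni
    exact hni
  have h1 : specProj W s * (Polynomial.aeval W q * specProj W s) = 0 := by
    ext v
    have := congrArg (fun T : E →ₗ[ℂ] E => ((T ⟨specProj W s v, v, rfl⟩ : E) : Y)) hq
    simpa [Θ] using this
  have h2 : cfc (s.indicator q.eval) W = 0 := by
    rw [← h1, ← cfc_polynomial q W, cfc_mul_specProj hs (by fun_prop)]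
    rw [specProj, ← cfc_mul _ _ W hs.cont (hs.continuousOn_indicator (by fun_prop))]
    apply cfc_congr
    intro x _
    by_cases hx : x ∈ s <;> simp [hx]
  have h3 : (spectrum ℂ W).EqOn (s.indicator q.eval) 0 := by
    apply eqOn_of_cfc_eq_cfc (a := W) (f := s.indicator q.eval) (g := 0) _
      (hs.continuousOn_indicator (by fun_prop)) continuousOn_const
    rw [h2]
    exact (cfc_zero ℂ W).symm
  refine (q.roots.toFinset.finite_toSet).subset ?_
  rintro x ⟨hx, hxs⟩
  have := h3 hx
  simp only [Set.indicator_of_mem hxs, Pi.zero_apply] at this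
  simp [hq0, this]

end SpectralProjection

/-! ### Quadratic form bounds on spectral subspaces of half planes. -/

section LevelSets

open Filter Topology ComplexConjugate

variable {Y : Type*} [NormedAddCommGroup Y] [InnerProductSpace ℂ Y] [CompleteSpace Y]

theorem specProj_compl {W : Y →L[ℂ] Y} [IsStarNormal W] {s : Set ℂ}
    (hs : RelClopen (spectrum ℂ W) s) : specProj W sᶜ = 1 - specProj W s := by
  rw [specProj, specProj, ← cfc_one ℂ W, ← cfc_sub _ _ W (by fun_prop) hs.cont]
  apply cfc_congr
  intro x _
  by_cases hx : x ∈ s <;> simp [hx]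

/-- The half plane `{z | s ≤ Re (c̄ z)}`. -/
def halfPlane (c : ℂ) (s : ℝ) : Set ℂ := {z | s ≤ (conj c * z).re}

theorem relClopen_halfPlane {K : Set ℂ} {c : ℂ} {s : ℝ} (h : ∀ x ∈ K, (conj c * x).re ≠ s) :
    RelClopen K (halfPlane c s) := by
  intro x hx
  have hc : Continuous fun z : ℂ => (conj c * z).re := by fun_prop
  rcases lt_or_gt_of_ne (h x hx) with h1 | h1
  · filter_upwards [nhdsWithin_le_nhds (hc.continuousAt.eventually_lt_const h1)] with y hy
    simp only [halfPlane, Set.mem_ofPred_eq]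
    exact ⟨fun h => absurd h (not_le.2 hy), fun h => absurd h (not_le.2 h1)⟩
  · filter_upwards [nhdsWithin_le_nhds (hc.continuousAt.eventually_const_lt h1)] with y hy
    simp only [halfPlane, Set.mem_ofPred_eq]
    exact ⟨fun _ => h1.le, fun _ => hy.le⟩

/-- Positivity of the functional calculus for `c̄ z - (s + δ)` cut off to the half plane. Together
with the opposite bound on the kernel of the projection, it allows spectral subspaces of two nearby
operators to be compared through quadratic forms alone. -/
theorem mul_norm_sq_le_of_specProj_eq {W : Y →L[ℂ] Y} [IsStarNormal W] {c : ℂ} {s δ : ℝ}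
    (h : ∀ x ∈ spectrum ℂ W, (conj c * x).re ≠ s)
    (hδ : ∀ x ∈ spectrum ℂ W, δ ≤ |(conj c * x).re - s|) {v : Y}
    (hv : specProj W (halfPlane c s) v = v) :
    (s + δ) * ‖v‖ ^ 2 ≤ (inner ℂ v (conj c • W v)).re := by
  have hs := relClopen_halfPlane h
  have hf : ContinuousOn (fun z : ℂ => conj c * z - ((s + δ : ℝ) : ℂ)) (spectrum ℂ W) := by
    fun_prop
  have h1 := re_inner_cfc_nonneg W (hs.continuousOn_indicator (hf.mono Set.inter_subset_left))
    (fun z hz => by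
      by_cases hzs : z ∈ halfPlane c s
      · have h2 := hδ z hz
        have h3 : s ≤ (conj c * z).re := hzs
        rw [abs_of_nonneg (sub_nonneg.2 h3)] at h2
        rw [Set.indicator_of_mem hzs, Complex.sub_re, Complex.ofReal_re]
        linarith
      · simp [hzs]) v
  rw [← cfc_mul_specProj hs hf, mul_apply_eq_comp, hv,
    cfc_sub (a := W) (fun z => conj c * z) (fun _ => ((s + δ : ℝ) : ℂ)), cfc_const_mul_id _ W,
    cfc_const _ W, sub_apply, smul_apply, Algebra.algebraMap_eq_smul_one, smul_apply,
    one_apply_eq_self, inner_sub_right, inner_smul_right v v, inner_self_eq_norm_sq_to_K,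
    Complex.sub_re] at h1
  have h2 : ((((s + δ : ℝ) : ℂ)) * ((‖v‖ : ℝ) : ℂ) ^ 2).re = (s + δ) * ‖v‖ ^ 2 := by
    rw [← Complex.ofReal_pow, ← Complex.ofReal_mul, Complex.ofReal_re]
  have h3 := h2 ▸ h1
  linarith [h3]

theorem le_mul_norm_sq_of_specProj_eq_zero {W : Y →L[ℂ] Y} [IsStarNormal W] {c : ℂ} {s δ : ℝ}
    (h : ∀ x ∈ spectrum ℂ W, (conj c * x).re ≠ s)
    (hδ : ∀ x ∈ spectrum ℂ W, δ ≤ |(conj c * x).re - s|) {v : Y}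
    (hv : specProj W (halfPlane c s) v = 0) :
    (inner ℂ v (conj c • W v)).re ≤ (s - δ) * ‖v‖ ^ 2 := by
  have hs := relClopen_halfPlane h
  have hv' : specProj W (halfPlane c s)ᶜ v = v := by
    rw [specProj_compl hs, sub_apply, hv, one_apply_eq_self, sub_zero]
  have hf : ContinuousOn (fun z : ℂ => ((s - δ : ℝ) : ℂ) - conj c * z) (spectrum ℂ W) := by
    fun_prop
  have h1 := re_inner_cfc_nonneg W
    (hs.compl.continuousOn_indicator (hf.mono Set.inter_subset_left))
    (fun z hz => by
      by_cases hzs : z ∈ halfPlane c s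
      · simp [hzs]
      · have h2 := hδ z hz
        have h3 : (conj c * z).re < s := not_le.1 hzs
        rw [abs_of_neg (sub_neg.2 h3)] at h2
        rw [Set.indicator_of_mem (show z ∈ (halfPlane c s)ᶜ from hzs), Complex.sub_re,
          Complex.ofReal_re]
        linarith) v
  rw [← cfc_mul_specProj hs.compl hf, mul_apply_eq_comp, hv',
    cfc_sub (a := W) (fun _ => ((s - δ : ℝ) : ℂ)) (fun z => conj c * z), cfc_const_mul_id _ W,
    cfc_const _ W, sub_apply, smul_apply, Algebra.algebraMap_eq_smul_one, smul_apply,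
    one_apply_eq_self, inner_sub_right, inner_smul_right v v, inner_self_eq_norm_sq_to_K,
    Complex.sub_re] at h1
  have h2 : ((((s - δ : ℝ) : ℂ)) * ((‖v‖ : ℝ) : ℂ) ^ 2).re = (s - δ) * ‖v‖ ^ 2 := by
    rw [← Complex.ofReal_pow, ← Complex.ofReal_mul, Complex.ofReal_re]
  have h3 := h2 ▸ h1
  linarith [h3]

end LevelSets

/-! ### Arcs of the unit circle and stability of eigenvalue counts. -/

section Arcs

open Filter Topology ComplexConjugate

theorem conj_circlePt_mul_re (m κ : ℝ) : (conj (circlePt m) * circlePt κ).re = Real.cos (κ - m) := by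
  have : conj (circlePt m) * circlePt κ = Complex.exp (((κ - m : ℝ) : ℂ) * Complex.I) := by
    rw [circlePt, circlePt, ← Complex.exp_conj, ← Complex.exp_add]
    congr 1
    simp
    ring
  rw [this, Complex.exp_ofReal_mul_I_re]

theorem norm_circlePt (κ : ℝ) : ‖circlePt κ‖ = 1 := Complex.norm_exp_ofReal_mul_I κ

theorem circlePt_zero : circlePt 0 = 1 := by simp [circlePt]

theorem injOn_circlePt {a b : ℝ} (hab : b - a < 2 * Real.pi) : Set.InjOn circlePt (Set.Icc a b) := by
  intro x hx y hy hxy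
  obtain ⟨n, hn⟩ := Complex.exp_eq_exp_iff_exists_int.1 hxy
  have h1 : x = y + n * (2 * Real.pi) := by
    have := congrArg Complex.im hn
    simpa using this
  have h2 : |(n : ℝ)| * (2 * Real.pi) < 1 * (2 * Real.pi) := by
    rw [one_mul, ← abs_of_pos Real.two_pi_pos, ← abs_mul, abs_of_pos Real.two_pi_pos, abs_lt]
    constructor <;> linarith [hx.1, hx.2, hy.1, hy.2]
  have h3 : |(n : ℝ)| < 1 := lt_of_mul_lt_mul_right h2 Real.two_pi_pos.le
  have h4 : n = 0 := by
    have : |n| < 1 := by exact_mod_cast h3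
    exact Int.abs_lt_one_iff.1 this
  simpa [h4] using h1

/-- An arc shorter than the circle is the part of the circle in a half plane whose normal points to
the midpoint of the arc. This turns arcs into level sets of a real linear function, to which the
quadratic form bounds apply. -/
theorem circlePt_mem_halfPlane {a b κ : ℝ} (hab : b - a < 2 * Real.pi) (hκ : κ ∈ Set.Icc a b) :
    circlePt κ ∈ halfPlane (circlePt ((a + b) / 2)) (Real.cos ((b - a) / 2)) := by
  change _ ≤ (conj (circlePt ((a + b) / 2)) * circlePt κ).re
  rw [conj_circlePt_mul_re, ← Real.cos_abs (κ - _)]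
  apply Real.cos_le_cos_of_nonneg_of_le_pi (abs_nonneg _) (by linarith)
  rw [abs_le]
  constructor <;> linarith [hκ.1, hκ.2]

theorem exists_circlePt_of_mem_halfPlane {a b : ℝ} (hle : a ≤ b)
    {z : ℂ} (hz : ‖z‖ = 1)
    (hm : z ∈ halfPlane (circlePt ((a + b) / 2)) (Real.cos ((b - a) / 2))) :
    ∃ κ ∈ Set.Icc a b, circlePt κ = z := by
  set m := (a + b) / 2 with hmdef
  set w := conj (circlePt m) * z with hw
  have hw1 : ‖w‖ = 1 := by rw [hw, norm_mul, RCLike.norm_conj, norm_circlePt, hz, one_mul]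
  have hwc : w = circlePt w.arg := by
    have := Complex.norm_mul_exp_arg_mul_I w
    rw [hw1] at this
    simpa [circlePt] using this.symm
  have hz2 : z = circlePt (w.arg + m) := by
    have h1 : circlePt m * w = z := by
      rw [hw, ← mul_assoc, Complex.mul_conj, Complex.normSq_eq_norm_sq, norm_circlePt]
      simp
    rw [← h1]
    nth_rewrite 1 [hwc]
    rw [circlePt, circlePt, circlePt, ← Complex.exp_add]
    congr 1
    push_cast
    ring
  have h2 : Real.cos ((b - a) / 2) ≤ Real.cos |w.arg| := by
    have h3 : Real.cos ((b - a) / 2) ≤ w.re := hm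
    rw [hwc, circlePt, Complex.exp_ofReal_mul_I_re] at h3
    rwa [Real.cos_abs]
  have h4 : |w.arg| ≤ (b - a) / 2 := by
    by_contra hlt
    have := Real.cos_lt_cos_of_nonneg_of_le_pi (by linarith) (Complex.abs_arg_le_pi w)
      (not_le.1 hlt)
    linarith
  rw [abs_le] at h4
  exact ⟨w.arg + m, ⟨by linarith [h4.1], by linarith [h4.2]⟩, hz2.symm⟩

theorem eq_circlePt_of_re_eq {a b : ℝ} (hle : a ≤ b) (hab : b - a < 2 * Real.pi)
    {z : ℂ} (hz : ‖z‖ = 1)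
    (hm : (conj (circlePt ((a + b) / 2)) * z).re = Real.cos ((b - a) / 2)) :
    z = circlePt a ∨ z = circlePt b := by
  obtain ⟨κ, hκ, rfl⟩ := exists_circlePt_of_mem_halfPlane hle hz hm.ge
  rw [conj_circlePt_mul_re, ← Real.cos_abs (κ - _)] at hm
  have h1 : |κ - (a + b) / 2| ≤ (b - a) / 2 := by
    rw [abs_le]
    constructor <;> linarith [hκ.1, hκ.2]
  have h2 := Real.injOn_cos ⟨abs_nonneg _, by linarith⟩ ⟨by linarith, by linarith⟩ hm
  rcases abs_cases (κ - (a + b) / 2) with h3 | h3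
  · right; congr 1; linarith [h3.1]
  · left; congr 1; linarith [h3.1]

/-- The end points of the closed arc `{e^{iκ} : a ≤ κ ≤ b}` are not in the spectrum of `W`, and the
part of the spectrum in the arc is a finite set of points with finite-dimensional eigenspaces. -/
def AdmArc {Y : Type*} [NormedAddCommGroup Y] [NormedSpace ℂ Y] (W : Y →L[ℂ] Y) (a b : ℝ) : Prop :=
  circlePt b ∉ spectrum ℂ W ∧ circlePt a ∉ spectrum ℂ W ∧
  {κ : ℝ | κ ∈ Set.Icc a b ∧ circlePt κ ∈ spectrum ℂ W}.Finite ∧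
  ∀ κ ∈ Set.Icc a b, FiniteDimensional ℂ (circleEigenspace W κ)

/-- The number of eigenvalues `e^{iκ}`, `κ ∈ s`, counted with multiplicity. -/
def eigCount {Y : Type*} [NormedAddCommGroup Y] [NormedSpace ℂ Y] (W : Y →L[ℂ] Y)
    (s : Set ℝ) : ℕ :=
  ∑ᶠ κ ∈ s, Module.finrank ℂ (circleEigenspace W κ)

variable {Y : Type*} [NormedAddCommGroup Y] [InnerProductSpace ℂ Y] [CompleteSpace Y]

theorem norm_eq_one_of_mem_spectrum {W : Y →L[ℂ] Y} (hW : W ∈ unitary (Y →L[ℂ] Y)) {z : ℂ}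
    (hz : z ∈ spectrum ℂ W) : ‖z‖ = 1 := by
  have := spectrum.subset_circle_of_unitary hW hz
  simpa using this

variable {W : Y →L[ℂ] Y} {a b : ℝ}

theorem re_ne_of_notMem_spectrum (hW : W ∈ unitary (Y →L[ℂ] Y)) (hle : a ≤ b)
    (hab : b - a < 2 * Real.pi) (ha : circlePt a ∉ spectrum ℂ W) (hb : circlePt b ∉ spectrum ℂ W) :
    ∀ x ∈ spectrum ℂ W, (conj (circlePt ((a + b) / 2)) * x).re ≠ Real.cos ((b - a) / 2) := by
  intro x hx h
  rcases eq_circlePt_of_re_eq hle hab (norm_eq_one_of_mem_spectrum hW hx) h with rfl | rfl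
  · exact ha hx
  · exact hb hx

theorem spectrum_inter_halfPlane (hW : W ∈ unitary (Y →L[ℂ] Y)) (hle : a ≤ b)
    (hab : b - a < 2 * Real.pi) :
    spectrum ℂ W ∩ halfPlane (circlePt ((a + b) / 2)) (Real.cos ((b - a) / 2)) =
      circlePt '' {κ : ℝ | κ ∈ Set.Icc a b ∧ circlePt κ ∈ spectrum ℂ W} := by
  ext z
  constructor
  · rintro ⟨hz, hm⟩
    obtain ⟨κ, hκ, rfl⟩ :=
      exists_circlePt_of_mem_halfPlane hle (norm_eq_one_of_mem_spectrum hW hz) hm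
    exact ⟨κ, ⟨hκ, hz⟩, rfl⟩
  · rintro ⟨κ, ⟨hκ, hz⟩, rfl⟩
    exact ⟨hz, circlePt_mem_halfPlane hab hκ⟩

/-- The spectral projection belonging to the arc `{e^{iκ} : a ≤ κ ≤ b}`. -/
def arcProj (W : Y →L[ℂ] Y) (a b : ℝ) : Y →L[ℂ] Y :=
  specProj W (halfPlane (circlePt ((a + b) / 2)) (Real.cos ((b - a) / 2)))

theorem AdmArc.finrank_range (h : AdmArc W a b) (hW : W ∈ unitary (Y →L[ℂ] Y)) (hle : a ≤ b)
    (hab : b - a < 2 * Real.pi) :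
    FiniteDimensional ℂ (LinearMap.range (arcProj W a b : Y →ₗ[ℂ] Y)) ∧
    Module.finrank ℂ (LinearMap.range (arcProj W a b : Y →ₗ[ℂ] Y)) =
      eigCount W (Set.Icc a b) := by
  have : IsStarNormal W := isStarNormal_of_mem_unitary hW
  obtain ⟨hb, ha, hfin, hfd⟩ := h
  have hs := relClopen_halfPlane (re_ne_of_notMem_spectrum hW hle hab ha hb)
  have hset := spectrum_inter_halfPlane hW hle hab
  have hZ : ((hfin.image circlePt).toFinset : Set ℂ) =
      spectrum ℂ W ∩ halfPlane (circlePt ((a + b) / 2)) (Real.cos ((b - a) / 2)) := by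
    rw [hset, Set.Finite.coe_toFinset]
  have hfd' : ∀ z ∈ (hfin.image circlePt).toFinset, FiniteDimensional ℂ (eigSpace W z) := by
    intro z hz
    rw [Set.Finite.mem_toFinset] at hz
    obtain ⟨κ, hκ, rfl⟩ := hz
    exact hfd κ hκ.1
  refine ⟨finiteDimensional_range_specProj hs hZ hfd', ?_⟩
  have himage : eigCount W (Set.Icc a b) =
      ∑ᶠ z ∈ circlePt '' Set.Icc a b, Module.finrank ℂ (eigSpace W z) :=
    (finsum_mem_image (f := fun z => Module.finrank ℂ (eigSpace W z)) (injOn_circlePt hab)).symm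
  rw [arcProj, finrank_range_specProj hs hZ hfd', himage]
  symm
  apply finsum_mem_eq_sum_of_subset
  · rintro _ ⟨⟨κ, hκ, rfl⟩, hsupp⟩
    rw [Set.Finite.coe_toFinset]
    refine ⟨κ, ⟨hκ, ?_⟩, rfl⟩
    by_contra hns
    apply hsupp
    exact (congrArg (fun S : Submodule ℂ Y => Module.finrank ℂ S)
      (eigSpace_eq_bot_of_notMem hns)).trans (finrank_bot ℂ Y)
  · rw [Set.Finite.coe_toFinset]
    exact Set.image_mono fun κ hκ => hκ.1

theorem admArc_of_finiteDimensional (hW : W ∈ unitary (Y →L[ℂ] Y)) (hle : a ≤ b)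
    (hab : b - a < 2 * Real.pi) (ha : circlePt a ∉ spectrum ℂ W) (hb : circlePt b ∉ spectrum ℂ W)
    [FiniteDimensional ℂ (LinearMap.range (arcProj W a b : Y →ₗ[ℂ] Y))] : AdmArc W a b := by
  have : IsStarNormal W := isStarNormal_of_mem_unitary hW
  have hs := relClopen_halfPlane (re_ne_of_notMem_spectrum hW hle hab ha hb)
  refine ⟨hb, ha, ?_, fun κ hκ => ?_⟩
  · have h1 := finite_spectrum_inter hs (hfd := ‹_›)
    rw [spectrum_inter_halfPlane hW hle hab] at h1
    exact h1.of_finite_image ((injOn_circlePt hab).mono fun κ hκ => hκ.1)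
  · apply Submodule.finiteDimensional_of_le
      (S₂ := LinearMap.range (arcProj W a b : Y →ₗ[ℂ] Y))
    intro y hy
    exact ⟨y, specProj_apply_of_eigen hs (circlePt_mem_halfPlane hab hκ) (mem_eigSpace.1 hy)⟩

/-- The hypothesis says that `P₀` is injective on the range of `P`. -/
theorem finrank_range_le_of_forall {P P₀ : Y →L[ℂ] Y} (hP : ∀ v, P (P v) = P v)
    [FiniteDimensional ℂ (LinearMap.range (P₀ : Y →ₗ[ℂ] Y))]
    (h : ∀ v, P v = v → P₀ v = 0 → v = 0) :
    FiniteDimensional ℂ (LinearMap.range (P : Y →ₗ[ℂ] Y)) ∧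
    Module.finrank ℂ (LinearMap.range (P : Y →ₗ[ℂ] Y)) ≤
      Module.finrank ℂ (LinearMap.range (P₀ : Y →ₗ[ℂ] Y)) := by
  let f : LinearMap.range (P : Y →ₗ[ℂ] Y) →ₗ[ℂ] LinearMap.range (P₀ : Y →ₗ[ℂ] Y) :=
    (P₀ : Y →ₗ[ℂ] Y).rangeRestrict ∘ₗ Submodule.subtype _
  have hf : Function.Injective f := by
    rw [← LinearMap.ker_eq_bot, Submodule.eq_bot_iff]
    rintro ⟨_, u, rfl⟩ hv
    apply Subtype.ext
    exact h _ (hP u) (congrArg Subtype.val hv)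
  have := FiniteDimensional.of_injective f hf
  exact ⟨this, LinearMap.finrank_le_finrank_of_injective hf⟩

theorem eventually_notMem_spectrum {z : ℂ} (hz : z ∉ spectrum ℂ W) :
    ∀ᶠ W' in 𝓝 W, z ∉ spectrum ℂ W' := by
  have hc : Continuous fun W' : Y →L[ℂ] Y => algebraMap ℂ (Y →L[ℂ] Y) z - W' := by fun_prop
  rw [spectrum.notMem_iff] at hz
  filter_upwards [hc.continuousAt.eventually (Units.isOpen.mem_nhds hz)] with W' hW'
  rw [spectrum.notMem_iff]
  exact hW'

/-- Local constancy of the number of eigenvalues in an arc. -/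
theorem AdmArc.eventually (h : AdmArc W a b) (hW : W ∈ unitary (Y →L[ℂ] Y)) (hle : a ≤ b)
    (hab : b - a < 2 * Real.pi) :
    ∀ᶠ W' in 𝓝 W, W' ∈ unitary (Y →L[ℂ] Y) →
      AdmArc W' a b ∧ eigCount W' (Set.Icc a b) = eigCount W (Set.Icc a b) := by
  have hn : IsStarNormal W := isStarNormal_of_mem_unitary hW
  obtain ⟨hfd, hrank⟩ := h.finrank_range hW hle hab
  have hne := re_ne_of_notMem_spectrum hW hle hab h.2.1 h.1
  set c := circlePt ((a + b) / 2) with hc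
  set s := Real.cos ((b - a) / 2) with hs
  -- Distance from the compact spectrum to the bounding line of the half plane; the line meets the
  -- circle only in the end points of the arc.
  obtain ⟨δ, hδ0, hδ⟩ : ∃ δ > 0, ∀ x ∈ spectrum ℂ W, δ ≤ |(conj c * x).re - s| := by
    rcases (spectrum ℂ W).eq_empty_or_nonempty with he | hnon
    · exact ⟨1, one_pos, by simp [he]⟩
    · have hcont : ContinuousOn (fun x : ℂ => |(conj c * x).re - s|) (spectrum ℂ W) := by
        fun_prop
      obtain ⟨x, hx, hmin⟩ := (spectrum.isCompact W).exists_isMinOn hnon hcont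
      exact ⟨_, abs_pos.2 (sub_ne_zero.2 (hne x hx)), fun y hy => hmin hy⟩
  filter_upwards [eventually_notMem_spectrum h.1, eventually_notMem_spectrum h.2.1,
    Metric.ball_mem_nhds W hδ0] with W' hb ha hball hW'
  have hn' : IsStarNormal W' := isStarNormal_of_mem_unitary hW'
  rw [mem_ball_iff_norm] at hball
  have hne' := re_ne_of_notMem_spectrum hW' hle hab ha hb
  have hdiff : ∀ v : Y, |(inner ℂ v (conj c • W' v)).re - (inner ℂ v (conj c • W v)).re| ≤
      ‖W' - W‖ * ‖v‖ ^ 2 := by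
    intro v
    rw [← Complex.sub_re, ← inner_sub_right, ← smul_sub]
    calc _ ≤ ‖inner ℂ v (conj c • (W' v - W v))‖ := Complex.abs_re_le_norm _
      _ ≤ ‖v‖ * ‖conj c • (W' v - W v)‖ := norm_inner_le_norm _ _
      _ = ‖v‖ * ‖(W' - W) v‖ := by
        rw [norm_smul, RCLike.norm_conj, hc, norm_circlePt, one_mul, sub_apply]
      _ ≤ ‖v‖ * (‖W' - W‖ * ‖v‖) := by gcongr; exact ContinuousLinearMap.le_opNorm _ _
      _ = _ := by ring
  have hgap' : ∀ x ∈ spectrum ℂ W', 0 ≤ |(conj c * x).re - s| := fun x _ => abs_nonneg _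
  have hv0 : ∀ v : Y, δ * ‖v‖ ^ 2 ≤ ‖W' - W‖ * ‖v‖ ^ 2 → v = 0 := by
    intro v hv
    by_contra hne0
    have : 0 < ‖v‖ ^ 2 := by positivity
    exact absurd (le_of_mul_le_mul_right hv this) (not_le.2 hball)
  -- The form of `W'` is at least `s` on the range of its projection, the form of `W` is at most `s
  -- - δ` on the kernel of its own, and the two forms differ by less than `δ`. The same works with
  -- the roles exchanged, so the two ranges have equal dimension.
  have h1 : ∀ v, arcProj W' a b v = v → arcProj W a b v = 0 → v = 0 := by
    intro v h2 h3
    have h4 := mul_norm_sq_le_of_specProj_eq hne' hgap' h2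
    have h5 := le_mul_norm_sq_of_specProj_eq_zero hne hδ h3
    apply hv0
    have := (abs_le.1 (hdiff v)).2
    nlinarith
  have h1' : ∀ v, arcProj W a b v = v → arcProj W' a b v = 0 → v = 0 := by
    intro v h2 h3
    have h4 := mul_norm_sq_le_of_specProj_eq hne hδ h2
    have h5 := le_mul_norm_sq_of_specProj_eq_zero hne' hgap' h3
    apply hv0
    have := (abs_le.1 (hdiff v)).1
    nlinarith
  obtain ⟨hfd', hle1⟩ := finrank_range_le_of_forall (P := arcProj W' a b) (P₀ := arcProj W a b)
    (specProj_apply_self (relClopen_halfPlane hne')) h1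
  obtain ⟨-, hle2⟩ := finrank_range_le_of_forall (P := arcProj W a b) (P₀ := arcProj W' a b)
    (specProj_apply_self (relClopen_halfPlane hne)) h1'
  have hadm := admArc_of_finiteDimensional hW' hle hab ha hb
  refine ⟨hadm, ?_⟩
  rw [← (hadm.finrank_range hW' hle hab).2, ← hrank]
  exact le_antisymm hle1 hle2

end Arcs

/-! ### Counting eigenvalues in arcs. -/

section Counting

open Filter Topology

variable {Y : Type*} [NormedAddCommGroup Y] [InnerProductSpace ℂ Y] [CompleteSpace Y]
  {W : Y →L[ℂ] Y} {a b : ℝ}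

theorem circleEigenspace_eq_bot_of_notMem {κ : ℝ} (h : circlePt κ ∉ spectrum ℂ W) :
    circleEigenspace W κ = ⊥ := eigSpace_eq_bot_of_notMem h

theorem finrank_circleEigenspace_of_eq_bot {κ : ℝ} (h : circleEigenspace W κ = ⊥) :
    Module.finrank ℂ (circleEigenspace W κ) = 0 := by
  rw [h, finrank_bot]

theorem mem_circleEigenspace {κ : ℝ} {y : Y} :
    y ∈ circleEigenspace W κ ↔ W y = circlePt κ • y := mem_eigSpace (z := circlePt κ)

theorem AdmArc.mono (h : AdmArc W a b) {a' b' : ℝ} (ha : a ≤ a') (hb : b' ≤ b)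
    (ha' : circlePt a' ∉ spectrum ℂ W) (hb' : circlePt b' ∉ spectrum ℂ W) : AdmArc W a' b' := by
  have hsub : Set.Icc a' b' ⊆ Set.Icc a b := Set.Icc_subset_Icc ha hb
  exact ⟨hb', ha', h.2.2.1.subset fun κ hκ => ⟨hsub hκ.1, hκ.2⟩, fun κ hκ => h.2.2.2 κ (hsub hκ)⟩

theorem AdmArc.exists_isolating {ε : ℝ} (h : AdmArc W (-ε) ε) (hε : 0 < ε) :
    ∃ ε' ∈ Set.Ioo 0 ε, AdmArc W (-ε') ε' ∧ AdmArc W ε' ε ∧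
      ∀ κ ∈ Set.Icc (-ε') ε', circlePt κ ∈ spectrum ℂ W → κ = 0 := by
  -- The point `ε` is added to the points to be avoided so that the radius found below is at most
  -- `ε`.
  have hfin : (({κ : ℝ | κ ∈ Set.Icc (-ε) ε ∧ circlePt κ ∈ spectrum ℂ W} ∪ {ε}) \ {0}).Finite :=
    (h.2.2.1.union (Set.finite_singleton ε)).subset Set.sdiff_subset
  have hopen : (({κ : ℝ | κ ∈ Set.Icc (-ε) ε ∧ circlePt κ ∈ spectrum ℂ W} ∪ {ε}) \ {0})ᶜ ∈ 𝓝 (0 : ℝ) :=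
    hfin.isClosed.isOpen_compl.mem_nhds (by simp)
  obtain ⟨r, hr, hball⟩ := Metric.mem_nhds_iff.1 hopen
  have hrε : r ≤ ε := by
    by_contra hlt
    have : ε ∈ Metric.ball (0 : ℝ) r := by
      rw [Metric.mem_ball, Real.dist_eq, sub_zero, abs_of_pos hε]
      linarith
    exact hball this ⟨Or.inr rfl, hε.ne'⟩
  have key : ∀ κ ∈ Set.Icc (-(r / 2)) (r / 2), circlePt κ ∈ spectrum ℂ W → κ = 0 := by
    intro κ hκ hs
    by_contra hne
    have : κ ∈ Metric.ball (0 : ℝ) r := by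
      rw [Metric.mem_ball, Real.dist_eq, sub_zero, abs_lt]
      constructor <;> linarith [hκ.1, hκ.2]
    exact hball this ⟨Or.inl ⟨⟨by linarith [hκ.1], by linarith [hκ.2]⟩, hs⟩, hne⟩
  have h1 : circlePt (r / 2) ∉ spectrum ℂ W := fun hs => by
    have := key (r / 2) ⟨by linarith, le_rfl⟩ hs
    linarith
  have h2 : circlePt (-(r / 2)) ∉ spectrum ℂ W := fun hs => by
    have := key (-(r / 2)) ⟨le_rfl, by linarith⟩ hs
    linarith
  exact ⟨r / 2, ⟨by linarith, by linarith⟩, h.mono (by linarith) (by linarith) h2 h1,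
    h.mono (by linarith) le_rfl h1 h.1, key⟩

theorem eigCount_congr {s s' : Set ℝ} (h : ∀ κ, circleEigenspace W κ ≠ ⊥ → (κ ∈ s ↔ κ ∈ s')) :
    eigCount W s = eigCount W s' := by
  apply finsum_mem_inter_support_eq
  ext κ
  simp only [Set.mem_inter_iff, Function.mem_support]
  refine and_congr_left fun hκ => h κ fun hbot => hκ (finrank_circleEigenspace_of_eq_bot hbot)

theorem eigCount_empty : eigCount W ∅ = 0 := finsum_mem_empty

theorem AdmArc.finite_support (h : AdmArc W a b) :
    (Set.Icc a b ∩ Function.support fun κ => Module.finrank ℂ (circleEigenspace W κ)).Finite := by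
  refine h.2.2.1.subset fun κ hκ => ⟨hκ.1, ?_⟩
  by_contra hns
  exact hκ.2 (finrank_circleEigenspace_of_eq_bot (circleEigenspace_eq_bot_of_notMem hns))

theorem AdmArc.eigCount_add (h : AdmArc W a b) {x y z : ℝ} (hx : a ≤ x) (hz : z ≤ b) (hxy : x ≤ y)
    (hyz : y ≤ z) (hy : circlePt y ∉ spectrum ℂ W) :
    eigCount W (Set.Icc x z) = eigCount W (Set.Icc x y) + eigCount W (Set.Icc y z) := by
  have h1 : eigCount W (Set.Icc y z) = eigCount W (Set.Ioc y z) := by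
    apply eigCount_congr
    intro κ hκ
    have : κ ≠ y := fun he => hκ (he ▸ circleEigenspace_eq_bot_of_notMem hy)
    simp only [Set.mem_Icc, Set.mem_Ioc]
    exact and_congr_left fun _ => ⟨fun h => lt_of_le_of_ne h this.symm, le_of_lt⟩
  rw [h1, ← Set.Icc_union_Ioc_eq_Icc hxy hyz, eigCount, eigCount, eigCount]
  apply finsum_mem_union'
  · rw [Set.disjoint_left]
    exact fun κ h1 h2 => absurd h1.2 (not_le.2 h2.1)
  · exact h.finite_support.subset (Set.inter_subset_inter_left _
      (Set.Icc_subset_Icc hx (hyz.trans hz)))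
  · exact h.finite_support.subset (Set.inter_subset_inter_left _
      (Set.Ioc_subset_Icc_self.trans (Set.Icc_subset_Icc (hx.trans hxy) hz)))

theorem arcCount_eq_eigCount (W : Y →L[ℂ] Y) (ε : ℝ) : arcCount W ε = eigCount W (Set.Icc 0 ε) := rfl

theorem star_specProj [IsStarNormal W] (s : Set ℂ) : star (specProj W s) = specProj W s := by
  refine (cfc_star (s.indicator (1 : ℂ → ℂ)) W).symm.trans (cfc_congr fun z _ => ?_)
  by_cases hz : z ∈ s <;> simp [hz]

theorem specProj_eigen_one [IsStarNormal W] {s : Set ℂ} (hs : RelClopen (spectrum ℂ W) s)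
    (h1 : ∀ z ∈ spectrum ℂ W, z ∈ s → z = 1) (v : Y) : W (specProj W s v) = specProj W s v := by
  have h1 : (W - 1) * specProj W s = 0 := by
    have h2 : W - 1 = cfc (fun x : ℂ => x - 1) W := by
      rw [cfc_sub _ _ W, cfc_id' ℂ W, cfc_const_one ℂ W]
    rw [h2, cfc_mul_specProj hs (by fun_prop), ← cfc_zero ℂ W]
    apply cfc_congr
    intro x hx
    by_cases hxs : x ∈ s
    · simp [h1 x hx hxs]
    · simp [hxs]
  have h3 := congrArg (fun T : Y →L[ℂ] Y => T v) h1
  simp only [mul_apply_eq_comp, sub_apply, one_apply_eq_self, zero_apply] at h3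
  exact sub_eq_zero.1 h3

/-- Off the eigenspace of an isolated eigenvalue `1`, the operators `W - e^{iκ}` are bounded below
uniformly for `κ` in the isolating arc. -/
theorem exists_gap {ε : ℝ} (h : AdmArc W (-ε) ε) (hW : W ∈ unitary (Y →L[ℂ] Y)) (hε : 0 < ε)
    (hεπ : ε < Real.pi) :
    ∃ δ > 0, ∀ v : Y, arcProj W (-ε) ε v = 0 → ∀ κ ∈ Set.Icc (-ε) ε,
      δ * ‖v‖ ≤ ‖W v - circlePt κ • v‖ := by
  have hn : IsStarNormal W := isStarNormal_of_mem_unitary hW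
  have hle : -ε ≤ ε := by linarith
  have hab : ε - -ε < 2 * Real.pi := by linarith
  have hne := re_ne_of_notMem_spectrum hW hle hab h.2.1 h.1
  set c := circlePt ((-ε + ε) / 2) with hc
  set s := Real.cos ((ε - -ε) / 2) with hs
  obtain ⟨δ, hδ0, hδ⟩ : ∃ δ > 0, ∀ x ∈ spectrum ℂ W,
      δ ≤ |((starRingEnd ℂ) c * x).re - s| := by
    rcases (spectrum ℂ W).eq_empty_or_nonempty with he | hnon
    · exact ⟨1, one_pos, by simp [he]⟩
    · have hcont : ContinuousOn (fun x : ℂ => |((starRingEnd ℂ) c * x).re - s|)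
          (spectrum ℂ W) := by
        fun_prop
      obtain ⟨x, hx, hmin⟩ := (spectrum.isCompact W).exists_isMinOn hnon hcont
      exact ⟨_, abs_pos.2 (sub_ne_zero.2 (hne x hx)), fun y hy => hmin hy⟩
  refine ⟨δ, hδ0, fun v hv κ hκ => ?_⟩
  -- On the kernel of the projection the form of `W` is at most `s - δ`, while a point of the arc
  -- contributes at least `s`; Cauchy-Schwarz turns this difference into the lower bound.
  have h1 := le_mul_norm_sq_of_specProj_eq_zero hne hδ hv
  have h2 : s ≤ ((starRingEnd ℂ) c * circlePt κ).re := circlePt_mem_halfPlane hab hκ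
  have h3 : (inner ℂ v ((starRingEnd ℂ) c • circlePt κ • v)).re =
      ((starRingEnd ℂ) c * circlePt κ).re * ‖v‖ ^ 2 := by
    rw [smul_smul, inner_smul_right v v, inner_self_eq_norm_sq_to_K]
    have : ((‖v‖ : ℝ) : ℂ) ^ 2 = ((‖v‖ ^ 2 : ℝ) : ℂ) := by push_cast; rfl
    exact (congrArg (fun x => ((starRingEnd ℂ) c * circlePt κ * x).re) this).trans
      (Complex.re_mul_ofReal _ _)
  have h4 : |(inner ℂ v ((starRingEnd ℂ) c • (W v - circlePt κ • v))).re| ≤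
      ‖v‖ * ‖W v - circlePt κ • v‖ := by
    calc _ ≤ ‖inner ℂ v ((starRingEnd ℂ) c • (W v - circlePt κ • v))‖ :=
          Complex.abs_re_le_norm _
      _ ≤ ‖v‖ * ‖(starRingEnd ℂ) c • (W v - circlePt κ • v)‖ := norm_inner_le_norm _ _
      _ = _ := by rw [norm_smul, RCLike.norm_conj, hc, norm_circlePt, one_mul]
  rw [smul_sub, inner_sub_right, Complex.sub_re, h3] at h4
  have h5 := (abs_le.1 h4).1
  rcases (norm_nonneg v).eq_or_lt with h0 | h0
  · rw [← h0, mul_zero]; exact norm_nonneg _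
  · have h6 : δ * ‖v‖ * ‖v‖ ≤ ‖W v - circlePt κ • v‖ * ‖v‖ := by
      nlinarith [mul_le_mul_of_nonneg_right h2 (sq_nonneg ‖v‖)]
    exact le_of_mul_le_mul_right h6 h0

end Counting

/-! ### Curves of unitary operators with clockwise crossings. -/

section MonotoneCurve

open Filter Topology

variable {Y : Type*} [NormedAddCommGroup Y] [InnerProductSpace ℂ Y] [CompleteSpace Y]
  {Z : Type*} [NormedAddCommGroup Z] [InnerProductSpace ℂ Z]

/-- A continuous curve of unitary operators whose eigenvalues pass `1` in clockwise direction: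
formally `W ν * ∂W = -i B*B`. -/
structure MonotoneCurve (W : ℝ → Y →L[ℂ] Y) (B : ℝ → Y →L[ℂ] Z) (c d : ℝ) : Prop where
  mem_unitary : ∀ μ ∈ Set.Icc c d, W μ ∈ unitary (Y →L[ℂ] Y)
  cont : ContinuousOn W (Set.Icc c d)
  cont_B : ContinuousOn B (Set.Icc c d)
  green : ∀ μ ∈ Set.Icc c d, ∀ ν ∈ Set.Icc c d, ∀ y y' : Y,
    inner ℂ (W ν y') (W μ y) - inner ℂ y' y =
      -Complex.I * ((μ - ν : ℝ) : ℂ) * inner ℂ (B ν y') (B μ y)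
  inj : ∀ μ ∈ Set.Icc c d, ∀ y : Y, W μ y = y → B μ y = 0 → y = 0
  adm : ∀ μ ∈ Set.Icc c d, ∃ ε ∈ Set.Ioo 0 Real.pi, AdmArc (W μ) (-ε) ε

variable {W : ℝ → Y →L[ℂ] Y} {B : ℝ → Y →L[ℂ] Z} {c d : ℝ}

/-- Eigenvalues cross `1` clockwise. -/
theorem MonotoneCurve.crossing (h : MonotoneCurve W B c d) {ν : ℝ} (hν : ν ∈ Set.Icc c d) {ε : ℝ}
    (hε : 0 < ε) (hεπ : ε < Real.pi) (hadm : AdmArc (W ν) (-ε) ε)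
    (hiso : ∀ κ ∈ Set.Icc (-ε) ε, circlePt κ ∈ spectrum ℂ (W ν) → κ = 0) :
    ∀ᶠ μ in 𝓝[Set.Icc c d] ν, ∀ κ ∈ Set.Icc (-ε) ε, circleEigenspace (W μ) κ ≠ ⊥ →
      (ν < μ → κ < 0) ∧ (μ < ν → 0 < κ) := by
  have hU := h.mem_unitary ν hν
  have hn : IsStarNormal (W ν) := isStarNormal_of_mem_unitary hU
  have hle : -ε ≤ ε := by linarith
  have hab : ε - -ε < 2 * Real.pi := by linarith
  have hcl := relClopen_halfPlane (re_ne_of_notMem_spectrum hU hle hab hadm.2.1 hadm.1)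
  obtain ⟨hfd, -⟩ := hadm.finrank_range hU hle hab
  obtain ⟨δ, hδ, hgap⟩ := exists_gap hadm hU hε hεπ
  set P := arcProj (W ν) (-ε) ε with hP
  have hP1 : ∀ v, W ν (P v) = P v := by
    apply specProj_eigen_one hcl
    intro z hz hzs
    obtain ⟨κ, hκ, rfl⟩ :=
      exists_circlePt_of_mem_halfPlane hle (norm_eq_one_of_mem_spectrum hU hz) hzs
    rw [hiso κ hκ hz, circlePt_zero]
  have hPP : ∀ v, P (P v) = P v := specProj_apply_self hcl
  have hPs : ∀ v w, inner ℂ (P v) w = inner ℂ v (P w) := by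
    intro v w
    have h1 : star P = P := star_specProj _
    nth_rewrite 1 [← h1]
    rw [ContinuousLinearMap.star_eq_adjoint, ContinuousLinearMap.adjoint_inner_left]
  have hPW : ∀ v, P (W ν v) = W ν (P v) := by
    intro v
    have hcomm : Commute (W ν) P := by
      have := cfc_commute_cfc (id : ℂ → ℂ) ((halfPlane (circlePt ((-ε + ε) / 2))
        (Real.cos ((ε - -ε) / 2))).indicator (1 : ℂ → ℂ)) (W ν)
      rwa [cfc_id ℂ (W ν)] at this
    exact (congrArg (fun T : Y →L[ℂ] Y => T v) hcomm.eq).symm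
  -- `W ν` is the identity on the range of `P`, so `B ν` is injective there by `inj`, and bounded
  -- below because that range is finite-dimensional.
  obtain ⟨m, hm, hBm⟩ : ∃ m > 0, ∀ v, m * ‖P v‖ ≤ ‖B ν (P v)‖ := by
    let f : LinearMap.range (P : Y →ₗ[ℂ] Y) →ₗ[ℂ] Z := (B ν : Y →ₗ[ℂ] Z) ∘ₗ Submodule.subtype _
    have hf : LinearMap.ker f = ⊥ := by
      rw [Submodule.eq_bot_iff]
      rintro ⟨_, u, rfl⟩ hv
      exact Subtype.ext (h.inj ν hν _ (hP1 u) hv)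
    obtain ⟨K, hK, hanti⟩ := f.exists_antilipschitzWith hf
    refine ⟨(K : ℝ)⁻¹, by positivity, fun v => ?_⟩
    have h1 := hanti.le_mul_norm (map_zero f) ⟨P v, v, rfl⟩
    rw [inv_mul_le_iff₀ (by positivity)]
    exact h1
  set M := ‖(1 : Y →L[ℂ] Y) - P‖ with hM
  -- At `μ = ν` this quantity is `m`. Since `M / δ * ‖W ν - W μ‖` will bound `‖y - P y‖ / ‖y‖`, its
  -- positivity is exactly what makes `B μ y` closer to `B ν (P y)` than the latter is to zero.
  have hcont : ContinuousWithinAt (fun μ => m * (1 - M / δ * ‖W ν - W μ‖) - ‖B μ - B ν‖ -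
      ‖B ν‖ * (M / δ * ‖W ν - W μ‖)) (Set.Icc c d) ν := by
    have h1 := h.cont ν hν
    have h2 := h.cont_B ν hν
    fun_prop
  have hev : ∀ᶠ μ in 𝓝[Set.Icc c d] ν, 0 < m * (1 - M / δ * ‖W ν - W μ‖) - ‖B μ - B ν‖ -
      ‖B ν‖ * (M / δ * ‖W ν - W μ‖) := by
    apply hcont.eventually_const_lt
    simpa using hm
  filter_upwards [hev, self_mem_nhdsWithin] with μ hpos hμ κ hκ hbot
  obtain ⟨y, hy, hy0⟩ := (Submodule.ne_bot_iff _).1 hbot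
  rw [mem_circleEigenspace] at hy
  have hynorm : 0 < ‖y‖ := norm_pos_iff.2 hy0
  -- An eigenvector of `W μ` in the arc is nearly fixed by `P`: the gap estimate for `W ν` applies
  -- to `y - P y`, and `W μ y = circlePt κ • y` reduces the right side to `(1 - P)(W ν - W μ) y`.
  have h1 : δ * ‖y - P y‖ ≤ M * (‖W ν - W μ‖ * ‖y‖) := by
    have h2 : P (y - P y) = 0 := by rw [map_sub, hPP, sub_self]
    have h3 : W ν (y - P y) - circlePt κ • (y - P y) =
        ((1 : Y →L[ℂ] Y) - P) ((W ν - W μ) y) := by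
      simp only [sub_apply, one_apply_eq_self, map_sub, hPW, hP1, hy, map_smul, smul_sub]
    refine (hgap _ h2 κ hκ).trans ?_
    rw [h3]
    exact (ContinuousLinearMap.le_opNorm _ _).trans
      (mul_le_mul_of_nonneg_left (ContinuousLinearMap.le_opNorm _ _) (norm_nonneg _))
  have h2 : ‖y - P y‖ ≤ M / δ * ‖W ν - W μ‖ * ‖y‖ := by
    rw [div_mul_eq_mul_div, div_mul_eq_mul_div, le_div_iff₀ hδ]
    linarith
  have h3 : ‖y‖ ≤ ‖P y‖ + ‖y - P y‖ := by
    have := norm_add_le (P y) (y - P y)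
    simpa using this
  have h4 : ‖B μ y - B ν (P y)‖ ≤ ‖B μ - B ν‖ * ‖y‖ + ‖B ν‖ * ‖y - P y‖ := by
    have : B μ y - B ν (P y) = (B μ - B ν) y + B ν (y - P y) := by
      simp only [sub_apply, map_sub]; abel
    rw [this]
    exact (norm_add_le _ _).trans
      (add_le_add (ContinuousLinearMap.le_opNorm _ _) (ContinuousLinearMap.le_opNorm _ _))
  have h5 : ‖B μ y - B ν (P y)‖ < ‖B ν (P y)‖ := by
    have h6 : ‖B ν‖ * ‖y - P y‖ ≤ ‖B ν‖ * (M / δ * ‖W ν - W μ‖ * ‖y‖) := by gcongr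
    have h7 : m * (‖y‖ - M / δ * ‖W ν - W μ‖ * ‖y‖) ≤ m * ‖P y‖ := by
      gcongr; linarith
    have h8 := mul_pos hpos hynorm
    have h9 := hBm y
    nlinarith
  have hR : 0 < (inner ℂ (B ν (P y)) (B μ y)).re := by
    have h6 : inner ℂ (B ν (P y)) (B μ y) =
        inner ℂ (B ν (P y)) (B ν (P y)) + inner ℂ (B ν (P y)) (B μ y - B ν (P y)) := by
      rw [← inner_add_right]; congr 1; abel
    have h7 : (inner ℂ (B ν (P y)) (B ν (P y))).re = ‖B ν (P y)‖ ^ 2 := by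
      have := inner_self_eq_norm_sq (𝕜 := ℂ) (B ν (P y))
      simpa using this
    have h8 : |(inner ℂ (B ν (P y)) (B μ y - B ν (P y))).re| ≤
        ‖B ν (P y)‖ * ‖B μ y - B ν (P y)‖ :=
      (Complex.abs_re_le_norm _).trans (norm_inner_le_norm _ _)
    have h9 : 0 < ‖B ν (P y)‖ := (norm_nonneg _).trans_lt h5
    rw [h6, Complex.add_re, h7]
    nlinarith [(abs_le.1 h8).1]
  -- As `W ν (P y) = P y`, this reads `(e^{iκ} - 1)‖P y‖² = -i(μ - ν)⟨B ν (P y), B μ y⟩`. The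
  -- imaginary part ties the sign of `sin κ` to that of `ν - μ`.
  have hgreen := h.green μ hμ ν hν y (P y)
  rw [hP1, hy, inner_smul_right (P y) y] at hgreen
  have hyP : inner ℂ (P y) y = ((‖P y‖ ^ 2 : ℝ) : ℂ) := by
    rw [← hPP y, hPs, hPP, inner_self_eq_norm_sq_to_K]
    push_cast
    rfl
  rw [hyP] at hgreen
  have him := congrArg Complex.im hgreen
  have hsin : (circlePt κ).im = Real.sin κ := by
    rw [circlePt, Complex.exp_ofReal_mul_I_im]
  have h6 : Real.sin κ * ‖P y‖ ^ 2 = -(μ - ν) * (inner ℂ (B ν (P y)) (B μ y)).re := by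
    rw [Complex.sub_im, Complex.im_mul_ofReal, Complex.ofReal_im, hsin, sub_zero] at him
    rw [him]
    simp [Complex.mul_im, Complex.mul_re]
    ring
  have hPy : 0 ≤ ‖P y‖ ^ 2 := sq_nonneg _
  constructor
  · intro hlt
    by_contra hκ0
    have hs : 0 ≤ Real.sin κ := Real.sin_nonneg_of_nonneg_of_le_pi (not_lt.1 hκ0)
      (hκ.2.trans hεπ.le)
    have h7 := mul_nonneg hs hPy
    have h8 : 0 < (μ - ν) * (inner ℂ (B ν (P y)) (B μ y)).re := mul_pos (by linarith) hR
    linarith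
  · intro hlt
    by_contra hκ0
    have hs : Real.sin κ ≤ 0 := Real.sin_nonpos_of_nonpos_of_neg_pi_le (not_lt.1 hκ0)
      (by linarith [hκ.1])
    have h7 := mul_nonneg (neg_nonneg.2 hs) hPy
    have h8 : 0 < (ν - μ) * (inner ℂ (B ν (P y)) (B μ y)).re := mul_pos (by linarith) hR
    linarith

end MonotoneCurve

/-! ### Crossings balance the loss of eigenvalues in the upper arc. -/

section MonotoneCounting

open Filter Topology

variable {Y : Type*} [NormedAddCommGroup Y] [InnerProductSpace ℂ Y] [CompleteSpace Y]
  {Z : Type*} [NormedAddCommGroup Z] [InnerProductSpace ℂ Z]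
  {W : ℝ → Y →L[ℂ] Y} {B : ℝ → Y →L[ℂ] Z} {c d : ℝ}

/-- The number of `ν ∈ [c, μ)` at which `1` is an eigenvalue of `W ν`, counted with
multiplicity. -/
def crossCount (W : ℝ → Y →L[ℂ] Y) (c μ : ℝ) : ℕ :=
  ∑ᶠ ν ∈ Set.Ico c μ, Module.finrank ℂ (circleEigenspace (W ν) 0)

theorem eventually_iff_exists_forall_lt {s : Set ℝ} {p : ℝ → Prop} {x : ℝ} :
    (∀ᶠ y in 𝓝[s] x, p y) ↔ ∃ r > 0, ∀ y ∈ s, |y - x| < r → p y := by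
  rw [Metric.nhdsWithin_basis_ball.eventually_iff]
  simp only [Set.mem_inter_iff, Metric.mem_ball, Real.dist_eq, and_imp]
  exact ⟨fun ⟨r, hr, h⟩ => ⟨r, hr, fun y hy hyr => h hyr hy⟩,
    fun ⟨r, hr, h⟩ => ⟨r, hr, fun y hyr hy => h y hy hyr⟩⟩

/-- An eigenvalue `1` has `κ = 0`, which is neither negative nor positive, so the crossing lemma
excludes it on both sides of `ν`. With compactness this makes the crossings finite in number. -/
theorem MonotoneCurve.eventually_ne (h : MonotoneCurve W B c d) {ν : ℝ} (hν : ν ∈ Set.Icc c d) :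
    ∀ᶠ μ in 𝓝[Set.Icc c d] ν, μ ≠ ν → circleEigenspace (W μ) 0 = ⊥ := by
  obtain ⟨ε, hε, hadm⟩ := h.adm ν hν
  obtain ⟨ε', hε', hadm', -, hiso⟩ := hadm.exists_isolating hε.1
  filter_upwards [h.crossing hν hε'.1 (hε'.2.trans hε.2) hadm' hiso] with μ hμ hne
  by_contra hbot
  obtain ⟨h1, h2⟩ := hμ 0 ⟨by linarith [hε'.1], hε'.1.le⟩ hbot
  rcases lt_or_gt_of_ne hne with hlt | hlt
  · exact lt_irrefl _ (h2 hlt)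
  · exact lt_irrefl _ (h1 hlt)

theorem MonotoneCurve.finite_crossings (h : MonotoneCurve W B c d) :
    {μ | μ ∈ Set.Icc c d ∧ circleEigenspace (W μ) 0 ≠ ⊥}.Finite := by
  obtain ⟨t, ht, hcov⟩ := isCompact_Icc.elim_nhdsWithin_subcover
    (fun ν => {μ | μ ≠ ν → circleEigenspace (W μ) 0 = ⊥}) (fun ν hν => h.eventually_ne hν)
  refine t.finite_toSet.subset fun μ hμ => ?_
  obtain ⟨ν, hν, hmem⟩ := Set.mem_iUnion₂.1 (hcov hμ.1)
  by_contra hne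
  exact hμ.2 (hmem fun he => hne (he ▸ hν))

theorem MonotoneCurve.finite_inter_support (h : MonotoneCurve W B c d) {s : Set ℝ}
    (hs : s ⊆ Set.Icc c d) :
    (s ∩ Function.support fun ν => Module.finrank ℂ (circleEigenspace (W ν) 0)).Finite :=
  h.finite_crossings.subset fun _ hν =>
    ⟨hs hν.1, fun hbot => hν.2 (finrank_circleEigenspace_of_eq_bot hbot)⟩

theorem MonotoneCurve.crossCount_add (h : MonotoneCurve W B c d) {μ ν : ℝ} (hμ : c ≤ μ)
    (hμν : μ ≤ ν) (hν : ν ≤ d) : crossCount W c ν = crossCount W c μ + crossCount W μ ν := by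
  rw [crossCount, crossCount, crossCount, ← Set.Ico_union_Ico_eq_Ico hμ hμν]
  apply finsum_mem_union'
  · rw [Set.disjoint_left]
    exact fun κ h1 h2 => absurd h1.2 (not_lt.2 h2.1)
  · exact h.finite_inter_support fun x hx => ⟨hx.1, by linarith [hx.2]⟩
  · exact h.finite_inter_support fun x hx => ⟨by linarith [hx.1], by linarith [hx.2]⟩

theorem crossCount_eq_zero {μ ν : ℝ} (h : ∀ x ∈ Set.Ico μ ν, circleEigenspace (W x) 0 = ⊥) :
    crossCount W μ ν = 0 :=
  finsum_mem_eq_zero_of_forall_eq_zero fun x hx => finrank_circleEigenspace_of_eq_bot (h x hx)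

theorem crossCount_eq_of_isolated {μ ν : ℝ} (hμν : μ < ν)
    (h : ∀ x ∈ Set.Ico μ ν, x ≠ μ → circleEigenspace (W x) 0 = ⊥) :
    crossCount W μ ν = Module.finrank ℂ (circleEigenspace (W μ) 0) := by
  rw [crossCount, ← finsum_mem_singleton (a := μ)
    (f := fun x => Module.finrank ℂ (circleEigenspace (W x) 0))]
  apply finsum_mem_inter_support_eq
  ext x
  simp only [Set.mem_inter_iff, Function.mem_support, Set.mem_singleton_iff]
  refine and_congr_left fun hx => ⟨fun hx' => ?_, fun hx' => by rw [hx']; exact ⟨le_rfl, hμν⟩⟩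
  by_contra hne
  exact hx (finrank_circleEigenspace_of_eq_bot (h x hx' hne))

/-- Crossings are isolated. Since `crossCount` uses `[c, μ)`, a crossing at `ν` is recorded only
once `μ` exceeds `ν`, the side on which the closed upper arc loses the eigenvalue. -/
theorem MonotoneCurve.eventually_crossCount (h : MonotoneCurve W B c d) {ν : ℝ}
    (hν : ν ∈ Set.Icc c d) :
    ∀ᶠ μ in 𝓝[Set.Icc c d] ν,
      (ν < μ → crossCount W c μ =
        crossCount W c ν + Module.finrank ℂ (circleEigenspace (W ν) 0)) ∧
      (μ < ν → crossCount W c μ = crossCount W c ν) := by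
  obtain ⟨r, hr, hball⟩ := eventually_iff_exists_forall_lt.1 (h.eventually_ne hν)
  rw [eventually_iff_exists_forall_lt]
  refine ⟨r, hr, fun μ hμ hμr => ⟨fun hlt => ?_, fun hlt => ?_⟩⟩
  · rw [h.crossCount_add hν.1 hlt.le hμ.2, crossCount_eq_of_isolated hlt]
    intro x hx hne
    refine hball x ⟨hν.1.trans hx.1, hx.2.le.trans hμ.2⟩ ?_ hne
    rw [abs_of_pos (by linarith)] at hμr
    rw [abs_of_nonneg (by linarith [hx.1])]
    linarith [hx.2]
  · rw [h.crossCount_add hμ.1 hlt.le hν.2, crossCount_eq_zero (μ := μ), add_zero]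
    intro x hx
    refine hball x ⟨hμ.1.trans hx.1, hx.2.le.trans hν.2⟩ ?_ hx.2.ne
    rw [abs_of_neg (by linarith)] at hμr
    rw [abs_of_neg (by linarith [hx.2])]
    linarith [hx.1]

/-- Split the arc at an isolating `ε'`. The count in `[ε', ε]` is stable. Near `1`, the eigenvalues
coming from `1` all have `κ < 0` after `ν` and leave the count, and all have `κ > 0` before `ν` and
are all counted. -/
theorem MonotoneCurve.eventually_arcCount (h : MonotoneCurve W B c d) {ν : ℝ}
    (hν : ν ∈ Set.Icc c d) {ε : ℝ} (hε : ε ∈ Set.Ioo 0 Real.pi) (hadm : AdmArc (W ν) (-ε) ε) :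
    ∀ᶠ μ in 𝓝[Set.Icc c d] ν,
      (ν < μ → arcCount (W μ) ε + Module.finrank ℂ (circleEigenspace (W ν) 0) =
        arcCount (W ν) ε) ∧
      (μ < ν → arcCount (W μ) ε = arcCount (W ν) ε) := by
  have hU := h.mem_unitary ν hν
  obtain ⟨hε0, hεπ⟩ := hε
  obtain ⟨ε', ⟨hε'0, hε'ε⟩, hadm1, hadm2, hiso⟩ := hadm.exists_isolating hε0
  have hc := h.cont ν hν
  have hev1 := hc.eventually (hadm1.eventually hU (by linarith) (by linarith))
  have hev2 := hc.eventually (hadm2.eventually hU (by linarith) (by linarith))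
  have hev3 := hc.eventually (hadm.eventually hU (by linarith) (by linarith))
  have hadd : ∀ W' : Y →L[ℂ] Y, AdmArc W' (-ε) ε → circlePt ε' ∉ spectrum ℂ W' →
      arcCount W' ε = eigCount W' (Set.Icc 0 ε') + eigCount W' (Set.Icc ε' ε) :=
    fun W' h1 h2 => h1.eigCount_add (by linarith) le_rfl hε'0.le hε'ε.le h2
  have hker : ∀ κ ∈ Set.Icc (-ε') ε', circleEigenspace (W ν) κ ≠ ⊥ → κ = 0 := by
    intro κ hκ hne
    apply hiso κ hκ
    by_contra hns
    exact hne (circleEigenspace_eq_bot_of_notMem hns)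
  have hd1 : eigCount (W ν) (Set.Icc 0 ε') = eigCount (W ν) (Set.Icc (-ε') ε') := by
    apply eigCount_congr
    intro κ hκ
    constructor
    · exact fun h => ⟨by linarith [h.1], h.2⟩
    · exact fun h => by rw [hker κ h hκ]; exact ⟨le_rfl, hε'0.le⟩
  have hd2 : eigCount (W ν) (Set.Icc (-ε') ε') =
      Module.finrank ℂ (circleEigenspace (W ν) 0) := by
    rw [← finsum_mem_singleton (a := (0 : ℝ))
      (f := fun x => Module.finrank ℂ (circleEigenspace (W ν) x))]
    apply eigCount_congr
    intro κ hκ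
    constructor
    · exact fun h => hker κ h hκ
    · rintro rfl
      exact ⟨by linarith, hε'0.le⟩
  filter_upwards [hev1, hev2, hev3, self_mem_nhdsWithin,
    h.crossing hν hε'0 (hε'ε.trans hεπ) hadm1 hiso] with μ h1 h2 h3 hμ hcr
  have hUμ := h.mem_unitary μ hμ
  obtain ⟨h1a, h1b⟩ := h1 hUμ
  obtain ⟨h2a, h2b⟩ := h2 hUμ
  obtain ⟨h3a, -⟩ := h3 hUμ
  rw [hadd _ hadm hadm1.1, hadd _ h3a h1a.1, h2b, hd1, hd2]
  constructor
  · intro hlt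
    have : eigCount (W μ) (Set.Icc 0 ε') = 0 := by
      rw [← eigCount_empty (W := W μ)]
      apply eigCount_congr
      intro κ hκ
      simp only [Set.mem_empty_iff_false, iff_false]
      intro hmem
      have := (hcr κ ⟨by linarith [hmem.1], hmem.2⟩ hκ).1 hlt
      linarith [hmem.1]
    rw [this, zero_add, add_comm]
  · intro hlt
    have : eigCount (W μ) (Set.Icc 0 ε') = eigCount (W μ) (Set.Icc (-ε') ε') := by
      apply eigCount_congr
      intro κ hκ
      constructor
      · exact fun h => ⟨by linarith [h.1], h.2⟩
      · exact fun h => ⟨((hcr κ h hκ).2 hlt).le, h.2⟩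
    rw [this, h1b, hd2]

/-- For the discrete topology on the target, `f` is continuous. The target may also be `Prop`, which
gives induction along an interval. -/
theorem eq_of_eventually_eq_nhdsWithin {X β : Type*} [TopologicalSpace X] {s : Set X}
    (hs : IsPreconnected s) {f : X → β} (h : ∀ x ∈ s, ∀ᶠ y in 𝓝[s] x, f y = f x) {x y : X}
    (hx : x ∈ s) (hy : y ∈ s) : f x = f y := by
  let _ : TopologicalSpace β := ⊥
  have _ : DiscreteTopology β := ⟨rfl⟩
  exact hs.constant (fun x hx => (tendsto_const_nhds (x := f x)).congr'
    ((h x hx).mono fun y hy => hy.symm)) hx hy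

/-- Along an interval on which the arc stays admissible, the loss of eigenvalues of the upper arc is
the number of crossings. -/
theorem MonotoneCurve.arcCount_add_crossCount (h : MonotoneCurve W B c d) {μ ν : ℝ}
    (hμ : μ ∈ Set.Icc c d) (hν : ν ∈ Set.Icc c d) {ε : ℝ} (hε : ε ∈ Set.Ioo 0 Real.pi)
    (hadm : ∀ x ∈ Set.uIcc μ ν, AdmArc (W x) (-ε) ε) :
    crossCount W c μ + arcCount (W μ) ε = crossCount W c ν + arcCount (W ν) ε := by
  have hsub : Set.uIcc μ ν ⊆ Set.Icc c d := Set.ordConnected_Icc.uIcc_subset hμ hν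
  refine eq_of_eventually_eq_nhdsWithin (s := Set.uIcc μ ν)
    (f := fun x => crossCount W c x + arcCount (W x) ε) isPreconnected_uIcc ?_
    Set.left_mem_uIcc Set.right_mem_uIcc
  intro x hx
  have hmono := nhdsWithin_mono x hsub
  filter_upwards [hmono (h.eventually_crossCount (hsub hx)),
    hmono (h.eventually_arcCount (hsub hx) hε (hadm x hx))] with y h1 h2
  rcases lt_trichotomy x y with hlt | rfl | hlt
  · have := h1.1 hlt
    have := h2.1 hlt
    omega
  · rfl
  · rw [h1.2 hlt, h2.2 hlt]

end MonotoneCounting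

/-! ### Families of monotone curves: local constancy in the parameter. -/

section MonotoneFamily

open Filter Topology

variable {Y : Type*} [NormedAddCommGroup Y] [InnerProductSpace ℂ Y] [CompleteSpace Y]
  {Z : Type*} [NormedAddCommGroup Z] [InnerProductSpace ℂ Z]

/-- A family of monotone curves that depends continuously on a parameter `t ∈ I`, without crossing
at the initial point. -/
structure MonotoneFamily (W : ℝ → ℝ → Y →L[ℂ] Y) (B : ℝ → ℝ → Y →L[ℂ] Z) (c d : ℝ)
    (I : Set ℝ) : Prop where
  curve : ∀ t ∈ I, MonotoneCurve (fun μ => W μ t) (fun μ => B μ t) c d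
  cont : ContinuousOn (fun p : ℝ × ℝ => W p.1 p.2) (Set.Icc c d ×ˢ I)
  base : ∀ t ∈ I, circleEigenspace (W c t) 0 = ⊥

variable {W : ℝ → ℝ → Y →L[ℂ] Y} {B : ℝ → ℝ → Y →L[ℂ] Z} {c d : ℝ} {I : Set ℝ}

theorem MonotoneFamily.cont_right (h : MonotoneFamily W B c d I) {μ : ℝ} (hμ : μ ∈ Set.Icc c d) :
    ContinuousOn (W μ) I :=
  h.cont.comp (f := fun t => (μ, t)) (by fun_prop) fun _ ht => ⟨hμ, ht⟩

/-- Near `t₀`, the crossings below `μ` and the eigenvalues in the arc at `μ` have a constant total number. -/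
def LocConst (W : ℝ → ℝ → Y →L[ℂ] Y) (c : ℝ) (I : Set ℝ) (t₀ μ ε : ℝ) : Prop :=
  ∀ᶠ t in 𝓝[I] t₀, crossCount (fun ν => W ν t) c μ + arcCount (W μ t) ε =
    crossCount (fun ν => W ν t₀) c μ + arcCount (W μ t₀) ε

/-- The difference is the count in `[ε, ε']`, an arc whose end points avoid the spectrum, hence
locally constant in `t`. So `LocConst` does not depend on the admissible `ε`. -/
theorem MonotoneFamily.eventually_arcCount_sub (h : MonotoneFamily W B c d I) {t₀ μ : ℝ}
    (ht₀ : t₀ ∈ I) (hμ : μ ∈ Set.Icc c d) {ε ε' : ℝ} (hε : 0 < ε) (hεε' : ε < ε')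
    (hε' : ε' < Real.pi) (hadm : AdmArc (W μ t₀) (-ε) ε) (hadm' : AdmArc (W μ t₀) (-ε') ε') :
    ∀ᶠ t in 𝓝[I] t₀, (arcCount (W μ t) ε' : ℤ) - arcCount (W μ t) ε =
      (arcCount (W μ t₀) ε' : ℤ) - arcCount (W μ t₀) ε := by
  have hU := (h.curve t₀ ht₀).mem_unitary μ hμ
  have hc := h.cont_right hμ t₀ ht₀
  have hadm2 : AdmArc (W μ t₀) ε ε' := hadm'.mono (by linarith) le_rfl hadm.1 hadm'.1
  have hadd : ∀ W' : Y →L[ℂ] Y, AdmArc W' (-ε') ε' → circlePt ε ∉ spectrum ℂ W' →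
      arcCount W' ε' = arcCount W' ε + eigCount W' (Set.Icc ε ε') :=
    fun W' h1 h2 => h1.eigCount_add (by linarith) le_rfl hε.le hεε'.le h2
  filter_upwards [self_mem_nhdsWithin,
    hc.eventually (hadm2.eventually hU (by linarith) (by linarith)),
    hc.eventually (hadm'.eventually hU (by linarith) (by linarith))] with t ht h2 h3
  have hUt := (h.curve t ht).mem_unitary μ hμ
  rw [hadd _ hadm' hadm.1, hadd _ (h3 hUt).1 (h2 hUt).1.2.1, (h2 hUt).2]
  push_cast
  ring

theorem MonotoneFamily.locConst_iff (h : MonotoneFamily W B c d I) {t₀ μ : ℝ}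
    (ht₀ : t₀ ∈ I) (hμ : μ ∈ Set.Icc c d) {ε ε' : ℝ} (hε : ε ∈ Set.Ioo 0 Real.pi)
    (hε' : ε' ∈ Set.Ioo 0 Real.pi) (hadm : AdmArc (W μ t₀) (-ε) ε)
    (hadm' : AdmArc (W μ t₀) (-ε') ε') :
    LocConst W c I t₀ μ ε ↔ LocConst W c I t₀ μ ε' := by
  rcases lt_trichotomy ε ε' with hlt | rfl | hlt
  · have hev := h.eventually_arcCount_sub ht₀ hμ hε.1 hlt hε'.2 hadm hadm'
    constructor <;>
    · intro h1
      filter_upwards [hev, h1] with t h2 h3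
      omega
  · rfl
  · have hev := h.eventually_arcCount_sub ht₀ hμ hε'.1 hlt hε.2 hadm' hadm
    constructor <;>
    · intro h1
      filter_upwards [hev, h1] with t h2 h3
      omega

/-- No crossings lie below `c`, and since `1` is not an eigenvalue at `(c, t₀)`, an isolating arc is
empty of eigenvalues at `t₀` and hence for nearby `t`. -/
theorem MonotoneFamily.locConst_base (h : MonotoneFamily W B c d I) (hcd : c ≤ d) {t₀ : ℝ}
    (ht₀ : t₀ ∈ I) {ε : ℝ} (hε : ε ∈ Set.Ioo 0 Real.pi) (hadm : AdmArc (W c t₀) (-ε) ε) :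
    LocConst W c I t₀ c ε := by
  have hc : c ∈ Set.Icc c d := ⟨le_rfl, hcd⟩
  obtain ⟨ε', ⟨hε'0, hε'ε⟩, hadm', -, hiso⟩ := hadm.exists_isolating hε.1
  have hε'π := hε'ε.trans hε.2
  rw [h.locConst_iff ht₀ hc hε ⟨hε'0, hε'π⟩ hadm hadm']
  have hU := (h.curve t₀ ht₀).mem_unitary c hc
  have hzero : ∀ t, crossCount (fun ν => W ν t) c c = 0 := fun t => by simp [crossCount]
  have h0 : eigCount (W c t₀) (Set.Icc (-ε') ε') = 0 := by
    rw [← eigCount_empty (W := W c t₀)]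
    apply eigCount_congr
    intro κ hκ
    simp only [Set.mem_empty_iff_false, iff_false]
    intro hmem
    have : κ = 0 := by
      apply hiso κ hmem
      by_contra hns
      exact hκ (circleEigenspace_eq_bot_of_notMem hns)
    exact hκ (this ▸ h.base t₀ ht₀)
  have hle : ∀ W' : Y →L[ℂ] Y, AdmArc W' (-ε') ε' → arcCount W' ε' ≤
      eigCount W' (Set.Icc (-ε') ε') := by
    intro W' hW'
    rw [arcCount_eq_eigCount, eigCount, eigCount]
    have : Set.Icc (-ε') ε' = Set.Icc 0 ε' ∪ Set.Ico (-ε') 0 := by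
      rw [Set.union_comm, Set.Ico_union_Icc_eq_Icc (by linarith) hε'0.le]
    rw [this, finsum_mem_union']
    · exact Nat.le_add_right _ _
    · rw [Set.disjoint_left]
      exact fun κ h1 h2 => absurd h1.1 (not_le.2 h2.2)
    · exact hW'.finite_support.subset (Set.inter_subset_inter_left _
        (Set.Icc_subset_Icc (by linarith) le_rfl))
    · exact hW'.finite_support.subset (Set.inter_subset_inter_left _
        (Set.Ico_subset_Icc_self.trans (Set.Icc_subset_Icc le_rfl hε'0.le)))
  filter_upwards [self_mem_nhdsWithin,
    (h.cont_right hc t₀ ht₀).eventually (hadm'.eventually hU (by linarith) (by linarith))]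
    with t ht h1
  obtain ⟨h2, h3⟩ := h1 ((h.curve t ht).mem_unitary c hc)
  have h4 := hle _ h2
  have h5 := hle _ hadm'
  rw [hzero, hzero]
  omega

/-- The property is carried from `c` to `d` along the segment `t = t₀`. Near each `(ν, t₀)` one arc
stays admissible for all nearby `(μ, t)`, and there the balance of crossings and arc counts, valid
for each `t` separately, moves the statement from `ν` to `μ` and back. -/
theorem MonotoneFamily.locConst (h : MonotoneFamily W B c d I) (hcd : c ≤ d) {t₀ : ℝ}
    (ht₀ : t₀ ∈ I) {ε : ℝ} (hε : ε ∈ Set.Ioo 0 Real.pi) (hadm : AdmArc (W d t₀) (-ε) ε) :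
    LocConst W c I t₀ d ε := by
  let p : ℝ → Prop := fun μ => ∃ ε ∈ Set.Ioo 0 Real.pi, AdmArc (W μ t₀) (-ε) ε ∧
    LocConst W c I t₀ μ ε
  have hp : ∀ μ ∈ Set.Icc c d, ∀ ε ∈ Set.Ioo 0 Real.pi, AdmArc (W μ t₀) (-ε) ε →
      (p μ ↔ LocConst W c I t₀ μ ε) := by
    intro μ hμ ε hε hadm
    constructor
    · rintro ⟨ε', hε', hadm', hloc⟩
      exact (h.locConst_iff ht₀ hμ hε' hε hadm' hadm).1 hloc
    · exact fun hloc => ⟨ε, hε, hadm, hloc⟩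
  have hpc : p c := by
    obtain ⟨ε', hε', hadm'⟩ := (h.curve t₀ ht₀).adm c ⟨le_rfl, hcd⟩
    exact ⟨ε', hε', hadm', h.locConst_base hcd ht₀ hε' hadm'⟩
  rw [← hp d ⟨hcd, le_rfl⟩ ε hε hadm]
  -- `p` is a locally constant `Prop`-valued function on the connected interval `[c, d]`.
  suffices hs : p c = p d from hs ▸ hpc
  refine eq_of_eventually_eq_nhdsWithin isPreconnected_Icc (f := p) ?_ ⟨le_rfl, hcd⟩ ⟨hcd, le_rfl⟩
  intro ν hν
  obtain ⟨ε', hε', hadm'⟩ := (h.curve t₀ ht₀).adm ν hν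
  have hUν := (h.curve t₀ ht₀).mem_unitary ν hν
  have hev := (h.cont (ν, t₀) ⟨hν, ht₀⟩).eventually
    (hadm'.eventually hUν (by linarith [hε'.1]) (by linarith [hε'.2]))
  rw [nhdsWithin_prod_eq, eventually_prod_iff] at hev
  obtain ⟨pa, hpa, pb, hpb, hab⟩ := hev
  obtain ⟨r, hr, hball⟩ := eventually_iff_exists_forall_lt.1 hpa
  rw [eventually_iff_exists_forall_lt]
  refine ⟨r, hr, fun μ hμ hμr => propext ?_⟩
  have hadmx : ∀ x ∈ Set.uIcc μ ν, ∀ t ∈ I, pb t → AdmArc (W x t) (-ε') ε' := by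
    intro x hx t ht hbt
    have hxK : x ∈ Set.Icc c d := Set.ordConnected_Icc.uIcc_subset hμ hν hx
    exact (hab (hball x hxK (by
      rw [abs_sub_comm] at hμr ⊢
      exact (Set.abs_sub_right_of_mem_uIcc hx).trans_lt hμr))
      hbt ((h.curve t ht).mem_unitary x hxK)).1
  have hbt₀ : pb t₀ := hpb.self_of_nhdsWithin ht₀
  have hkey : ∀ t ∈ I, pb t → crossCount (fun ν => W ν t) c μ + arcCount (W μ t) ε' =
      crossCount (fun ν => W ν t) c ν + arcCount (W ν t) ε' := fun t ht hbt =>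
    (h.curve t ht).arcCount_add_crossCount hμ hν hε' fun x hx => hadmx x hx t ht hbt
  rw [hp μ hμ ε' hε' (hadmx μ Set.left_mem_uIcc t₀ ht₀ hbt₀), hp ν hν ε' hε' hadm']
  constructor <;>
  · intro hloc
    filter_upwards [hloc, hpb, self_mem_nhdsWithin] with t h1 h2 h3
    have h4 := hkey t h3 h2
    have h5 := hkey t₀ ht₀ hbt₀
    omega

end MonotoneFamily

/-! ### Maslov partitions and their flow. -/

section Partitions

open Filter Topology

variable {X : Type*} [NormedAddCommGroup X] [InnerProductSpace ℂ X] [CompleteSpace X]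
  {J : X →L[ℂ] X} {F : ℝ → Submodule ℂ X} {Z : Submodule ℂ X} {a b : ℝ}
  [CompleteSpace (kerSubI J)]

/-- An arc admissible at `t` stays admissible near `t`; a uniform partition finer than a Lebesgue
number of this cover has one admissible arc on each piece. -/
theorem nonempty_maslovPartition (hab : a < b)
    (hU : ∀ t ∈ Set.Icc a b, souriau J (F t) Z ∈ unitary (kerSubI J →L[ℂ] kerSubI J))
    (hc : ContinuousOn (fun t => souriau J (F t) Z) (Set.Icc a b))
    (hadm : ∀ t ∈ Set.Icc a b, ∃ ε ∈ Set.Ioo 0 Real.pi, AdmArc (souriau J (F t) Z) (-ε) ε) :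
    Nonempty (MaslovPartition J F Z a b) := by
  have hloc : ∀ t : Set.Icc a b, ∃ ε ∈ Set.Ioo 0 Real.pi, ∃ r > 0, ∀ t' ∈ Set.Icc a b,
      |t' - t| < r → AdmArc (souriau J (F t') Z) (-ε) ε := by
    intro t
    obtain ⟨ε, hε, h⟩ := hadm t t.2
    refine ⟨ε, hε, ?_⟩
    rw [← eventually_iff_exists_forall_lt
      (p := fun t' => AdmArc (souriau J (F t') Z) (-ε) ε)]
    filter_upwards [self_mem_nhdsWithin, (hc t t.2).eventually
      (h.eventually (hU t t.2) (by linarith [hε.1]) (by linarith [hε.2]))] with t' ht' h'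
    exact (h' (hU t' ht')).1
  choose ε hε r hr hball using hloc
  obtain ⟨δ, hδ, hleb⟩ := lebesgue_number_lemma_of_metric (isCompact_Icc (a := a) (b := b))
    (c := fun t : Set.Icc a b => Metric.ball (t : ℝ) (r t)) (fun t => Metric.isOpen_ball)
    (fun x hx => Set.mem_iUnion.2 ⟨⟨x, hx⟩, Metric.mem_ball_self (hr _)⟩)
  obtain ⟨n, hn⟩ := exists_nat_gt ((b - a) / δ)
  have hn0 : (0 : ℝ) < n := lt_of_le_of_lt (by have := sub_pos.2 hab; positivity) hn
  set h := (b - a) / n with hh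
  have hh0 : 0 < h := div_pos (sub_pos.2 hab) hn0
  have hhδ : h < δ := by
    rw [hh, div_lt_iff₀ hn0]
    rw [div_lt_iff₀ hδ] at hn
    linarith
  have hnh : (n : ℝ) * h = b - a := by rw [hh]; field_simp
  have hmem : ∀ j : Fin (n + 1), a + j * h ∈ Set.Icc a b := by
    intro j
    have h1 : (j : ℝ) * h ≤ n * h := by
      gcongr
      exact_mod_cast Nat.lt_succ_iff.1 j.2
    have h2 : 0 ≤ (j : ℝ) * h := by positivity
    exact ⟨by linarith, by linarith⟩
  have hex : ∀ j : Fin n, ∃ t : Set.Icc a b,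
      Metric.ball (a + (j.castSucc : Fin (n + 1)) * h) δ ⊆ Metric.ball (t : ℝ) (r t) :=
    fun j => hleb _ (hmem j.castSucc)
  choose t ht using hex
  refine ⟨{ N := n, s := fun j => a + j * h, ε := fun j => ε (t j), strictMono_s := ?_,
            s_zero := ?_, s_last := ?_, ε_mem := fun j => hε _, admissible := ?_ }⟩
  · intro i j hij
    have : (i : ℝ) < j := by exact_mod_cast hij
    simp only [add_lt_add_iff_left]
    gcongr
  · simp
  · simp [hnh]
  · intro j x hx
    have hx1 : a + (j : ℝ) * h ≤ x := by simpa using hx.1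
    have hx2 : x ≤ a + ((j : ℝ) + 1) * h := by simpa using hx.2
    have hxab : x ∈ Set.Icc a b := ⟨(hmem j.castSucc).1.trans hx.1, hx.2.trans (hmem j.succ).2⟩
    apply hball (t j) x hxab
    have hxb : x ∈ Metric.ball (a + ((j.castSucc : Fin (n + 1)) : ℝ) * h) δ := by
      rw [Metric.mem_ball, Real.dist_eq, abs_lt]
      simp only [Fin.val_castSucc]
      constructor <;> linarith
    have := ht j hxb
    rwa [Metric.mem_ball, Real.dist_eq] at this

theorem sum_castSucc_sub_succ {n : ℕ} (f : Fin (n + 1) → ℤ) :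
    ∑ j : Fin n, (f j.castSucc - f j.succ) = f 0 - f (Fin.last n) := by
  rw [Finset.sum_sub_distrib]
  have h1 := Fin.sum_univ_castSucc f
  have h2 := Fin.sum_univ_succ f
  linarith

/-- If the counting functions of admissible arcs differ from `-m` by locally constant functions,
then the flow of every partition is the decrease of `m`. -/
theorem MaslovPartition.flow_eq (p : MaslovPartition J F Z a b) (m : ℝ → ℕ)
    (hm : ∀ t₀ ∈ Set.Icc a b, ∀ ε ∈ Set.Ioo 0 Real.pi, AdmArc (souriau J (F t₀) Z) (-ε) ε →
      ∀ᶠ t in 𝓝[Set.Icc a b] t₀, m t + arcCount (souriau J (F t) Z) ε =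
        m t₀ + arcCount (souriau J (F t₀) Z) ε) :
    p.flow = (m a : ℤ) - m b := by
  have hs : ∀ j, p.s j ∈ Set.Icc a b := by
    intro j
    have h1 := p.strictMono_s.monotone (Fin.zero_le j)
    have h2 := p.strictMono_s.monotone (Fin.le_last j)
    rw [p.s_zero] at h1
    rw [p.s_last] at h2
    exact ⟨h1, h2⟩
  -- On each piece `m + k(·, εⱼ)` is locally constant, hence constant, so every summand of the flow
  -- is a decrement of `m`.
  have hconst : ∀ j : Fin p.N,
      (m (p.s j.succ) + arcCount (souriau J (F (p.s j.succ)) Z) (p.ε j) : ℕ) =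
        m (p.s j.castSucc) + arcCount (souriau J (F (p.s j.castSucc)) Z) (p.ε j) := by
    intro j
    have hle : p.s j.castSucc ≤ p.s j.succ := p.strictMono_s.monotone (Fin.castSucc_le_succ j)
    have hsub : Set.Icc (p.s j.castSucc) (p.s j.succ) ⊆ Set.Icc a b :=
      Set.Icc_subset_Icc (hs _).1 (hs _).2
    refine eq_of_eventually_eq_nhdsWithin
      (f := fun t => m t + arcCount (souriau J (F t) Z) (p.ε j)) isPreconnected_Icc
      (s := Set.Icc (p.s j.castSucc) (p.s j.succ)) ?_ ⟨hle, le_rfl⟩ ⟨le_rfl, hle⟩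
    intro t₀ ht₀
    exact nhdsWithin_mono _ hsub
      (hm t₀ (hsub ht₀) (p.ε j) (p.ε_mem j) (p.admissible j t₀ ht₀))
  have hsum := sum_castSucc_sub_succ (fun j => (m (p.s j) : ℤ))
  rw [p.s_zero, p.s_last] at hsum
  rw [MaslovPartition.flow, ← hsum]
  refine Finset.sum_congr rfl fun j _ => ?_
  have := hconst j
  omega

end Partitions

/-! ### Admissible arcs from the Fredholm property. -/

section Unitary

open Filter Topology

/-- A bounded operator between Hilbert spaces whose range has finite codimension has closed
range. -/
theorem isClosed_range_of_finiteDimensional_quotient {E F : Type*} [NormedAddCommGroup E]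
    [InnerProductSpace ℂ E] [CompleteSpace E] [NormedAddCommGroup F] [NormedSpace ℂ F]
    [CompleteSpace F] (f : E →L[ℂ] F)
    [FiniteDimensional ℂ (F ⧸ LinearMap.range (f : E →ₗ[ℂ] F))] :
    IsClosed (LinearMap.range (f : E →ₗ[ℂ] F) : Set F) := by
  set K := LinearMap.ker (f : E →ₗ[ℂ] F) with hK
  have hKc : IsClosed (K : Set E) := f.isClosed_ker
  have : CompleteSpace K := hKc.completeSpace_coe
  -- Restricting to the orthogonal complement of the kernel keeps the range and makes the operator
  -- injective.
  set g : Kᗮ →L[ℂ] F := f ∘L Kᗮ.subtypeL with hg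
  have hrange : LinearMap.range (g : Kᗮ →ₗ[ℂ] F) = LinearMap.range (f : E →ₗ[ℂ] F) := by
    apply le_antisymm
    · rintro _ ⟨x, rfl⟩
      exact ⟨x, rfl⟩
    · rintro _ ⟨x, rfl⟩
      refine ⟨⟨x - K.starProjection x, K.sub_starProjection_mem_orthogonal x⟩, ?_⟩
      have : f (K.starProjection x) = 0 := K.starProjection_apply_mem x
      simp [hg, this]
  have hker : LinearMap.ker (g : Kᗮ →ₗ[ℂ] F) = ⊥ := by
    rw [Submodule.eq_bot_iff]
    rintro ⟨x, hx⟩ hx0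
    have : x ∈ K ⊓ Kᗮ := ⟨hx0, hx⟩
    rw [Submodule.inf_orthogonal_eq_bot] at this
    exact Subtype.ext this
  obtain ⟨G, hG⟩ := (LinearMap.range (f : E →ₗ[ℂ] F)).exists_isCompl
  have hGf : FiniteDimensional ℂ G :=
    (Submodule.quotientEquivOfIsCompl _ G hG).finiteDimensional
  rw [← hrange] at hG ⊢
  exact g.closed_complemented_range_of_isCompl_of_ker_eq_bot G hG G.closed_of_finiteDimensional hker

variable {Y : Type*} [NormedAddCommGroup Y] [InnerProductSpace ℂ Y] [CompleteSpace Y]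

/-- If `W - 1` is Fredholm for a unitary operator `W`, then small arcs around `1` are
admissible. -/
theorem exists_admArc_of_fredholm {W : Y →L[ℂ] Y} (hW : W ∈ unitary (Y →L[ℂ] Y))
    (hker : FiniteDimensional ℂ (circleEigenspace W 0))
    (hran : FiniteDimensional ℂ (Y ⧸ LinearMap.range ((W - 1 : Y →L[ℂ] Y) : Y →ₗ[ℂ] Y))) :
    ∃ ε ∈ Set.Ioo 0 Real.pi, AdmArc W (-ε) ε := by
  set N := circleEigenspace W 0 with hN
  have hmemN : ∀ y, y ∈ N ↔ W y = y := fun y => by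
    rw [hN, mem_circleEigenspace, circlePt_zero, one_smul]
  set P := N.starProjection with hP
  have hPN : ∀ v, P v ∈ N := fun v => N.starProjection_apply_mem v
  have hWP : ∀ v, W (P v) = P v := fun v => (hmemN _).1 (hPN v)
  have hPP : ∀ v ∈ N, P v = v := fun v hv => Submodule.starProjection_eq_self_iff.2 hv
  have hinner : ∀ x y, inner ℂ (W x) (W y) = inner ℂ x y :=
    ContinuousLinearMap.inner_map_map_of_mem_unitary hW
  have hPW : ∀ v, P (W v) = P v := by
    intro v
    apply N.eq_starProjection_of_mem_of_inner_eq_zero (hPN v)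
    intro w hw
    have h1 : inner ℂ (v - P v) w = 0 := Submodule.starProjection_inner_eq_zero (K := N) v w hw
    rw [← hinner, (hmemN w).1 hw, map_sub, hWP] at h1
    exact h1
  have hclosed := isClosed_range_of_finiteDimensional_quotient (W - 1)
  set R := LinearMap.range ((W - 1 : Y →L[ℂ] Y) : Y →ₗ[ℂ] Y) with hR
  have hRc : CompleteSpace R := hclosed.completeSpace_coe
  have hRorth : Rᗮ ≤ N := by
    intro y hy
    have h1 : ∀ v, inner ℂ (W v - v) y = 0 := fun v => hy _ ⟨v, rfl⟩
    rw [hmemN, ← sub_eq_zero, ← inner_self_eq_zero (𝕜 := ℂ)]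
    have h3 := h1 y
    have h4 := inner_eq_zero_symm.1 h3
    rw [inner_sub_left] at h3
    rw [inner_sub_right] at h4
    rw [inner_sub_left, inner_sub_right, inner_sub_right, hinner]
    linear_combination -h3 - h4
  -- The eigenspace `N` reduces the unitary `W`, and the closed range of `W - 1` contains the
  -- orthogonal complement of `N`; adding `P` fills in `N`.
  have hA : IsUnit (W - 1 + P) := by
    rw [ContinuousLinearMap.isUnit_iff_bijective]
    constructor
    · rw [injective_iff_map_eq_zero]
      intro v hv
      have h1 := congrArg P hv
      simp only [add_apply, sub_apply, one_apply_eq_self, map_add, map_sub, hPW, sub_self,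
        zero_add, map_zero, hPP _ (hPN v)] at h1
      simp only [add_apply, sub_apply, one_apply_eq_self, h1, add_zero, sub_eq_zero] at hv
      rw [← hPP v ((hmemN v).2 hv), h1]
    · intro y
      have hy1 : y - P y ∈ R := by
        have : R = Rᗮᗮ := (Submodule.orthogonal_orthogonal R).symm
        rw [this]
        exact Submodule.orthogonal_le hRorth (N.sub_starProjection_mem_orthogonal y)
      obtain ⟨v, hv⟩ := hy1
      have hv' : W v - v = y - P y := hv
      refine ⟨v - P v + P y, ?_⟩
      simp only [add_apply, sub_apply, one_apply_eq_self, map_add, map_sub, hWP, hPP _ (hPN _)]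
      rw [show W v = y - P y + v by rw [← hv']; abel]
      abel
  have hunit : ∀ᶠ z in 𝓝 (1 : ℂ), IsUnit (W - z • (1 : Y →L[ℂ] Y) + P) := by
    have hc : Continuous fun z : ℂ => W - z • (1 : Y →L[ℂ] Y) + P := by fun_prop
    refine hc.continuousAt.eventually (p := IsUnit) (Units.isOpen.mem_nhds ?_)
    simpa using hA
  have hspec : ∀ᶠ z in 𝓝 (1 : ℂ), z ∈ spectrum ℂ W → z = 1 := by
    have h2 : ∀ᶠ z in 𝓝 (1 : ℂ), z ≠ 2 := isOpen_ne.mem_nhds (by norm_num)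
    filter_upwards [hunit, h2] with z hz hz2 hspec
    by_contra hz1
    apply hspec
    have h2z : (2 : ℂ) - z ≠ 0 := sub_ne_zero.2 (Ne.symm hz2)
    -- On `N` the operator `W - z + P` is multiplication by `2 - z` and `W - z` by `1 - z`, so
    -- scaling `N` by `w` turns the former into the latter. The scaling is invertible for `z ≠ 1`,
    -- which isolates `1` in the spectrum.
    obtain ⟨w, hw0, hw⟩ : ∃ w : ℂ, w ≠ 0 ∧ w * (2 - z) = 1 - z :=
      ⟨(1 - z) / (2 - z), div_ne_zero (sub_ne_zero.2 (Ne.symm hz1)) h2z, div_mul_cancel₀ _ h2z⟩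
    have hfac : W - z • (1 : Y →L[ℂ] Y) =
        (W - z • (1 : Y →L[ℂ] Y) + P) * (1 - P + w • P) := by
      ext v
      simp only [mul_apply_eq_comp, add_apply, sub_apply, smul_apply, one_apply_eq_self, map_add,
        map_sub, map_smul, hWP, hPP _ (hPN v)]
      calc W v - z • v = (W v - P v - (z • v - z • P v)) + (1 - z) • P v := by module
        _ = _ := by rw [← hw]; module
    have hu2 : IsUnit (1 - P + w • P) := by
      refine ⟨⟨1 - P + w • P, 1 - P + w⁻¹ • P, ?_, ?_⟩, rfl⟩ <;>
      · ext v
        simp only [mul_apply_eq_comp, add_apply, sub_apply, smul_apply, one_apply_eq_self, map_add,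
          map_sub, map_smul, hPP _ (hPN v), sub_self, zero_add, smul_smul, mul_inv_cancel₀ hw0,
          inv_mul_cancel₀ hw0, one_smul]
        abel
    have hmul := hz.mul hu2
    rw [← hfac] at hmul
    change IsUnit _
    rw [Algebra.algebraMap_eq_smul_one, ← neg_sub]
    exact hmul.neg
  have hcirc : ContinuousAt circlePt 0 := by
    unfold circlePt
    fun_prop
  have hκ : ∀ᶠ κ in 𝓝 (0 : ℝ), circlePt κ ∈ spectrum ℂ W → circlePt κ = 1 := by
    refine hcirc.eventually (p := fun z => z ∈ spectrum ℂ W → z = 1) ?_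
    rw [circlePt_zero]
    exact hspec
  obtain ⟨r, hr, hball⟩ := Metric.eventually_nhds_iff.1 hκ
  set ε := min (r / 2) 1 with hε
  have hε0 : 0 < ε := lt_min (by linarith) one_pos
  have hεr : ε < r := lt_of_le_of_lt (min_le_left _ _) (by linarith)
  have hε1 : ε ≤ 1 := min_le_right _ _
  have hεπ : ε < Real.pi := by linarith [Real.pi_gt_three]
  have hiso : ∀ κ ∈ Set.Icc (-ε) ε, circlePt κ ∈ spectrum ℂ W → κ = 0 := by
    intro κ hκ hs
    have h1 := hball (by rw [Real.dist_eq, sub_zero, abs_lt]; constructor <;>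
      linarith [hκ.1, hκ.2]) hs
    rw [← circlePt_zero] at h1
    exact injOn_circlePt (by linarith) hκ ⟨by linarith, hε0.le⟩ h1
  refine ⟨ε, ⟨hε0, hεπ⟩, fun hs => ?_, fun hs => ?_, ?_, fun κ hκ => ?_⟩
  · have := hiso ε ⟨by linarith, le_rfl⟩ hs
    linarith
  · have := hiso (-ε) ⟨le_rfl, by linarith⟩ hs
    linarith
  · exact (Set.finite_singleton (0 : ℝ)).subset fun κ hκ => hiso κ hκ.1 hκ.2
  · by_cases hs : circlePt κ ∈ spectrum ℂ W
    · rw [hiso κ hκ hs]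
      exact hker
    · rw [circleEigenspace_eq_bot_of_notMem hs]
      infer_instance

end Unitary

/-! ### Lagrangian planes, reflections and the operator `U V⁻¹`. -/

section Lagrangian

open Filter Topology

variable {X : Type*} [NormedAddCommGroup X] [InnerProductSpace ℂ X] [CompleteSpace X]

/-- `J² = -1`, `J* = -J`. -/
structure IsComplexStructure (J : X →L[ℂ] X) : Prop where
  sq : ∀ x, J (J x) = -x
  skew : ∀ x y, inner ℂ (J x) y = -inner ℂ x (J y)

/-- The reflection in `F`. -/
def reflect (F : Submodule ℂ X) : X →L[ℂ] X := (2 : ℂ) • planeProj F - 1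

variable {J : X →L[ℂ] X} {F Z : Submodule ℂ X}

theorem IsLagrangian.mem_iff (h : IsLagrangian J F) (x : X) : x ∈ F ↔ J x ∈ Fᗮ := by
  rw [h x, Submodule.mem_orthogonal]
  rfl

theorem IsLagrangian.isClosed (h : IsLagrangian J F) : IsClosed (F : Set X) := by
  have : (F : Set X) = J ⁻¹' (Fᗮ : Set X) := Set.ext fun x => h.mem_iff x
  rw [this]
  exact F.isClosed_orthogonal.preimage J.continuous

theorem planeProj_mem (hF : IsClosed (F : Set X)) (x : X) : planeProj F x ∈ F := by
  have h := F.topologicalClosure.starProjection_apply_mem x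
  exact (IsClosed.submodule_topologicalClosure_eq hF).le h

theorem planeProj_eq {p q : X} (hp : p ∈ F) (hq : q ∈ Fᗮ) : planeProj F (p + q) = p := by
  apply Submodule.eq_starProjection_of_mem_of_inner_eq_zero (F.le_topologicalClosure hp)
  intro w hw
  rw [add_sub_cancel_left]
  have : q ∈ F.topologicalClosureᗮ := by rwa [Submodule.orthogonal_closure]
  exact Submodule.inner_left_of_mem_orthogonal hw this

theorem sub_planeProj_mem (x : X) : x - planeProj F x ∈ Fᗮ := by
  have h := F.topologicalClosure.sub_starProjection_mem_orthogonal x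
  rwa [Submodule.orthogonal_closure] at h

theorem exists_add_of_isClosed (hF : IsClosed (F : Set X)) (x : X) :
    ∃ p ∈ F, ∃ q ∈ Fᗮ, x = p + q :=
  ⟨planeProj F x, planeProj_mem hF x, x - planeProj F x, sub_planeProj_mem x, by abel⟩

theorem reflect_add {p q : X} (hp : p ∈ F) (hq : q ∈ Fᗮ) : reflect F (p + q) = p - q := by
  simp only [reflect, sub_apply, smul_apply, planeProj_eq hp hq, one_apply_eq_self]
  module

theorem reflect_eq_self_iff (hF : IsClosed (F : Set X)) (x : X) : reflect F x = x ↔ x ∈ F := by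
  constructor
  · intro h
    have h1 : planeProj F x = x := by
      simp only [reflect, sub_apply, smul_apply, one_apply_eq_self] at h
      have h2 : (2 : ℂ) • (planeProj F x - x) = 0 := by
        rw [smul_sub, sub_eq_zero, two_smul ℂ x, ← sub_eq_iff_eq_add]
        exact h
      exact sub_eq_zero.1 ((smul_eq_zero.1 h2).resolve_left two_ne_zero)
    rw [← h1]
    exact planeProj_mem hF x
  · intro h
    have := reflect_add h (Submodule.zero_mem Fᗮ)
    simpa using this

theorem reflect_reflect (hF : IsClosed (F : Set X)) (x : X) : reflect F (reflect F x) = x := by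
  obtain ⟨p, hp, q, hq, rfl⟩ := exists_add_of_isClosed hF x
  rw [reflect_add hp hq, sub_eq_add_neg, reflect_add hp (Fᗮ.neg_mem hq), sub_neg_eq_add]

theorem inner_reflect (hF : IsClosed (F : Set X)) (x y : X) :
    inner ℂ (reflect F x) y = inner ℂ x (reflect F y) := by
  obtain ⟨p, hp, q, hq, rfl⟩ := exists_add_of_isClosed hF x
  obtain ⟨p', hp', q', hq', rfl⟩ := exists_add_of_isClosed hF y
  rw [reflect_add hp hq, reflect_add hp' hq']
  have h1 : inner ℂ p q' = 0 := hq' p hp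
  have h2 : inner ℂ q p' = 0 := Submodule.inner_left_of_mem_orthogonal hp' hq
  simp only [inner_sub_left, inner_add_right, inner_add_left, inner_sub_right, h1, h2]
  ring

/-- `J` exchanges a Lagrangian plane and its orthogonal complement. Thus the reflection anticommutes
with `J` and exchanges `ker (J + i)` and `ker (J - i)`; its restriction is the operator `U`, and `U
V⁻¹` becomes a product of two reflections. -/
theorem reflect_J (hJ : IsComplexStructure J) (h : IsLagrangian J F) (x : X) :
    reflect F (J x) = -J (reflect F x) := by
  obtain ⟨p, hp, q, hq, rfl⟩ := exists_add_of_isClosed h.isClosed x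
  have h1 : J q ∈ F := by
    rw [h.mem_iff, hJ.sq]
    exact Fᗮ.neg_mem hq
  rw [reflect_add hp hq, map_add, add_comm (J p), reflect_add h1 ((h.mem_iff p).1 hp), map_sub]
  abel

theorem mem_kerSubI {x : X} : x ∈ kerSubI J ↔ J x = Complex.I • x := by
  simp [kerSubI, sub_eq_zero]

theorem mem_kerAddI {x : X} : x ∈ kerAddI J ↔ J x = -(Complex.I • x) := by
  simp [kerAddI, add_eq_zero_iff_eq_neg]

instance : CompleteSpace (kerSubI J) := by
  have : IsClosed (kerSubI J : Set X) :=
    (J - Complex.I • ContinuousLinearMap.id ℂ X : X →L[ℂ] X).isClosed_ker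
  exact this.completeSpace_coe

theorem eq_zero_of_mem_ker_of_mem_ker {x : X} (h1 : x ∈ kerSubI J) (h2 : x ∈ kerAddI J) :
    x = 0 := by
  rw [mem_kerSubI] at h1
  rw [mem_kerAddI, h1, eq_neg_iff_add_eq_zero, ← two_smul ℂ, smul_smul] at h2
  exact (smul_eq_zero.1 h2).resolve_left (by simp)

theorem exists_add_of_isComplexStructure (hJ : IsComplexStructure J) (x : X) :
    ∃ y ∈ kerAddI J, ∃ z ∈ kerSubI J, x = y + z := by
  have hI : Complex.I * Complex.I = -1 := Complex.I_mul_I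
  refine ⟨(1 / 2 : ℂ) • (x + Complex.I • J x), ?_, (1 / 2 : ℂ) • (x - Complex.I • J x), ?_, ?_⟩
  · rw [mem_kerAddI, map_smul, map_add, map_smul, hJ.sq]
    have h : Complex.I • Complex.I • J x = -J x := by rw [smul_smul, hI, neg_one_smul]
    rw [smul_comm Complex.I, smul_add Complex.I x, h]
    module
  · rw [mem_kerSubI, map_smul, map_sub, map_smul, hJ.sq]
    have h : Complex.I • Complex.I • J x = -J x := by rw [smul_smul, hI, neg_one_smul]
    rw [smul_comm Complex.I, smul_sub Complex.I x, h]
    module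
  · module

theorem reflect_mem_kerSubI (hJ : IsComplexStructure J) (h : IsLagrangian J F) {x : X}
    (hx : x ∈ kerAddI J) : reflect F x ∈ kerSubI J := by
  rw [mem_kerAddI] at hx
  have h1 := reflect_J hJ h x
  rw [hx, map_neg, map_smul, neg_inj] at h1
  rw [mem_kerSubI, h1]

theorem reflect_mem_kerAddI (hJ : IsComplexStructure J) (h : IsLagrangian J F) {x : X}
    (hx : x ∈ kerSubI J) : reflect F x ∈ kerAddI J := by
  rw [mem_kerSubI] at hx
  have h1 := reflect_J hJ h x
  rw [hx, map_smul] at h1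
  rw [mem_kerAddI, h1, neg_neg]

theorem reflect_eq_of_add_mem (hJ : IsComplexStructure J) (h : IsLagrangian J F) {y z : X}
    (hy : y ∈ kerAddI J) (hz : z ∈ kerSubI J) (hyz : y + z ∈ F) : reflect F y = z := by
  rw [← reflect_eq_self_iff h.isClosed, map_add] at hyz
  have h1 : z - reflect F y = reflect F z - y := by
    rw [sub_eq_sub_iff_add_eq_add, add_comm z, ← hyz]
    abel
  have h2 : z - reflect F y = 0 := by
    apply eq_zero_of_mem_ker_of_mem_ker (J := J)
    · exact Submodule.sub_mem _ hz (reflect_mem_kerSubI hJ h hy)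
    · rw [h1]
      exact Submodule.sub_mem _ (reflect_mem_kerAddI hJ h hz) hy
  exact (sub_eq_zero.1 h2).symm

/-- A Lagrangian plane as the graph of the restriction of its reflection. -/
def reflectEquiv (hJ : IsComplexStructure J) (h : IsLagrangian J F) :
    kerAddI J ≃L[ℂ] kerSubI J :=
  ContinuousLinearEquiv.equivOfInverse
    ((reflect F ∘L (kerAddI J).subtypeL).codRestrict _ fun x => reflect_mem_kerSubI hJ h x.2)
    ((reflect F ∘L (kerSubI J).subtypeL).codRestrict _ fun x => reflect_mem_kerAddI hJ h x.2)
    (fun x => Subtype.ext (reflect_reflect h.isClosed x))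
    (fun x => Subtype.ext (reflect_reflect h.isClosed x))

theorem graphOperator_eq (hJ : IsComplexStructure J) (h : IsLagrangian J F) :
    graphOperator J F = (reflectEquiv hJ h : kerAddI J →L[ℂ] kerSubI J) := by
  have hgraph : IsGraphOf J F (reflectEquiv hJ h : kerAddI J →L[ℂ] kerSubI J) := by
    intro x
    constructor
    · intro hx
      obtain ⟨y, hy, z, hz, rfl⟩ := exists_add_of_isComplexStructure hJ x
      refine ⟨⟨y, hy⟩, ?_⟩
      change y + z = y + reflect F y
      rw [reflect_eq_of_add_mem hJ h hy hz hx]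
    · rintro ⟨y, rfl⟩
      change (y : X) + reflect F y ∈ F
      rw [← reflect_eq_self_iff h.isClosed, map_add, reflect_reflect h.isClosed, add_comm]
  have hex : ∃ U : kerAddI J →L[ℂ] kerSubI J, IsGraphOf J F U := ⟨_, hgraph⟩
  rw [graphOperator, dif_pos hex]
  have hU := hex.choose_spec
  ext y
  obtain ⟨y', hy'⟩ := (hgraph _).1 ((hU _).2 ⟨y, rfl⟩)
  have h1 : (y : X) - y' = (reflectEquiv hJ h y' : X) - hex.choose y := by
    rw [sub_eq_sub_iff_add_eq_add, hy', add_comm]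
    rfl
  have h2 : (y : X) - y' = 0 := by
    apply eq_zero_of_mem_ker_of_mem_ker (J := J)
    · rw [h1]
      exact Submodule.sub_mem _ (Subtype.prop _) (Subtype.prop _)
    · exact Submodule.sub_mem _ y.2 y'.2
  have h3 : y = y' := Subtype.ext (sub_eq_zero.1 h2)
  rw [h2] at h1
  rw [← h3] at h1
  exact (sub_eq_zero.1 h1.symm).symm

theorem souriau_apply (hJ : IsComplexStructure J) (hF : IsLagrangian J F) (hZ : IsLagrangian J Z)
    (y : kerSubI J) : (souriau J F Z y : X) = reflect F (reflect Z y) := by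
  rw [souriau, graphOperator_eq hJ hF, graphOperator_eq hJ hZ, ContinuousLinearMap.inverse_equiv]
  rfl

/-- Writes the operator without restricted codomains, as a bounded expression in the projection onto
`F`, so that continuity in `F` is immediate. -/
theorem souriau_eq_adjoint_comp (hJ : IsComplexStructure J) (hF : IsLagrangian J F)
    (hZ : IsLagrangian J Z) :
    souriau J F Z = (ContinuousLinearMap.adjoint (kerSubI J).subtypeL) ∘L
      (reflect F ∘L (reflect Z ∘L (kerSubI J).subtypeL)) := by
  ext1 y
  apply ext_inner_right ℂ
  intro v
  simp only [ContinuousLinearMap.comp_apply]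
  rw [ContinuousLinearMap.adjoint_inner_left, Submodule.coe_inner, souriau_apply hJ hF hZ]
  rfl

theorem souriau_mem_unitary (hJ : IsComplexStructure J) (hF : IsLagrangian J F)
    (hZ : IsLagrangian J Z) : souriau J F Z ∈ unitary (kerSubI J →L[ℂ] kerSubI J) := by
  have hstar : star (souriau J F Z) = souriau J Z F := by
    rw [ContinuousLinearMap.star_eq_adjoint]
    symm
    rw [ContinuousLinearMap.eq_adjoint_iff]
    intro x y
    rw [Submodule.coe_inner, Submodule.coe_inner, souriau_apply hJ hF hZ, souriau_apply hJ hZ hF,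
      inner_reflect hZ.isClosed, inner_reflect hF.isClosed]
  rw [Unitary.mem_iff, hstar]
  constructor <;>
  · ext y
    simp only [mul_apply_eq_comp, one_apply_eq_self]
    rw [souriau_apply hJ ‹_› ‹_›, souriau_apply hJ ‹_› ‹_›]
    simp only [reflect_reflect hF.isClosed, reflect_reflect hZ.isClosed]

theorem continuousOn_souriau {T : Type*} [TopologicalSpace T] {s : Set T}
    {F : T → Submodule ℂ X} (hJ : IsComplexStructure J) (hF : ∀ t ∈ s, IsLagrangian J (F t))
    (hZ : IsLagrangian J Z) (hc : ContinuousOn (fun t => planeProj (F t)) s) :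
    ContinuousOn (fun t => souriau J (F t) Z) s := by
  have h1 : ContinuousOn (fun t => reflect (F t)) s := by
    unfold reflect
    fun_prop
  have h2 : ContinuousOn (fun t => (ContinuousLinearMap.adjoint (kerSubI J).subtypeL) ∘L
      (reflect (F t) ∘L (reflect Z ∘L (kerSubI J).subtypeL))) s := by
    fun_prop
  exact h2.congr fun t ht => souriau_eq_adjoint_comp hJ (hF t ht) hZ

theorem reflect_add_self_mem (hF : IsClosed (F : Set X)) (x : X) : x + reflect F x ∈ F := by
  rw [← reflect_eq_self_iff hF, map_add, reflect_reflect hF, add_comm]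

/-- `ker (U V⁻¹ - 1)` is isomorphic to the intersection of the two planes. -/
def circleEigenspaceEquiv (hJ : IsComplexStructure J) (hF : IsLagrangian J F)
    (hZ : IsLagrangian J Z) :
    circleEigenspace (souriau J F Z) 0 ≃ₗ[ℂ] (F ⊓ Z : Submodule ℂ X) := by
  have hmem : ∀ y : kerSubI J, y ∈ circleEigenspace (souriau J F Z) 0 ↔
      reflect F (reflect Z y) = y := by
    intro y
    rw [mem_circleEigenspace, circlePt_zero, one_smul, Subtype.ext_iff, souriau_apply hJ hF hZ]
  let f : circleEigenspace (souriau J F Z) 0 →ₗ[ℂ] (F ⊓ Z : Submodule ℂ X) :=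
    LinearMap.codRestrict _ ((((1 : X →L[ℂ] X) + reflect Z : X →L[ℂ] X) : X →ₗ[ℂ] X) ∘ₗ
      (kerSubI J).subtype ∘ₗ Submodule.subtype _) fun y => by
      have h1 := (hmem y).1 y.2
      refine ⟨?_, reflect_add_self_mem hZ.isClosed _⟩
      have h2 : reflect Z ((y : kerSubI J) : X) = reflect F (y : kerSubI J) := by
        rw [← reflect_reflect hF.isClosed (reflect Z _), h1]
      change ((y : kerSubI J) : X) + reflect Z (y : kerSubI J) ∈ F
      rw [h2]
      exact reflect_add_self_mem hF.isClosed _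
  have hf : ∀ y, (f y : X) = ((y : kerSubI J) : X) + reflect Z (y : kerSubI J) := fun _ => rfl
  refine LinearEquiv.ofBijective f ⟨?_, ?_⟩
  · rw [injective_iff_map_eq_zero]
    intro y hy
    have h1 : ((y : kerSubI J) : X) + reflect Z (y : kerSubI J) = 0 := by rw [← hf, hy]; rfl
    apply Subtype.ext
    apply Subtype.ext
    apply eq_zero_of_mem_ker_of_mem_ker (J := J) (Subtype.prop _)
    rw [eq_neg_of_add_eq_zero_left h1]
    exact Submodule.neg_mem _ (reflect_mem_kerAddI hJ hZ (Subtype.prop _))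
  · rintro ⟨x, hxF, hxZ⟩
    obtain ⟨y, hy, z, hz, rfl⟩ := exists_add_of_isComplexStructure hJ x
    have h1 := reflect_eq_of_add_mem hJ hF hy hz hxF
    have h2 := reflect_eq_of_add_mem hJ hZ hy hz hxZ
    have h3 : reflect Z z = y := by rw [← h2, reflect_reflect hZ.isClosed]
    refine ⟨⟨⟨z, hz⟩, (hmem _).2 ?_⟩, Subtype.ext ?_⟩
    · change reflect F (reflect Z z) = z
      rw [h3, h1]
    · rw [hf]
      change z + reflect Z z = y + z
      rw [h3, add_comm]

/-- If `y ∈ ker (J - i)` lies in `F + Z`, the components in `ker (J + i)` of the two summands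
cancel, say `l₁` and `-l₁`. Then `y` is the reflection of `l₁` in `F` minus that in `Z`, that is, `U
V⁻¹ - 1` applied to the latter. So the range of `U V⁻¹ - 1` has finite codimension. -/
theorem exists_admArc_souriau (hJ : IsComplexStructure J) (hF : IsLagrangian J F)
    (hZ : IsLagrangian J Z) (hfp : IsFredholmPair F Z) :
    ∃ ε ∈ Set.Ioo 0 Real.pi, AdmArc (souriau J F Z) (-ε) ε := by
  obtain ⟨h1, -, h2⟩ := hfp
  apply exists_admArc_of_fredholm (souriau_mem_unitary hJ hF hZ)
  · exact (circleEigenspaceEquiv hJ hF hZ).symm.finiteDimensional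
  · set R := LinearMap.range ((souriau J F Z - 1 : kerSubI J →L[ℂ] kerSubI J) :
      kerSubI J →ₗ[ℂ] kerSubI J) with hR
    have hle : (F ⊔ Z).comap (kerSubI J).subtype ≤ R := by
      intro y hy
      obtain ⟨l, hl, z, hz, hsum⟩ := Submodule.mem_sup.1 hy
      obtain ⟨l1, hl1, l2, hl2, rfl⟩ := exists_add_of_isComplexStructure hJ l
      obtain ⟨z1, hz1, z2, hz2, rfl⟩ := exists_add_of_isComplexStructure hJ z
      have e1 := reflect_eq_of_add_mem hJ hF hl1 hl2 hl
      have e2 := reflect_eq_of_add_mem hJ hZ hz1 hz2 hz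
      have h3 : l1 + z1 = y - (l2 + z2) := by
        rw [eq_sub_iff_add_eq, ← show l1 + l2 + (z1 + z2) = y from hsum]
        abel
      have h4 : l1 + z1 = 0 := by
        apply eq_zero_of_mem_ker_of_mem_ker (J := J)
        · rw [h3]
          exact Submodule.sub_mem _ y.2 (Submodule.add_mem _ hl2 hz2)
        · exact Submodule.add_mem _ hl1 hz1
      have h5 : z1 = -l1 := eq_neg_of_add_eq_zero_right h4
      refine ⟨⟨reflect Z l1, reflect_mem_kerSubI hJ hZ hl1⟩, Subtype.ext ?_⟩
      change (souriau J F Z _ : X) - reflect Z l1 = y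
      rw [souriau_apply hJ hF hZ]
      change reflect F (reflect Z (reflect Z l1)) - reflect Z l1 = y
      rw [reflect_reflect hZ.isClosed, e1]
      have h6 : (y : X) = l2 + z2 := (sub_eq_zero.1 (h3.symm.trans h4))
      rw [h6, ← e2, h5, map_neg, sub_eq_add_neg]
    have hfin : FiniteDimensional ℂ (kerSubI J ⧸ (F ⊔ Z).comap (kerSubI J).subtype) := by
      apply FiniteDimensional.of_injective (Submodule.mapQ _ (F ⊔ Z) (kerSubI J).subtype le_rfl)
      rw [← LinearMap.ker_eq_bot, Submodule.ker_mapQ, Submodule.mkQ_map_self]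
    exact Submodule.CoFG.of_le hle hfin

/-- The spaces `ker (J ± i)` are orthogonal and `J` is scalar on each. For `w = U p` the right side
measures the failure of isometry, which is how Green's identity turns into an identity for `W`. -/
theorem sympForm_add_add {p p' : X} (hp : p ∈ kerAddI J) {w : X} (hw : w ∈ kerSubI J)
    (hJ : IsComplexStructure J) (hp' : p' ∈ kerAddI J) {w' : X} (hw' : w' ∈ kerSubI J) :
    sympForm J (p + w) (p' + w') = Complex.I * (inner ℂ w' w - inner ℂ p' p) := by
  have horth : ∀ {a b : X}, a ∈ kerAddI J → b ∈ kerSubI J → inner ℂ a b = 0 := by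
    intro a b ha hb
    rw [mem_kerAddI] at ha
    rw [mem_kerSubI] at hb
    have h1 := hJ.skew a b
    rw [ha, hb, inner_neg_left, inner_smul_left, inner_smul_right a b, Complex.conj_I] at h1
    have h2 : (2 * Complex.I) * inner ℂ a b = 0 := by linear_combination h1
    exact (mul_eq_zero.1 h2).resolve_left (by simp)
  rw [sympForm, map_add, mem_kerAddI.1 hp, mem_kerSubI.1 hw, inner_add_right, inner_neg_right,
    inner_smul_right (p' + w') p, inner_smul_right (p' + w') w, inner_add_left, inner_add_left,
    horth hp' hw, inner_eq_zero_symm.1 (horth hp hw')]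
  ring

end Lagrangian

/-! ### Reduction of a pair of planes to one plane and the diagonal. -/

section Doubling

variable {X : Type*} [NormedAddCommGroup X] [InnerProductSpace ℂ X]

theorem isComplexStructure_stdJ (𝔥 : Type*) [NormedAddCommGroup 𝔥] [InnerProductSpace ℂ 𝔥] :
    IsComplexStructure (stdJ 𝔥) := by
  refine ⟨stdJ_sq, fun x y => ?_⟩
  simp [stdJ, WithLp.prod_inner_apply]

variable {J : X →L[ℂ] X} {F G Z : Submodule ℂ X}

@[simp]
theorem doubleJ_fst (J : X →L[ℂ] X) (x : WithLp 2 (X × X)) : (doubleJ J x).fst = J x.fst := rfl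

@[simp]
theorem doubleJ_snd (J : X →L[ℂ] X) (x : WithLp 2 (X × X)) : (doubleJ J x).snd = -J x.snd := rfl

theorem withLp_prod_ext {x y : WithLp 2 (X × X)} (h1 : x.fst = y.fst) (h2 : x.snd = y.snd) :
    x = y := by
  apply (WithLp.linearEquiv 2 ℂ (X × X)).injective
  exact Prod.ext h1 h2

theorem isComplexStructure_doubleJ (hJ : IsComplexStructure J) :
    IsComplexStructure (doubleJ J) := by
  refine ⟨fun x => ?_, fun x y => ?_⟩
  · apply withLp_prod_ext
    · simp [hJ.sq]
    · simp [hJ.sq]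
  · simp only [WithLp.prod_inner_apply]
    change inner ℂ (J x.fst) y.fst + inner ℂ (-J x.snd) y.snd =
      -(inner ℂ x.fst (J y.fst) + inner ℂ x.snd (-J y.snd))
    rw [inner_neg_left, inner_neg_right, hJ.skew, hJ.skew]
    ring

theorem mem_planeSum {x : WithLp 2 (X × X)} :
    x ∈ planeSum F G ↔ x.fst ∈ F ∧ x.snd ∈ G := Iff.rfl

theorem mem_diagPlane {x : WithLp 2 (X × X)} : x ∈ diagPlane X ↔ x.fst = x.snd := by
  change x.fst - x.snd = 0 ↔ _
  rw [sub_eq_zero]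

theorem sympForm_doubleJ (x y : WithLp 2 (X × X)) :
    sympForm (doubleJ J) x y = sympForm J x.fst y.fst - sympForm J x.snd y.snd := by
  simp only [sympForm, WithLp.prod_inner_apply]
  change inner ℂ y.fst (J x.fst) + inner ℂ y.snd (-J x.snd) = _
  rw [inner_neg_right]
  ring

theorem sympForm_zero_left (u : X) : sympForm J 0 u = 0 := by simp [sympForm]

theorem sympForm_zero_right (u : X) : sympForm J u 0 = 0 := by simp [sympForm]

theorem IsLagrangian.planeSum (hF : IsLagrangian J F) (hG : IsLagrangian J G) :
    IsLagrangian (doubleJ J) (planeSum F G) := by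
  intro u
  rw [mem_planeSum, hF, hG]
  constructor
  · rintro ⟨h1, h2⟩ v hv
    rw [sympForm_doubleJ, h1 _ (mem_planeSum.1 hv).1, h2 _ (mem_planeSum.1 hv).2, sub_zero]
  · intro h
    refine ⟨fun v hv => ?_, fun v hv => ?_⟩
    · have := h (WithLp.toLp 2 (v, 0)) ⟨hv, G.zero_mem⟩
      rw [sympForm_doubleJ] at this
      simpa [sympForm_zero_right] using this
    · have := h (WithLp.toLp 2 (0, v)) ⟨F.zero_mem, hv⟩
      rw [sympForm_doubleJ] at this
      simpa [sympForm_zero_right] using this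

theorem isLagrangian_diagPlane (hJ : IsComplexStructure J) :
    IsLagrangian (doubleJ J) (diagPlane X) := by
  intro u
  constructor
  · intro hu v hv
    rw [sympForm_doubleJ, mem_diagPlane.1 hu, mem_diagPlane.1 hv, sub_self]
  · intro h
    rw [mem_diagPlane, ← sub_eq_zero]
    have h1 : J (u.fst - u.snd) = 0 := by
      rw [← inner_self_eq_zero (𝕜 := ℂ)]
      have := h (WithLp.toLp 2 (J (u.fst - u.snd), J (u.fst - u.snd))) (mem_diagPlane.2 rfl)
      rw [sympForm_doubleJ] at this
      conv_lhs => rw [map_sub J, inner_sub_right]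
      rw [← map_sub J]
      exact this
    rw [← neg_eq_zero, ← hJ.sq, h1, map_zero]

variable [CompleteSpace X]

theorem planeProj_planeSum (hF : IsClosed (F : Set X)) (hG : IsClosed (G : Set X)) :
    planeProj (planeSum F G) =
      ((WithLp.prodContinuousLinearEquiv 2 ℂ X X).symm : X × X →L[ℂ] WithLp 2 (X × X)) ∘L
        ((planeProj F).prodMap (planeProj G)) ∘L
        ((WithLp.prodContinuousLinearEquiv 2 ℂ X X) : WithLp 2 (X × X) →L[ℂ] X × X) := by
  ext1 x
  have hx : x = WithLp.toLp 2 (planeProj F x.fst, planeProj G x.snd) +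
      WithLp.toLp 2 (x.fst - planeProj F x.fst, x.snd - planeProj G x.snd) := by
    apply withLp_prod_ext <;> simp
  conv_lhs => rw [hx]
  rw [planeProj_eq]
  · rfl
  · exact ⟨planeProj_mem hF _, planeProj_mem hG _⟩
  · intro v hv
    rw [WithLp.prod_inner_apply]
    have h1 := sub_planeProj_mem x.fst _ hv.1
    have h2 := sub_planeProj_mem x.snd _ hv.2
    exact (congrArg₂ (· + ·) h1 h2).trans (add_zero 0)

theorem continuousOn_planeProj_planeSum {T : Type*} [TopologicalSpace T] {s : Set T}
    {F G : T → Submodule ℂ X} (hF : ∀ t ∈ s, IsClosed (F t : Set X))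
    (hG : ∀ t ∈ s, IsClosed (G t : Set X)) (hFc : ContinuousOn (fun t => planeProj (F t)) s)
    (hGc : ContinuousOn (fun t => planeProj (G t)) s) :
    ContinuousOn (fun t => planeProj (planeSum (F t) (G t))) s := by
  have h1 : ContinuousOn (fun t => (planeProj (F t)).prodMap (planeProj (G t))) s :=
    ContinuousOn.prod_mapL ℂ hFc hGc
  have h2 : ContinuousOn (fun t =>
      ((WithLp.prodContinuousLinearEquiv 2 ℂ X X).symm : X × X →L[ℂ] WithLp 2 (X × X)) ∘L
        ((planeProj (F t)).prodMap (planeProj (G t))) ∘L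
        ((WithLp.prodContinuousLinearEquiv 2 ℂ X X) : WithLp 2 (X × X) →L[ℂ] X × X)) s := by
    fun_prop
  exact h2.congr fun t ht => planeProj_planeSum (hF t ht) (hG t ht)

/-- The sum is the range of the bounded operator `(x, y) ↦ P_F x + P_G y`. -/
theorem isClosed_sup_of_finiteDimensional_quotient (hF : IsClosed (F : Set X))
    (hG : IsClosed (G : Set X)) [FiniteDimensional ℂ (X ⧸ (F ⊔ G))] :
    IsClosed ((F ⊔ G : Submodule ℂ X) : Set X) := by
  let f : WithLp 2 (X × X) →L[ℂ] X := ((planeProj F).coprod (planeProj G)) ∘L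
    ((WithLp.prodContinuousLinearEquiv 2 ℂ X X) : WithLp 2 (X × X) →L[ℂ] X × X)
  have hf : LinearMap.range (f : WithLp 2 (X × X) →ₗ[ℂ] X) = F ⊔ G := by
    apply le_antisymm
    · rintro _ ⟨x, rfl⟩
      exact Submodule.add_mem_sup (planeProj_mem hF x.fst) (planeProj_mem hG x.snd)
    · intro x hx
      obtain ⟨p, hp, q, hq, rfl⟩ := Submodule.mem_sup.1 hx
      refine ⟨WithLp.toLp 2 (p, q), ?_⟩
      change planeProj F p + planeProj G q = p + q
      have h1 := planeProj_eq hp (Fᗮ.zero_mem)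
      have h2 := planeProj_eq hq (Gᗮ.zero_mem)
      rw [add_zero] at h1 h2
      rw [h1, h2]
  have : FiniteDimensional ℂ (X ⧸ LinearMap.range (f : WithLp 2 (X × X) →ₗ[ℂ] X)) := by
    rw [hf]; infer_instance
  have h := isClosed_range_of_finiteDimensional_quotient f
  rw [← hf]
  exact h

/-- The intersection with the diagonal. -/
def planeSumInfDiagEquiv (F G : Submodule ℂ X) :
    (planeSum F G ⊓ diagPlane X : Submodule ℂ (WithLp 2 (X × X))) ≃ₗ[ℂ]
      (F ⊓ G : Submodule ℂ X) where
  toFun x := ⟨x.1.fst, x.2.1.1, by rw [mem_diagPlane.1 x.2.2]; exact x.2.1.2⟩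
  invFun x := ⟨WithLp.toLp 2 (x, x), ⟨x.2.1, x.2.2⟩, mem_diagPlane.2 rfl⟩
  left_inv x := Subtype.ext (withLp_prod_ext rfl (mem_diagPlane.1 x.2.2))
  right_inv x := rfl
  map_add' x y := rfl
  map_smul' c x := rfl

/-- The difference map `(x, y) ↦ x - y` pulls `F + G` back into `F ⊕ G` plus the diagonal, so the
codimension does not grow. -/
theorem IsFredholmPair.planeSum (hF : IsClosed (F : Set X)) (hG : IsClosed (G : Set X))
    (h : IsFredholmPair F G) : IsFredholmPair (planeSum F G) (diagPlane X) := by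
  obtain ⟨h1, -, h3⟩ := h
  have hq : FiniteDimensional ℂ (WithLp 2 (X × X) ⧸ (_root_.planeSum F G ⊔ diagPlane X)) := by
    let d : WithLp 2 (X × X) →ₗ[ℂ] X := (LinearMap.fst ℂ X X - LinearMap.snd ℂ X X) ∘ₗ
      (WithLp.linearEquiv 2 ℂ (X × X)).toLinearMap
    have hd : ∀ x, d x = x.fst - x.snd := fun _ => rfl
    have hle : (F ⊔ G).comap d ≤ _root_.planeSum F G ⊔ diagPlane X := by
      intro x hx
      obtain ⟨p, hp, q, hq, hpq⟩ := Submodule.mem_sup.1 hx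
      rw [hd] at hpq
      have : x = WithLp.toLp 2 (p, -q) + WithLp.toLp 2 (x.fst - p, x.snd + q) := by
        apply withLp_prod_ext <;> simp
      rw [this]
      refine Submodule.add_mem_sup ⟨hp, G.neg_mem hq⟩ (mem_diagPlane.2 ?_)
      change x.fst - p = x.snd + q
      rw [sub_eq_iff_eq_add, add_assoc, add_comm q, hpq]
      abel
    have hfin : FiniteDimensional ℂ (WithLp 2 (X × X) ⧸ (F ⊔ G).comap d) := by
      apply FiniteDimensional.of_injective (Submodule.mapQ _ (F ⊔ G) d le_rfl)
      rw [← LinearMap.ker_eq_bot, Submodule.ker_mapQ, Submodule.mkQ_map_self]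
    exact Submodule.CoFG.of_le hle hfin
  refine ⟨(planeSumInfDiagEquiv F G).symm.finiteDimensional, ?_, hq⟩
  apply isClosed_sup_of_finiteDimensional_quotient
  · exact ((hF.preimage (WithLp.prod_continuous_ofLp 2 X X |>.fst)).inter
      (hG.preimage (WithLp.prod_continuous_ofLp 2 X X |>.snd)))
  · have : (diagPlane X : Set (WithLp 2 (X × X))) = {x | x.fst = x.snd} :=
      Set.ext fun x => mem_diagPlane
    rw [this]
    exact isClosed_eq (WithLp.prod_continuous_ofLp 2 X X |>.fst)
      (WithLp.prod_continuous_ofLp 2 X X |>.snd)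

end Doubling

/-! ### Continuous right inverses of surjective operators. -/

section SurjectiveOperators

variable {E F : Type*} [NormedAddCommGroup E] [InnerProductSpace ℂ E] [CompleteSpace E]
variable [NormedAddCommGroup F] [InnerProductSpace ℂ F] [CompleteSpace F]

open ContinuousLinearMap (adjoint)

/-- The open mapping constant `C` gives `‖y‖ ≤ C‖Ψ* y‖`, so `Ψ Ψ*` is coercive with constant `C⁻²`.
Invertibility of `Ψ Ψ*` is an open condition, equivalent to surjectivity of `Ψ`, and makes
`rightInv` continuous. -/
theorem isUnit_comp_adjoint_of_surjective {Ψ : E →L[ℂ] F} (h : Function.Surjective Ψ) :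
    IsUnit (Ψ ∘L adjoint Ψ) := by
  obtain ⟨C, hC, hpre⟩ := Ψ.exists_preimage_norm_le h
  have hbound : ∀ y, ‖y‖ ≤ C * ‖adjoint Ψ y‖ := by
    intro y
    obtain ⟨x, rfl, hx⟩ := hpre y
    rcases eq_or_ne (Ψ x) 0 with h0 | h0
    · rw [h0]; simp
    have h1 : ‖Ψ x‖ * ‖Ψ x‖ ≤ ‖Ψ x‖ * (C * ‖adjoint Ψ (Ψ x)‖) := by
      calc ‖Ψ x‖ * ‖Ψ x‖ = ‖inner ℂ (Ψ x) (Ψ x)‖ := by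
            rw [inner_self_eq_norm_sq_to_K]; simp [sq]
        _ = ‖inner ℂ x (adjoint Ψ (Ψ x))‖ := by rw [ContinuousLinearMap.adjoint_inner_right]
        _ ≤ ‖x‖ * ‖adjoint Ψ (Ψ x)‖ := norm_inner_le_norm _ _
        _ ≤ C * ‖Ψ x‖ * ‖adjoint Ψ (Ψ x)‖ := by gcongr
        _ = _ := by ring
    exact le_of_mul_le_mul_left h1 (norm_pos_iff.2 h0)
  let c : NNReal := ⟨(C ^ 2)⁻¹, by positivity⟩
  apply ContinuousLinearMap.isUnit_of_forall_le_norm_inner_map _ (c := c)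
  · change (0 : ℝ) < (C ^ 2)⁻¹
    positivity
  · intro x
    rw [ContinuousLinearMap.comp_apply, ← ContinuousLinearMap.adjoint_inner_right,
      inner_self_eq_norm_sq_to_K]
    change ‖x‖ ^ 2 * (C ^ 2)⁻¹ ≤ _
    have h1 : ‖((‖adjoint Ψ x‖ : ℂ)) ^ 2‖ = ‖adjoint Ψ x‖ ^ 2 := by simp
    refine le_trans ?_ h1.ge
    rw [← div_eq_mul_inv, div_le_iff₀ (by positivity), ← mul_pow, mul_comm]
    gcongr
    exact hbound x

theorem surjective_of_isUnit_comp_adjoint {Ψ : E →L[ℂ] F} (h : IsUnit (Ψ ∘L adjoint Ψ)) :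
    Function.Surjective Ψ := by
  intro y
  refine ⟨adjoint Ψ (Ring.inverse (Ψ ∘L adjoint Ψ) y), ?_⟩
  have := congrArg (fun L : F →L[ℂ] F => L y) (Ring.mul_inverse_cancel _ h)
  exact this

/-- The right inverse `Ψ* (Ψ Ψ*)⁻¹` of a surjective operator. -/
def rightInv (Ψ : E →L[ℂ] F) : F →L[ℂ] E := adjoint Ψ ∘L Ring.inverse (Ψ ∘L adjoint Ψ)

theorem apply_rightInv {Ψ : E →L[ℂ] F} (h : Function.Surjective Ψ) (y : F) :
    Ψ (rightInv Ψ y) = y :=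
  congrArg (fun L : F →L[ℂ] F => L y)
    (Ring.mul_inverse_cancel _ (isUnit_comp_adjoint_of_surjective h))

theorem ContinuousOn.rightInv {T : Type*} [TopologicalSpace T] {s : Set T} {Ψ : T → E →L[ℂ] F}
    (hc : ContinuousOn Ψ s) (h : ∀ t ∈ s, Function.Surjective (Ψ t)) :
    ContinuousOn (fun t => rightInv (Ψ t)) s := by
  have h1 : ContinuousOn (fun t => adjoint (Ψ t)) s :=
    (ContinuousLinearMap.adjoint (𝕜 := ℂ) (E := E) (F := F)).continuous.comp_continuousOn hc
  have h2 : ContinuousOn (fun t => Ψ t ∘L adjoint (Ψ t)) s := hc.clm_comp h1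
  refine h1.clm_comp fun t ht => ?_
  obtain ⟨u, hu⟩ := isUnit_comp_adjoint_of_surjective (h t ht)
  have h3 := NormedRing.inverse_continuousAt u
  rw [hu] at h3
  exact ContinuousAt.comp_continuousWithinAt (f := fun t => Ψ t ∘L adjoint (Ψ t)) h3 (h2 t ht)

open Filter Topology in
theorem eventually_surjective {T : Type*} [TopologicalSpace T] {s : Set T} {Ψ : T → E →L[ℂ] F}
    {t₀ : T} (hc : ContinuousWithinAt Ψ s t₀) (h : Function.Surjective (Ψ t₀)) :
    ∀ᶠ t in 𝓝[s] t₀, Function.Surjective (Ψ t) := by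
  have h1 : ContinuousWithinAt (fun t => adjoint (Ψ t)) s t₀ :=
    (ContinuousLinearMap.adjoint (𝕜 := ℂ) (E := E) (F := F)).continuous.continuousAt
      |>.comp_continuousWithinAt hc
  have h2 : ContinuousWithinAt (fun t => Ψ t ∘L adjoint (Ψ t)) s t₀ := hc.clm_comp h1
  filter_upwards [h2 (Units.isOpen.mem_nhds (isUnit_comp_adjoint_of_surjective h))] with t ht
  exact surjective_of_isUnit_comp_adjoint ht

end SurjectiveOperators

/-! ### Solutions and their traces for one operator. -/

section TraceSystem

variable {D H X : Type*} [NormedAddCommGroup D] [InnerProductSpace ℂ D] [CompleteSpace D]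
variable [NormedAddCommGroup H] [InnerProductSpace ℂ H] [CompleteSpace H]
variable [NormedAddCommGroup X] [InnerProductSpace ℂ X] [CompleteSpace X]

/-- The domain `D` of the adjoint of a symmetric operator, with its embedding `ι`, the adjoint
operator `M` and a trace `Tr` whose kernel is the domain of the symmetric operator. -/
structure TraceSystem (J : X →L[ℂ] X) (ι M : D →L[ℂ] H) (Tr : D →L[ℂ] X) : Prop where
  green : ∀ f g, inner ℂ (ι g) (M f) - inner ℂ (M g) (ι f) = sympForm J (Tr f) (Tr g)
  surjective : Function.Surjective Tr
  injective : ∀ d, ι d = 0 → d = 0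
  norm_le : ∀ d, ‖d‖ ≤ ‖ι d‖ + ‖M d‖
  exists_of_adjoint : ∀ u v, (∀ w, Tr w = 0 → inner ℂ u (M w) = inner ℂ v (ι w)) →
    ∃ d, ι d = u ∧ M d = v

/-- The restriction of `M` to the preimage of `G` under the trace has compact resolvent. -/
def CompactResolventOn (ι M : D →L[ℂ] H) (Tr : D →L[ℂ] X) (G : Submodule ℂ X) : Prop :=
  ∃ (z : ℂ) (R : H →L[ℂ] H), IsCompactOperator R ∧
    (∀ y, ∃ d, Tr d ∈ G ∧ ι d = R y ∧ M d - z • R y = y) ∧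
    ∀ d, Tr d ∈ G → R (M d - z • ι d) = ι d

/-- `M + B`. -/
def perturbed (ι M : D →L[ℂ] H) (B : H →L[ℂ] H) : D →L[ℂ] H := M + B ∘L ι

/-- The traces of the solutions of `(M + B) u = 0`. -/
def tracePlane (ι M : D →L[ℂ] H) (Tr : D →L[ℂ] X) (B : H →L[ℂ] H) : Submodule ℂ X :=
  (LinearMap.ker (perturbed ι M B : D →ₗ[ℂ] H)).map (Tr : D →ₗ[ℂ] X)

/-- The solutions of `(M + B) u = 0` with trace in `G`. -/
def kerOn (ι M : D →L[ℂ] H) (Tr : D →L[ℂ] X) (B : H →L[ℂ] H) (G : Submodule ℂ X) :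
    Submodule ℂ D :=
  LinearMap.ker (perturbed ι M B : D →ₗ[ℂ] H) ⊓ G.comap (Tr : D →ₗ[ℂ] X)

variable {J : X →L[ℂ] X} {ι M : D →L[ℂ] H} {Tr : D →L[ℂ] X} {B : H →L[ℂ] H} {G : Submodule ℂ X}

theorem sympForm_symm (hJ : IsComplexStructure J) {u v : X} (h : sympForm J u v = 0) :
    sympForm J v u = 0 := by
  rw [sympForm, ← inner_conj_symm, hJ.skew]
  rw [sympForm] at h
  rw [h]; simp

theorem eq_zero_of_sympForm (hJ : IsComplexStructure J) {u : X} (h : ∀ v, sympForm J u v = 0) :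
    u = 0 := by
  have h1 : J u = 0 := by
    rw [← inner_self_eq_zero (𝕜 := ℂ)]
    exact h (J u)
  rw [← neg_eq_zero, ← hJ.sq, h1, map_zero]

theorem perturbed_apply (d : D) : perturbed ι M B d = M d + B (ι d) := rfl

namespace TraceSystem

theorem green_perturbed (h : TraceSystem J ι M Tr) (hB : ∀ x y, inner ℂ (B x) y = inner ℂ x (B y))
    (f g : D) : inner ℂ (ι g) (perturbed ι M B f) - inner ℂ (perturbed ι M B g) (ι f) =
      sympForm J (Tr f) (Tr g) := by
  rw [← h.green, perturbed_apply, perturbed_apply, inner_add_right, inner_add_left, hB]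
  ring

theorem exists_of_orthogonal (h : TraceSystem J ι M Tr)
    (hB : ∀ x y, inner ℂ (B x) y = inner ℂ x (B y)) {y : H}
    (hy : ∀ w, Tr w = 0 → inner ℂ y (perturbed ι M B w) = 0) :
    ∃ d, ι d = y ∧ perturbed ι M B d = 0 := by
  obtain ⟨d, h1, h2⟩ := h.exists_of_adjoint y (-B y) fun w hw => by
    have := hy w hw
    rw [perturbed_apply, inner_add_right, ← hB] at this
    rw [inner_neg_left]
    exact eq_neg_of_add_eq_zero_left this
  exact ⟨d, h1, by rw [perturbed_apply, h1, h2, neg_add_cancel]⟩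

/-- A solution of the boundary value problem satisfies `R(B + z)u = -u`, so the kernel embeds in an
eigenspace of a compact operator for a nonzero eigenvalue. -/
theorem finiteDimensional_ker_inf (h : TraceSystem J ι M Tr)
    (hcomp : CompactResolventOn ι M Tr G) (B : H →L[ℂ] H) :
    FiniteDimensional ℂ (kerOn ι M Tr B G) := by
  obtain ⟨z, R, hR, -, hleft⟩ := hcomp
  let C : H →L[ℂ] H := R ∘L (B + z • 1)
  have hC : IsCompactOperator C := hR.comp_clm _
  let E : Submodule ℂ H := LinearMap.ker ((C + 1 : H →L[ℂ] H) : H →ₗ[ℂ] H)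
  have hEmem : ∀ x, x ∈ E ↔ C x = -x := by
    intro x
    change C x + x = 0 ↔ _
    rw [add_eq_zero_iff_eq_neg]
  have hEcl : IsClosed (E : Set H) := (C + 1 : H →L[ℂ] H).isClosed_ker
  have hEfin : FiniteDimensional ℂ E := by
    apply FiniteDimensional.of_isCompactOperator_id (𝕜 := ℂ)
    have h1 : ∀ v ∈ E, (C : H →ₗ[ℂ] H) v ∈ E := by
      intro v hv
      have := (hEmem v).1 hv
      change C v ∈ E
      rw [this]
      exact E.neg_mem hv
    have h2 := (IsCompactOperator.restrict (f := (C : H →ₗ[ℂ] H)) hC h1 hEcl).neg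
    have h3 : (-⇑((C : H →ₗ[ℂ] H).restrict h1)) = id := by
      funext v
      apply Subtype.ext
      change -(C v) = (v : H)
      rw [(hEmem v).1 v.2, neg_neg]
    rw [h3] at h2
    exact h2
  let f : (kerOn ι M Tr B G) →ₗ[ℂ] E :=
    LinearMap.codRestrict E ((ι : D →ₗ[ℂ] H) ∘ₗ (kerOn ι M Tr B G).subtype) fun d => by
      rw [hEmem]
      change R (B (ι d) + z • ι d) = -ι d
      have h1 : M d + B (ι d) = 0 := d.2.1
      rw [← hleft d d.2.2, ← map_neg]
      congr 1
      rw [hleft d d.2.2, eq_neg_of_add_eq_zero_left h1]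
      abel
  apply FiniteDimensional.of_injective f
  rw [injective_iff_map_eq_zero]
  intro d hd
  exact Subtype.ext (h.injective _ (congrArg Subtype.val hd))

/-- Let `N` be the kernel, viewed in `H`. On `Tr⁻¹ G`, the operator `M + B + P_N` is `1 + C` after
`M - z`, with `C = (B + P_N + z)R` compact. Symmetry makes it injective, the Fredholm alternative
makes it onto, and so the finite-dimensional `N` spans the quotient. -/
theorem cofinite_map (h : TraceSystem J ι M Tr) (hG : IsLagrangian J G)
    (hcomp : CompactResolventOn ι M Tr G) (hB : ∀ x y, inner ℂ (B x) y = inner ℂ x (B y)) :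
    FiniteDimensional ℂ (H ⧸ (G.comap (Tr : D →ₗ[ℂ] X)).map (perturbed ι M B : D →ₗ[ℂ] H)) := by
  have hfin := h.finiteDimensional_ker_inf hcomp B
  set N := (kerOn ι M Tr B G).map (ι : D →ₗ[ℂ] H) with hN
  have hNfin : FiniteDimensional ℂ N := inferInstance
  obtain ⟨z, R, hR, hright, hleft⟩ := hcomp
  let S : H →L[ℂ] H := B + N.starProjection + z • 1
  let C : H →L[ℂ] H := S ∘L R
  have hC : IsCompactOperator C := hR.clm_comp S
  have hsum : ∀ y : H, ∃ d, Tr d ∈ G ∧ ι d = R y ∧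
      perturbed ι M B d + N.starProjection (ι d) = y + C y := by
    intro y
    obtain ⟨d, h1, h2, h3⟩ := hright y
    refine ⟨d, h1, h2, ?_⟩
    change M d + B (ι d) + _ = y + (B (R y) + N.starProjection (R y) + z • R y)
    rw [h2]
    conv_rhs => lhs; rw [← h3]
    abel
  have hinj : ∀ y, y + C y = 0 → y = 0 := by
    intro y hy
    obtain ⟨d, h1, h2, h3⟩ := hsum y
    rw [hy] at h3
    -- The boundary value problem is symmetric, so its range is orthogonal to its kernel; hence both
    -- terms of a vanishing sum `(M + B)d + P_N(ι d)` vanish.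
    have h4 : inner ℂ (N.starProjection (ι d)) (perturbed ι M B d) = 0 := by
      obtain ⟨n, hn, hnι⟩ := N.starProjection_apply_mem (ι d)
      have hn1 : perturbed ι M B n = 0 := hn.1
      have := h.green_perturbed hB d n
      rw [hn1, inner_zero_left, sub_zero, show sympForm J (Tr d) (Tr n) = 0 from (hG _).1 h1 _ hn.2] at this
      rw [← hnι]
      exact this
    have h5 : N.starProjection (ι d) = 0 := by
      rw [← inner_self_eq_zero (𝕜 := ℂ)]
      nth_rw 2 [eq_neg_of_add_eq_zero_right h3]
      rw [inner_neg_right, h4, neg_zero]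
    rw [h5, add_zero] at h3
    have h6 : ι d ∈ N := ⟨d, ⟨h3, h1⟩, rfl⟩
    have h7 : ι d = 0 := by
      rw [← h5]
      exact (Submodule.starProjection_eq_self_iff.2 h6).symm
    have h8 := h.injective d h7
    obtain ⟨d', h1', h2', h3'⟩ := hright y
    have h9 : d' = 0 := h.injective d' (by rw [h2', ← h2, h7])
    rw [h9, map_zero, ← h2, h7, smul_zero, sub_zero] at h3'
    exact h3'.symm
  have hsurj : Function.Surjective ((1 + C : H →L[ℂ] H)) := by
    rcases hC.hasEigenvalue_or_mem_resolventSet (μ := (-1 : ℂ)) (by simp) with h1 | h1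
    · obtain ⟨v, hv⟩ := h1.exists_hasEigenvector
      refine absurd (hinj v ?_) hv.2
      have : C v = (-1 : ℂ) • v := hv.apply_eq_smul
      rw [this]; simp
    · rw [spectrum.mem_resolventSet_iff] at h1
      have h2 : (1 + C : H →L[ℂ] H) = -(algebraMap ℂ (H →L[ℂ] H) (-1) - C) := by
        simp [add_comm]
      rw [h2]
      have := (ContinuousLinearMap.isUnit_iff_bijective.1 h1.neg).2
      exact this
  let q := ((G.comap (Tr : D →ₗ[ℂ] X)).map (perturbed ι M B : D →ₗ[ℂ] H)).mkQ
  apply Module.Finite.of_surjective (q ∘ₗ N.subtype)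
  intro x
  obtain ⟨x, rfl⟩ := Submodule.mkQ_surjective _ x
  obtain ⟨y, rfl⟩ := hsurj x
  obtain ⟨d, h1, -, h3⟩ := hsum y
  refine ⟨⟨_, N.starProjection_apply_mem (ι d)⟩, ?_⟩
  change q _ = q (y + C y)
  rw [← h3, map_add]
  have : q (perturbed ι M B d) = 0 := (Submodule.Quotient.mk_eq_zero _).2 ⟨d, h1, rfl⟩
  rw [this, zero_add]
  rfl

/-- A vector orthogonal to the range is a solution by the adjoint property. Green's identity against
arbitrary `w` and surjectivity of the trace show that its trace vanishes, and unique continuation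
applies. -/
theorem surjective_perturbed (h : TraceSystem J ι M Tr) (hJ : IsComplexStructure J)
    (hG : IsLagrangian J G) (hcomp : CompactResolventOn ι M Tr G)
    (hB : ∀ x y, inner ℂ (B x) y = inner ℂ x (B y))
    (huc : ∀ d, perturbed ι M B d = 0 → Tr d = 0 → d = 0) :
    Function.Surjective (perturbed ι M B) := by
  have hcof := h.cofinite_map hG hcomp hB
  have hfin : FiniteDimensional ℂ (H ⧸ LinearMap.range (perturbed ι M B : D →ₗ[ℂ] H)) :=
    Submodule.CoFG.of_le LinearMap.map_le_range hcof
  have hcl := isClosed_range_of_finiteDimensional_quotient (perturbed ι M B)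
  rw [← ContinuousLinearMap.coe_coe, ← LinearMap.range_eq_top]
  set L := LinearMap.range (perturbed ι M B : D →ₗ[ℂ] H) with hL
  have : CompleteSpace L := IsClosed.completeSpace_coe (hs := hcl)
  rw [← Submodule.orthogonal_eq_bot_iff, Submodule.eq_bot_iff]
  intro y hy
  have hy' : ∀ w, inner ℂ y (perturbed ι M B w) = 0 := fun w =>
    Submodule.inner_left_of_mem_orthogonal (show perturbed ι M B w ∈ L from ⟨w, rfl⟩) hy
  obtain ⟨d, rfl, hd⟩ := h.exists_of_orthogonal hB fun w _ => hy' w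
  have h1 : Tr d = 0 := by
    apply eq_zero_of_sympForm hJ
    intro v
    obtain ⟨w, rfl⟩ := h.surjective v
    apply sympForm_symm hJ
    rw [← h.green_perturbed hB, hd, hy', inner_zero_left, sub_zero]
  rw [huc d hd h1, map_zero]

/-- Test Green's identity with `w` such that `(M + B)w = ι d`. Injectivity of the trace on solutions
thus follows from surjectivity, and so is also available slightly below `κ`. -/
theorem eq_zero_of_trace_eq_zero (h : TraceSystem J ι M Tr)
    (hB : ∀ x y, inner ℂ (B x) y = inner ℂ x (B y))
    (hs : Function.Surjective (perturbed ι M B)) {d : D} (hd : perturbed ι M B d = 0)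
    (hTr : Tr d = 0) : d = 0 := by
  apply h.injective
  rw [← inner_self_eq_zero (𝕜 := ℂ)]
  obtain ⟨w, hw⟩ := hs (ι d)
  have := h.green_perturbed hB w d
  rw [hd, hTr, hw, inner_zero_left, sub_zero, sympForm_zero_right] at this
  exact this

/-- For zero trace, Green's identity gives `‖ι d‖² = ⟨(M + B)d, R(ι d)⟩` with `R` a bounded right
inverse. So `M + B` is bounded below on `ker Tr` in the graph norm. -/
theorem isClosed_map_ker (h : TraceSystem J ι M Tr)
    (hB : ∀ x y, inner ℂ (B x) y = inner ℂ x (B y))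
    (hs : Function.Surjective (perturbed ι M B)) :
    IsClosed (((LinearMap.ker (Tr : D →ₗ[ℂ] X)).map (perturbed ι M B : D →ₗ[ℂ] H) :
      Submodule ℂ H) : Set H) := by
  set R := ι ∘L rightInv (perturbed ι M B) with hR
  have h1 : ∀ d, Tr d = 0 → ‖ι d‖ ≤ ‖R‖ * ‖perturbed ι M B d‖ := by
    intro d hd
    rcases eq_or_ne (ι d) 0 with h0 | h0
    · rw [h0, norm_zero]; positivity
    have h2 := h.green_perturbed hB (rightInv (perturbed ι M B) (ι d)) d
    rw [apply_rightInv hs, hd, sympForm_zero_right, sub_eq_zero] at h2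
    have h3 : ‖ι d‖ * ‖ι d‖ ≤ ‖ι d‖ * (‖R‖ * ‖perturbed ι M B d‖) := by
      calc ‖ι d‖ * ‖ι d‖ = ‖inner ℂ (ι d) (ι d)‖ := by
            rw [inner_self_eq_norm_sq_to_K]; simp [sq]
        _ = ‖inner ℂ (perturbed ι M B d) (R (ι d))‖ := by rw [h2]; rfl
        _ ≤ ‖perturbed ι M B d‖ * ‖R (ι d)‖ := norm_inner_le_norm _ _
        _ ≤ ‖perturbed ι M B d‖ * (‖R‖ * ‖ι d‖) := by gcongr; exact R.le_opNorm _
        _ = _ := by ring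
    exact le_of_mul_le_mul_left h3 (norm_pos_iff.2 h0)
  have hbd : ∀ d, Tr d = 0 → ‖d‖ ≤ (‖R‖ + 1 + ‖B‖ * ‖R‖) * ‖perturbed ι M B d‖ := by
    intro d hd
    have h2 : ‖M d‖ ≤ ‖perturbed ι M B d‖ + ‖B‖ * ‖ι d‖ := by
      have : M d = perturbed ι M B d - B (ι d) := by rw [perturbed_apply]; abel
      rw [this]
      refine (norm_sub_le _ _).trans ?_
      gcongr
      exact B.le_opNorm _
    calc ‖d‖ ≤ ‖ι d‖ + ‖M d‖ := h.norm_le d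
      _ ≤ ‖ι d‖ + (‖perturbed ι M B d‖ + ‖B‖ * ‖ι d‖) := by gcongr
      _ ≤ ‖R‖ * ‖perturbed ι M B d‖ + (‖perturbed ι M B d‖ +
          ‖B‖ * (‖R‖ * ‖perturbed ι M B d‖)) := by gcongr <;> exact h1 d hd
      _ = _ := by ring
  have hkcl : IsClosed (LinearMap.ker (Tr : D →ₗ[ℂ] X) : Set D) := Tr.isClosed_ker
  have : CompleteSpace (LinearMap.ker (Tr : D →ₗ[ℂ] X)) := hkcl.completeSpace_coe
  let f : LinearMap.ker (Tr : D →ₗ[ℂ] X) →L[ℂ] H :=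
    perturbed ι M B ∘L (LinearMap.ker (Tr : D →ₗ[ℂ] X)).subtypeL
  have hanti : AntilipschitzWith (‖R‖₊ + 1 + ‖B‖₊ * ‖R‖₊) f := by
    apply ContinuousLinearMap.antilipschitz_of_bound
    intro d
    exact hbd d d.2
  have hcl := hanti.isClosed_range f.uniformContinuous
  convert hcl using 1
  ext y
  constructor
  · rintro ⟨d, hd, rfl⟩
    exact ⟨⟨d, hd⟩, rfl⟩
  · rintro ⟨d, rfl⟩
    exact ⟨d, d.2, rfl⟩

/-- Isotropy is Green's identity. For maximality, if `Tr d` annihilates the plane, then `(M + B)d`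
is orthogonal to all solutions, hence lies in the closed space `(M + B)(ker Tr)`; subtracting a
suitable `w ∈ ker Tr` turns `d` into a solution with the same trace. -/
theorem isLagrangian_tracePlane (h : TraceSystem J ι M Tr)
    (hB : ∀ x y, inner ℂ (B x) y = inner ℂ x (B y))
    (hs : Function.Surjective (perturbed ι M B)) : IsLagrangian J (tracePlane ι M Tr B) := by
  intro x
  constructor
  · rintro ⟨f, hf, rfl⟩ _ ⟨g, hg, rfl⟩
    have hf' : perturbed ι M B f = 0 := hf
    have hg' : perturbed ι M B g = 0 := hg
    have := h.green_perturbed hB f g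
    rw [hf', hg', inner_zero_left, inner_zero_right, sub_zero] at this
    exact this.symm
  · intro hx
    obtain ⟨d, rfl⟩ := h.surjective x
    set L := (LinearMap.ker (Tr : D →ₗ[ℂ] X)).map (perturbed ι M B : D →ₗ[ℂ] H) with hL
    have hcl : IsClosed (L : Set H) := h.isClosed_map_ker hB hs
    have hmem : perturbed ι M B d ∈ L := by
      rw [← IsClosed.submodule_topologicalClosure_eq hcl,
        ← Submodule.orthogonal_orthogonal_eq_closure]
      intro y hy
      obtain ⟨n, rfl, hn⟩ := h.exists_of_orthogonal hB (y := y) fun w hw =>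
        Submodule.inner_left_of_mem_orthogonal (⟨w, hw, rfl⟩ : perturbed ι M B w ∈ L) hy
      have := h.green_perturbed hB d n
      rw [hn, inner_zero_left, sub_zero, show sympForm J (Tr d) (Tr n) = 0 from hx _ ⟨n, hn, rfl⟩] at this
      exact this
    obtain ⟨w, hw, hwd⟩ := hmem
    have hw' : Tr w = 0 := hw
    have hwd' : perturbed ι M B w = perturbed ι M B d := hwd
    refine ⟨d - w, ?_, ?_⟩
    · change perturbed ι M B (d - w) = 0
      rw [map_sub, hwd', sub_self]
    · change Tr (d - w) = Tr d
      rw [map_sub, hw', sub_zero]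

/-- `ker (M + B) ∩ Tr⁻¹ G ≃ K ∩ G`. -/
def kerInfEquiv (h : TraceSystem J ι M Tr)
    (hB : ∀ x y, inner ℂ (B x) y = inner ℂ x (B y))
    (hs : Function.Surjective (perturbed ι M B)) (G : Submodule ℂ X) :
    (kerOn ι M Tr B G) ≃ₗ[ℂ] (tracePlane ι M Tr B ⊓ G : Submodule ℂ X) :=
  LinearEquiv.ofBijective
    (LinearMap.codRestrict (tracePlane ι M Tr B ⊓ G) ((Tr : D →ₗ[ℂ] X) ∘ₗ (kerOn ι M Tr B G).subtype)
      fun d => Submodule.mem_inf.2 ⟨Submodule.mem_map_of_mem d.2.1, d.2.2⟩) <| by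
    constructor
    · rw [injective_iff_map_eq_zero]
      intro d hd
      exact Subtype.ext (h.eq_zero_of_trace_eq_zero hB hs d.2.1 (congrArg Subtype.val hd))
    · rintro ⟨_, ⟨d, hd, rfl⟩, hdG⟩
      exact ⟨⟨d, Submodule.mem_inf.2 ⟨hd, hdG⟩⟩, rfl⟩

/-- If `(M + B)d = (M + B)w` with `Tr w ∈ G`, then `Tr d` is the trace of the solution `d - w` plus
an element of `G`. So the cofinite range of the boundary value problem yields a cofinite sum of
planes. -/
theorem isFredholmPair (h : TraceSystem J ι M Tr) (hG : IsLagrangian J G)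
    (hcomp : CompactResolventOn ι M Tr G) (hB : ∀ x y, inner ℂ (B x) y = inner ℂ x (B y))
    (hs : Function.Surjective (perturbed ι M B)) : IsFredholmPair (tracePlane ι M Tr B) G := by
  have hfin := h.finiteDimensional_ker_inf hcomp B
  have hcof := h.cofinite_map hG hcomp hB
  have hq : FiniteDimensional ℂ (X ⧸ (tracePlane ι M Tr B ⊔ G)) := by
    set S := ((G.comap (Tr : D →ₗ[ℂ] X)).map (perturbed ι M B : D →ₗ[ℂ] H)).comap
      (perturbed ι M B : D →ₗ[ℂ] H) with hS
    have hD : FiniteDimensional ℂ (D ⧸ S) := by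
      apply FiniteDimensional.of_injective (Submodule.mapQ S _ (perturbed ι M B : D →ₗ[ℂ] H) le_rfl)
      rw [← LinearMap.ker_eq_bot, Submodule.ker_mapQ, Submodule.mkQ_map_self]
    have hle : S ≤ (tracePlane ι M Tr B ⊔ G).comap (Tr : D →ₗ[ℂ] X) := by
      rintro d ⟨w, hw, hwd⟩
      have hwd' : perturbed ι M B w = perturbed ι M B d := hwd
      have h1 : Tr d = Tr (d - w) + Tr w := by rw [map_sub]; abel
      change Tr d ∈ tracePlane ι M Tr B ⊔ G
      rw [h1]
      refine Submodule.add_mem_sup (show Tr (d - w) ∈ tracePlane ι M Tr B from ⟨d - w, ?_, rfl⟩)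
        (show Tr w ∈ G from hw)
      change perturbed ι M B (d - w) = 0
      rw [map_sub, hwd', sub_self]
    apply Module.Finite.of_surjective (Submodule.mapQ S _ (Tr : D →ₗ[ℂ] X) hle)
    intro x
    obtain ⟨x, rfl⟩ := Submodule.mkQ_surjective _ x
    obtain ⟨d, rfl⟩ := h.surjective x
    exact ⟨S.mkQ d, rfl⟩
  exact ⟨(h.kerInfEquiv hB hs G).finiteDimensional,
    isClosed_sup_of_finiteDimensional_quotient (h.isLagrangian_tracePlane hB hs).isClosed
      hG.isClosed, hq⟩

end TraceSystem

end TraceSystem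

/-! ### Continuity of the plane of traces. -/

section TracePlaneContinuity

variable {D H X : Type*} [NormedAddCommGroup D] [InnerProductSpace ℂ D] [CompleteSpace D]
variable [NormedAddCommGroup H] [InnerProductSpace ℂ H] [CompleteSpace H]
variable [NormedAddCommGroup X] [InnerProductSpace ℂ X] [CompleteSpace X]

/-- A projection onto the kernel of a surjective operator. -/
def kerProj (Φ : D →L[ℂ] H) : D →L[ℂ] D := 1 - rightInv Φ ∘L Φ

theorem apply_kerProj {Φ : D →L[ℂ] H} (h : Function.Surjective Φ) (d : D) :
    Φ (kerProj Φ d) = 0 := by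
  change Φ (d - rightInv Φ (Φ d)) = 0
  rw [map_sub, apply_rightInv h, sub_self]

theorem kerProj_eq_self {Φ : D →L[ℂ] H} {d : D} (h : Φ d = 0) : kerProj Φ d = d := by
  change d - rightInv Φ (Φ d) = d
  rw [h, map_zero, sub_zero]

/-- `(u, v) ↦ S u + J S v`, where `S` is the trace composed with the projection onto `ker Φ`. -/
def planeSplit (J : X →L[ℂ] X) (Φ : D →L[ℂ] H) (Tr : D →L[ℂ] X) : WithLp 2 (D × D) →L[ℂ] X :=
  (Tr ∘L kerProj Φ) ∘L WithLp.fstL 2 ℂ D D + J ∘L (Tr ∘L kerProj Φ) ∘L WithLp.sndL 2 ℂ D D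

/-- A right inverse of the trace from its image on `ker Φ`, extended by zero. -/
def solMap (J : X →L[ℂ] X) (Φ : D →L[ℂ] H) (Tr : D →L[ℂ] X) : X →L[ℂ] D :=
  kerProj Φ ∘L WithLp.fstL 2 ℂ D D ∘L rightInv (planeSplit J Φ Tr)

variable {J : X →L[ℂ] X} {Φ : D →L[ℂ] H} {Tr : D →L[ℂ] X}

/-- For a Lagrangian plane `K` the orthogonal complement is `J K`, so `X = K + J K`. -/
theorem planeSplit_surjective (hJ : IsComplexStructure J)
    (hK : IsLagrangian J ((LinearMap.ker (Φ : D →ₗ[ℂ] H)).map (Tr : D →ₗ[ℂ] X))) :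
    Function.Surjective (planeSplit J Φ Tr) := by
  intro x
  obtain ⟨p, ⟨u, hu, rfl⟩, q, hq, rfl⟩ := exists_add_of_isClosed hK.isClosed x
  have h1 : -J q ∈ (LinearMap.ker (Φ : D →ₗ[ℂ] H)).map (Tr : D →ₗ[ℂ] X) := by
    rw [hK.mem_iff, map_neg, hJ.sq, neg_neg]
    exact hq
  obtain ⟨v, hv, hvq⟩ := h1
  have hvq' : Tr v = -J q := hvq
  refine ⟨WithLp.toLp 2 (u, v), ?_⟩
  change Tr (kerProj Φ u) + J (Tr (kerProj Φ v)) = Tr u + q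
  rw [kerProj_eq_self hu, kerProj_eq_self hv, hvq', map_neg, hJ.sq, neg_neg]

theorem apply_solMap (h : Function.Surjective Φ) (x : X) : Φ (solMap J Φ Tr x) = 0 :=
  apply_kerProj h _

/-- The right inverse of `planeSplit` writes `x` as a vector of the plane plus one of its orthogonal
complement. So the projection is a composition of operators that depend continuously on `Φ` and
`Tr`. -/
theorem trace_solMap (hJ : IsComplexStructure J) (h : Function.Surjective Φ)
    (hK : IsLagrangian J ((LinearMap.ker (Φ : D →ₗ[ℂ] H)).map (Tr : D →ₗ[ℂ] X))) (x : X) :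
    Tr (solMap J Φ Tr x) =
      planeProj ((LinearMap.ker (Φ : D →ₗ[ℂ] H)).map (Tr : D →ₗ[ℂ] X)) x := by
  set uv := rightInv (planeSplit J Φ Tr) x with huv
  have h1 : Tr (kerProj Φ uv.fst) + J (Tr (kerProj Φ uv.snd)) = x :=
    apply_rightInv (planeSplit_surjective hJ hK) x
  have hmem : ∀ d, Tr (kerProj Φ d) ∈ (LinearMap.ker (Φ : D →ₗ[ℂ] H)).map (Tr : D →ₗ[ℂ] X) :=
    fun d => ⟨_, apply_kerProj h d, rfl⟩
  conv_rhs => rw [← h1]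
  rw [planeProj_eq (hmem _) ((hK.mem_iff _).1 (hmem _))]
  rfl

section Continuity

variable {T : Type*} [TopologicalSpace T] {s : Set T} {Φ : T → D →L[ℂ] H} {Tr : T → D →L[ℂ] X}

theorem continuousOn_solMap (hJ : IsComplexStructure J) (hΦ : ContinuousOn Φ s)
    (hTr : ContinuousOn Tr s) (h : ∀ t ∈ s, Function.Surjective (Φ t))
    (hK : ∀ t ∈ s,
      IsLagrangian J ((LinearMap.ker (Φ t : D →ₗ[ℂ] H)).map (Tr t : D →ₗ[ℂ] X))) :
    ContinuousOn (fun t => solMap J (Φ t) (Tr t)) s := by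
  have h1 : ContinuousOn (fun t => kerProj (Φ t)) s :=
    continuousOn_const.sub ((hΦ.rightInv h).clm_comp hΦ)
  have h2 : ContinuousOn (fun t => Tr t ∘L kerProj (Φ t)) s := hTr.clm_comp h1
  have h3 : ContinuousOn (fun t => planeSplit J (Φ t) (Tr t)) s :=
    (h2.clm_comp continuousOn_const).add
      (continuousOn_const.clm_comp (h2.clm_comp continuousOn_const))
  exact h1.clm_comp (continuousOn_const.clm_comp
    (h3.rightInv fun t ht => planeSplit_surjective hJ (hK t ht)))

theorem continuousOn_planeProj_map_ker (hJ : IsComplexStructure J) (hΦ : ContinuousOn Φ s)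
    (hTr : ContinuousOn Tr s) (h : ∀ t ∈ s, Function.Surjective (Φ t))
    (hK : ∀ t ∈ s,
      IsLagrangian J ((LinearMap.ker (Φ t : D →ₗ[ℂ] H)).map (Tr t : D →ₗ[ℂ] X))) :
    ContinuousOn (fun t =>
      planeProj ((LinearMap.ker (Φ t : D →ₗ[ℂ] H)).map (Tr t : D →ₗ[ℂ] X))) s := by
  have h1 : ContinuousOn (fun t => Tr t ∘L solMap J (Φ t) (Tr t)) s :=
    hTr.clm_comp (continuousOn_solMap hJ hΦ hTr h hK)
  refine h1.congr fun t ht => ?_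
  ext1 x
  exact (trace_solMap hJ (h t ht) (hK t ht) x).symm

end Continuity

end TracePlaneContinuity

/-! ### The family of unitary operators of the boundary value problems. -/

section TraceFamily

open Filter Topology

variable {D H X : Type*} [NormedAddCommGroup D] [InnerProductSpace ℂ D] [CompleteSpace D]
variable [NormedAddCommGroup H] [InnerProductSpace ℂ H] [CompleteSpace H]
variable [NormedAddCommGroup X] [InnerProductSpace ℂ X] [CompleteSpace X]

/-- A continuous family of self-adjoint boundary value problems, with compact resolvents, for
the operators `M + V t`. -/
structure TraceFamily (J : X →L[ℂ] X) (ι M : D →L[ℂ] H) (V : ℝ → H →L[ℂ] H)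
    (Tr : ℝ → D →L[ℂ] X) (G : ℝ → Submodule ℂ X) (I : Set ℝ) : Prop where
  isComplexStructure : IsComplexStructure J
  cont_V : ContinuousOn V I
  symm_V : ∀ t ∈ I, ∀ x y, inner ℂ (V t x) y = inner ℂ x (V t y)
  system : ∀ t ∈ I, TraceSystem J ι M (Tr t)
  cont_Tr : ContinuousOn Tr I
  lagrangian : ∀ t ∈ I, IsLagrangian J (G t)
  cont_G : ContinuousOn (fun t => planeProj (G t)) I
  compact : ∀ t ∈ I, CompactResolventOn ι M (Tr t) (G t)

/-- `V - μ`. -/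
def shifted (V : H →L[ℂ] H) (μ : ℝ) : H →L[ℂ] H := V - (μ : ℂ) • 1

/-- The unitary operator `U V⁻¹` of the pair `(K, G)`, where `K` consists of the traces of
solutions of `(M + V - μ) u = 0`. -/
def pairUnitary (J : X →L[ℂ] X) (ι M : D →L[ℂ] H) (V : H →L[ℂ] H) (Tr : D →L[ℂ] X)
    (G : Submodule ℂ X) (μ : ℝ) : kerSubI (doubleJ J) →L[ℂ] kerSubI (doubleJ J) :=
  souriau (doubleJ J) (planeSum (tracePlane ι M Tr (shifted V μ)) G) (diagPlane X)

/-- The element of `K ⊕ G` that corresponds to an element of `ker (J - i)`. -/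
def pairVector (J : X →L[ℂ] X) (ι M : D →L[ℂ] H) (V : H →L[ℂ] H) (Tr : D →L[ℂ] X)
    (G : Submodule ℂ X) (μ : ℝ) : kerSubI (doubleJ J) →L[ℂ] WithLp 2 (X × X) :=
  reflect (diagPlane X) ∘L (kerSubI (doubleJ J)).subtypeL +
    (kerSubI (doubleJ J)).subtypeL ∘L pairUnitary J ι M V Tr G μ

/-- The solution whose trace is the first coordinate of `pairVector`. -/
def pairSolution (J : X →L[ℂ] X) (ι M : D →L[ℂ] H) (V : H →L[ℂ] H) (Tr : D →L[ℂ] X)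
    (G : Submodule ℂ X) (μ : ℝ) : kerSubI (doubleJ J) →L[ℂ] H :=
  ι ∘L solMap J (perturbed ι M (shifted V μ)) Tr ∘L WithLp.fstL 2 ℂ X X ∘L pairVector J ι M V Tr G μ

variable {J : X →L[ℂ] X} {ι M : D →L[ℂ] H} {V : ℝ → H →L[ℂ] H} {Tr : ℝ → D →L[ℂ] X}
  {G : ℝ → Submodule ℂ X} {I : Set ℝ} {t μ : ℝ}

theorem shifted_apply (V : H →L[ℂ] H) (μ : ℝ) (x : H) : shifted V μ x = V x - (μ : ℂ) • x := rfl

namespace TraceFamily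

theorem mono (h : TraceFamily J ι M V Tr G I) {I' : Set ℝ} (hI : I' ⊆ I) :
    TraceFamily J ι M V Tr G I' where
  isComplexStructure := h.isComplexStructure
  cont_V := h.cont_V.mono hI
  symm_V t ht := h.symm_V t (hI ht)
  system t ht := h.system t (hI ht)
  cont_Tr := h.cont_Tr.mono hI
  lagrangian t ht := h.lagrangian t (hI ht)
  cont_G := h.cont_G.mono hI
  compact t ht := h.compact t (hI ht)

theorem symm_shifted (h : TraceFamily J ι M V Tr G I) (ht : t ∈ I) (μ : ℝ) (x y : H) :
    inner ℂ (shifted (V t) μ x) y = inner ℂ x (shifted (V t) μ y) := by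
  rw [shifted_apply, shifted_apply, inner_sub_left, inner_sub_right, inner_smul_left,
    inner_smul_right x y, h.symm_V t ht, Complex.conj_ofReal]

theorem isLagrangian_tracePlane (h : TraceFamily J ι M V Tr G I) (ht : t ∈ I)
    (hs : Function.Surjective (perturbed ι M (shifted (V t) μ))) :
    IsLagrangian J (tracePlane ι M (Tr t) (shifted (V t) μ)) :=
  (h.system t ht).isLagrangian_tracePlane (h.symm_shifted ht μ) hs

theorem isFredholmPair (h : TraceFamily J ι M V Tr G I) (ht : t ∈ I)
    (hs : Function.Surjective (perturbed ι M (shifted (V t) μ))) :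
    IsFredholmPair (tracePlane ι M (Tr t) (shifted (V t) μ)) (G t) :=
  (h.system t ht).isFredholmPair (h.lagrangian t ht) (h.compact t ht) (h.symm_shifted ht μ) hs

theorem continuousOn_perturbed (h : TraceFamily J ι M V Tr G I) (s : Set ℝ) :
    ContinuousOn (fun p : ℝ × ℝ => perturbed ι M (shifted (V p.2) p.1)) (s ×ˢ I) := by
  have h1 : ContinuousOn (fun p : ℝ × ℝ => V p.2) (s ×ˢ I) :=
    h.cont_V.comp continuousOn_snd fun p hp => hp.2
  have h2 : ContinuousOn (fun p : ℝ × ℝ => (p.1 : ℂ) • (1 : H →L[ℂ] H)) (s ×ˢ I) := by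
    fun_prop
  exact continuousOn_const.add ((h1.sub h2).clm_comp continuousOn_const)

/-- `ker (U V⁻¹ - 1)` is isomorphic to the kernel of the boundary value problem. -/
def pairUnitaryEquiv (h : TraceFamily J ι M V Tr G I) (ht : t ∈ I)
    (hs : Function.Surjective (perturbed ι M (shifted (V t) μ))) :
    circleEigenspace (pairUnitary J ι M (V t) (Tr t) (G t) μ) 0 ≃ₗ[ℂ]
      kerOn ι M (Tr t) (shifted (V t) μ) (G t) :=
  ((circleEigenspaceEquiv (isComplexStructure_doubleJ h.isComplexStructure)
    ((h.isLagrangian_tracePlane ht hs).planeSum (h.lagrangian t ht))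
    (isLagrangian_diagPlane h.isComplexStructure)).trans (planeSumInfDiagEquiv _ _)).trans
    ((h.system t ht).kerInfEquiv (h.symm_shifted ht μ) hs (G t)).symm

theorem pairVector_mem (h : TraceFamily J ι M V Tr G I) (ht : t ∈ I)
    (hs : Function.Surjective (perturbed ι M (shifted (V t) μ))) (y : kerSubI (doubleJ J)) :
    pairVector J ι M (V t) (Tr t) (G t) μ y ∈
      planeSum (tracePlane ι M (Tr t) (shifted (V t) μ)) (G t) := by
  have hF := (h.isLagrangian_tracePlane ht hs).planeSum (h.lagrangian t ht)
  change reflect (diagPlane X) y + (pairUnitary J ι M (V t) (Tr t) (G t) μ y :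
    WithLp 2 (X × X)) ∈ _
  rw [pairUnitary, souriau_apply (isComplexStructure_doubleJ h.isComplexStructure) hF
    (isLagrangian_diagPlane h.isComplexStructure)]
  exact reflect_add_self_mem hF.isClosed _

theorem sympForm_solMap (h : TraceFamily J ι M V Tr G I) (ht : t ∈ I) {ν : ℝ}
    (hs : Function.Surjective (perturbed ι M (shifted (V t) μ)))
    (hs' : Function.Surjective (perturbed ι M (shifted (V t) ν))) {f g : X}
    (hf : f ∈ tracePlane ι M (Tr t) (shifted (V t) μ))
    (hg : g ∈ tracePlane ι M (Tr t) (shifted (V t) ν)) :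
    sympForm J f g = ((μ - ν : ℝ) : ℂ) *
      inner ℂ (ι (solMap J (perturbed ι M (shifted (V t) ν)) (Tr t) g))
        (ι (solMap J (perturbed ι M (shifted (V t) μ)) (Tr t) f)) := by
  have key : ∀ {μ : ℝ} {f : X}, Function.Surjective (perturbed ι M (shifted (V t) μ)) →
      f ∈ tracePlane ι M (Tr t) (shifted (V t) μ) →
      Tr t (solMap J (perturbed ι M (shifted (V t) μ)) (Tr t) f) = f ∧
      M (solMap J (perturbed ι M (shifted (V t) μ)) (Tr t) f) =
        (μ : ℂ) • ι (solMap J (perturbed ι M (shifted (V t) μ)) (Tr t) f) -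
        V t (ι (solMap J (perturbed ι M (shifted (V t) μ)) (Tr t) f)) := by
    intro μ f hs hf
    constructor
    · rw [trace_solMap h.isComplexStructure hs (h.isLagrangian_tracePlane ht hs)]
      have := planeProj_eq hf (Submodule.zero_mem _)
      rwa [add_zero] at this
    · have := apply_solMap (J := J) (Tr := Tr t) hs f
      rw [perturbed_apply, shifted_apply] at this
      rw [eq_neg_of_add_eq_zero_left this, neg_sub]
  obtain ⟨h1, h2⟩ := key hs hf
  obtain ⟨h3, h4⟩ := key hs' hg
  set u := solMap J (perturbed ι M (shifted (V t) μ)) (Tr t) f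
  set v := solMap J (perturbed ι M (shifted (V t) ν)) (Tr t) g
  rw [← h1, ← h3, ← (h.system t ht).green, h2, h4, inner_sub_left, inner_sub_right,
    inner_smul_left, inner_smul_right (ι v) (ι u), h.symm_V t ht, Complex.conj_ofReal,
    Complex.ofReal_sub]
  ring

/-- Evaluate the doubled form on the two pair vectors. Second coordinates both lie in the Lagrangian
`G t` and contribute nothing; first coordinates are traces of solutions and give `(μ - ν)` times the
inner product of the solutions. -/
theorem green_pairUnitary (h : TraceFamily J ι M V Tr G I) (ht : t ∈ I) {ν : ℝ}
    (hs : Function.Surjective (perturbed ι M (shifted (V t) μ)))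
    (hs' : Function.Surjective (perturbed ι M (shifted (V t) ν))) (y y' : kerSubI (doubleJ J)) :
    inner ℂ (pairUnitary J ι M (V t) (Tr t) (G t) ν y')
      (pairUnitary J ι M (V t) (Tr t) (G t) μ y) - inner ℂ y' y =
      -Complex.I * ((μ - ν : ℝ) : ℂ) * inner ℂ (pairSolution J ι M (V t) (Tr t) (G t) ν y')
        (pairSolution J ι M (V t) (Tr t) (G t) μ y) := by
  have hJ2 := isComplexStructure_doubleJ h.isComplexStructure
  have hZ := isLagrangian_diagPlane h.isComplexStructure
  have hm := h.pairVector_mem ht hs y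
  have hm' := h.pairVector_mem ht hs' y'
  have h1 : sympForm J (pairVector J ι M (V t) (Tr t) (G t) μ y).fst
      (pairVector J ι M (V t) (Tr t) (G t) ν y').fst = ((μ - ν : ℝ) : ℂ) *
        inner ℂ (pairSolution J ι M (V t) (Tr t) (G t) ν y')
        (pairSolution J ι M (V t) (Tr t) (G t) μ y) :=
    h.sympForm_solMap ht hs hs' (mem_planeSum.1 hm).1 (mem_planeSum.1 hm').1
  have h2 : sympForm J (pairVector J ι M (V t) (Tr t) (G t) μ y).snd
      (pairVector J ι M (V t) (Tr t) (G t) ν y').snd = 0 :=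
    ((h.lagrangian t ht) _).1 (mem_planeSum.1 hm).2 _ (mem_planeSum.1 hm').2
  have h3 : sympForm (doubleJ J) (pairVector J ι M (V t) (Tr t) (G t) μ y)
      (pairVector J ι M (V t) (Tr t) (G t) ν y') = _ :=
    sympForm_add_add (reflect_mem_kerAddI hJ2 hZ y.2)
      (pairUnitary J ι M (V t) (Tr t) (G t) μ y).2 hJ2 (reflect_mem_kerAddI hJ2 hZ y'.2)
      (pairUnitary J ι M (V t) (Tr t) (G t) ν y').2
  rw [inner_reflect hZ.isClosed, reflect_reflect hZ.isClosed, sympForm_doubleJ, h1, h2,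
    sub_zero] at h3
  rw [mul_assoc, h3, ← mul_assoc, neg_mul, Complex.I_mul_I, neg_neg, one_mul]
  rfl

/-- For a fixed vector `y` the pair vector is diagonal; if its solution vanishes so does its first
coordinate, hence the whole vector, whose component in `ker (J - i)` is `y`. -/
theorem eq_zero_of_pairSolution (h : TraceFamily J ι M V Tr G I) (ht : t ∈ I)
    (hs : Function.Surjective (perturbed ι M (shifted (V t) μ))) {y : kerSubI (doubleJ J)}
    (hy : pairUnitary J ι M (V t) (Tr t) (G t) μ y = y)
    (hy0 : pairSolution J ι M (V t) (Tr t) (G t) μ y = 0) : y = 0 := by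
  have hJ2 := isComplexStructure_doubleJ h.isComplexStructure
  have hZ := isLagrangian_diagPlane h.isComplexStructure
  have hL := h.isLagrangian_tracePlane ht hs
  have hm := h.pairVector_mem ht hs y
  have hx : pairVector J ι M (V t) (Tr t) (G t) μ y = y + reflect (diagPlane X) y := by
    change reflect (diagPlane X) y + (pairUnitary J ι M (V t) (Tr t) (G t) μ y :
      WithLp 2 (X × X)) = _
    rw [hy, add_comm]
  have hd : pairVector J ι M (V t) (Tr t) (G t) μ y ∈ diagPlane X := by
    rw [hx]
    exact reflect_add_self_mem hZ.isClosed _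
  have h1 : solMap J (perturbed ι M (shifted (V t) μ)) (Tr t)
      (pairVector J ι M (V t) (Tr t) (G t) μ y).fst = 0 := (h.system t ht).injective _ hy0
  have h2 := trace_solMap h.isComplexStructure hs hL
    (pairVector J ι M (V t) (Tr t) (G t) μ y).fst
  have h3 := planeProj_eq (mem_planeSum.1 hm).1 (Submodule.zero_mem _)
  rw [add_zero] at h3
  have h4 : (pairVector J ι M (V t) (Tr t) (G t) μ y).fst = 0 := by
    rw [← h3]
    exact h2.symm.trans (by rw [h1, map_zero])
  have h5 : pairVector J ι M (V t) (Tr t) (G t) μ y = 0 :=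
    withLp_prod_ext h4 ((mem_diagPlane.1 hd).symm.trans h4)
  rw [hx] at h5
  apply Subtype.ext
  apply eq_zero_of_mem_ker_of_mem_ker (J := doubleJ J) y.2
  rw [eq_neg_of_add_eq_zero_left h5]
  exact Submodule.neg_mem _ (reflect_mem_kerAddI hJ2 hZ y.2)

theorem continuousOn_tracePlane (h : TraceFamily J ι M V Tr G I) {s : Set ℝ}
    (hs : ∀ μ ∈ s, ∀ t ∈ I, Function.Surjective (perturbed ι M (shifted (V t) μ))) :
    ContinuousOn (fun p : ℝ × ℝ => planeProj (tracePlane ι M (Tr p.2) (shifted (V p.2) p.1)))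
      (s ×ˢ I) := by
  have hTr : ContinuousOn (fun p : ℝ × ℝ => Tr p.2) (s ×ˢ I) :=
    h.cont_Tr.comp continuousOn_snd fun p hp => hp.2
  exact continuousOn_planeProj_map_ker h.isComplexStructure (h.continuousOn_perturbed s) hTr
    (fun p hp => hs _ hp.1 _ hp.2)
    (fun p hp => h.isLagrangian_tracePlane hp.2 (hs _ hp.1 _ hp.2))

theorem continuousOn_pairUnitary (h : TraceFamily J ι M V Tr G I) {s : Set ℝ}
    (hs : ∀ μ ∈ s, ∀ t ∈ I, Function.Surjective (perturbed ι M (shifted (V t) μ))) :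
    ContinuousOn (fun p : ℝ × ℝ => pairUnitary J ι M (V p.2) (Tr p.2) (G p.2) p.1)
      (s ×ˢ I) := by
  have hL : ∀ p ∈ s ×ˢ I,
      IsLagrangian J (tracePlane ι M (Tr p.2) (shifted (V p.2) p.1)) :=
    fun p hp => h.isLagrangian_tracePlane hp.2 (hs _ hp.1 _ hp.2)
  have hG : ContinuousOn (fun p : ℝ × ℝ => planeProj (G p.2)) (s ×ˢ I) :=
    h.cont_G.comp (f := fun p : ℝ × ℝ => p.2) continuousOn_snd fun p hp => hp.2
  exact continuousOn_souriau (isComplexStructure_doubleJ h.isComplexStructure)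
    (fun p hp => (hL p hp).planeSum (h.lagrangian _ hp.2))
    (isLagrangian_diagPlane h.isComplexStructure) (continuousOn_planeProj_planeSum
      (fun p hp => (hL p hp).isClosed) (fun p hp => (h.lagrangian _ hp.2).isClosed)
      (h.continuousOn_tracePlane hs) hG)

theorem monotoneFamily (h : TraceFamily J ι M V Tr G I) {c d : ℝ}
    (hs : ∀ μ ∈ Set.Icc c d, ∀ t ∈ I, Function.Surjective (perturbed ι M (shifted (V t) μ)))
    (hbase : ∀ t ∈ I, kerOn ι M (Tr t) (shifted (V t) c) (G t) = ⊥) (hcd : c ≤ d) :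
    MonotoneFamily (fun μ t => pairUnitary J ι M (V t) (Tr t) (G t) μ)
      (fun μ t => pairSolution J ι M (V t) (Tr t) (G t) μ) c d I := by
  have hJ := h.isComplexStructure
  have hJ2 := isComplexStructure_doubleJ hJ
  have hZ := isLagrangian_diagPlane hJ
  have hL : ∀ p ∈ Set.Icc c d ×ˢ I,
      IsLagrangian J (tracePlane ι M (Tr p.2) (shifted (V p.2) p.1)) :=
    fun p hp => h.isLagrangian_tracePlane hp.2 (hs _ hp.1 _ hp.2)
  have hS : ∀ p ∈ Set.Icc c d ×ˢ I, IsLagrangian (doubleJ J)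
      (planeSum (tracePlane ι M (Tr p.2) (shifted (V p.2) p.1)) (G p.2)) :=
    fun p hp => (hL p hp).planeSum (h.lagrangian _ hp.2)
  have hΦ := h.continuousOn_perturbed (Set.Icc c d)
  have hTr : ContinuousOn (fun p : ℝ × ℝ => Tr p.2) (Set.Icc c d ×ˢ I) :=
    h.cont_Tr.comp continuousOn_snd fun p hp => hp.2
  have hW := h.continuousOn_pairUnitary hs
  have hE := continuousOn_solMap hJ hΦ hTr (fun p hp => hs _ hp.1 _ hp.2) hL
  have hB : ContinuousOn (fun p : ℝ × ℝ => pairSolution J ι M (V p.2) (Tr p.2) (G p.2) p.1)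
      (Set.Icc c d ×ˢ I) :=
    continuousOn_const.clm_comp (hE.clm_comp (continuousOn_const.clm_comp
      (continuousOn_const.add (continuousOn_const.clm_comp hW))))
  have hslice : ∀ t ∈ I, ContinuousOn (fun μ : ℝ => (μ, t)) (Set.Icc c d) := fun t _ => by fun_prop
  refine ⟨fun t ht => ⟨?_, ?_, ?_, ?_, ?_, ?_⟩, hW, fun t ht => ?_⟩
  · exact fun μ hμ => souriau_mem_unitary hJ2 (hS (μ, t) ⟨hμ, ht⟩) hZ
  · exact ContinuousOn.comp (f := fun μ : ℝ => (μ, t))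
      (g := fun p : ℝ × ℝ => pairUnitary J ι M (V p.2) (Tr p.2) (G p.2) p.1) hW (hslice t ht) fun μ hμ => ⟨hμ, ht⟩
  · exact ContinuousOn.comp (f := fun μ : ℝ => (μ, t))
      (g := fun p : ℝ × ℝ => pairSolution J ι M (V p.2) (Tr p.2) (G p.2) p.1) hB (hslice t ht) fun μ hμ => ⟨hμ, ht⟩
  · exact fun μ hμ ν hν y y' => h.green_pairUnitary ht (hs μ hμ t ht) (hs ν hν t ht) y y'
  · exact fun μ hμ y => h.eq_zero_of_pairSolution ht (hs μ hμ t ht)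
  · intro μ hμ
    exact exists_admArc_souriau hJ2 (hS (μ, t) ⟨hμ, ht⟩) hZ
      ((h.isFredholmPair ht (hs μ hμ t ht)).planeSum (hL (μ, t) ⟨hμ, ht⟩).isClosed
        (h.lagrangian t ht).isClosed)
  · have e := h.pairUnitaryEquiv ht (hs c ⟨le_rfl, hcd⟩ t ht)
    rw [hbase t ht] at e
    rw [Submodule.eq_bot_iff]
    intro x hx
    have : e ⟨x, hx⟩ = 0 := Subsingleton.elim _ _
    exact congrArg Subtype.val (e.map_eq_zero_iff.1 this)

end TraceFamily

end TraceFamily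

/-! ### Morse index and Maslov index of a trace family. -/

section MorseMaslov

open Filter Topology

variable {D H X : Type*} [NormedAddCommGroup D] [InnerProductSpace ℂ D] [CompleteSpace D]
variable [NormedAddCommGroup H] [InnerProductSpace ℂ H] [CompleteSpace H]
variable [NormedAddCommGroup X] [InnerProductSpace ℂ X] [CompleteSpace X]

/-- The number of negative eigenvalues of the boundary value problem. -/
def morseCount (ι M : D →L[ℂ] H) (V : H →L[ℂ] H) (Tr : D →L[ℂ] X) (G : Submodule ℂ X) : ℕ :=
  ∑ᶠ μ ∈ Set.Iio (0 : ℝ), Module.finrank ℂ (kerOn ι M Tr (shifted V μ) G)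

variable {J : X →L[ℂ] X} {ι M : D →L[ℂ] H} {V : ℝ → H →L[ℂ] H} {Tr : ℝ → D →L[ℂ] X}
  {G : ℝ → Submodule ℂ X} {I : Set ℝ} {κ b c t t₀ : ℝ}

namespace TraceFamily

theorem surjective_perturbed (h : TraceFamily J ι M V Tr G I) (ht : t ∈ I) {μ : ℝ}
    (huc : ∀ d, perturbed ι M (shifted (V t) μ) d = 0 → Tr t d = 0 → d = 0) :
    Function.Surjective (perturbed ι M (shifted (V t) μ)) :=
  (h.system t ht).surjective_perturbed h.isComplexStructure (h.lagrangian t ht) (h.compact t ht)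
    (h.symm_shifted ht μ) huc

/-- Eigenvalues are excluded only strictly below `κ`, so the spectral parameter has to start there.
Surjectivity is open in `(t, μ)`, and compactness of `[c, b]` gives one neighbourhood of `t₀` for
all `μ`. -/
theorem exists_lt_eventually_surjective (h : TraceFamily J ι M V Tr G I) (ht₀ : t₀ ∈ I)
    (hs : ∀ μ, κ ≤ μ → Function.Surjective (perturbed ι M (shifted (V t₀) μ))) (b : ℝ) :
    ∃ c < κ, ∀ᶠ t in 𝓝[I] t₀, ∀ μ ∈ Set.Icc c b,
      Function.Surjective (perturbed ι M (shifted (V t) μ)) := by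
  have hcont : ContinuousOn (fun p : ℝ × ℝ => perturbed ι M (shifted (V p.1) p.2))
      (I ×ˢ Set.univ) :=
    ContinuousOn.comp (g := fun p : ℝ × ℝ => perturbed ι M (shifted (V p.2) p.1))
      (f := Prod.swap) (h.continuousOn_perturbed Set.univ) continuous_swap.continuousOn
      fun p hp => ⟨hp.2, hp.1⟩
  have hev : ∀ μ, Function.Surjective (perturbed ι M (shifted (V t₀) μ)) →
      ∀ᶠ p : ℝ × ℝ in 𝓝 (t₀, μ), p.1 ∈ I →
        Function.Surjective (perturbed ι M (shifted (V p.1) p.2)) := by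
    intro μ hμ
    have h1 := eventually_surjective (hcont (t₀, μ) ⟨ht₀, trivial⟩) hμ
    rw [eventually_nhdsWithin_iff] at h1
    filter_upwards [h1] with p hp hpI
    exact hp ⟨hpI, trivial⟩
  have h2 : ∀ᶠ μ in 𝓝 κ, Function.Surjective (perturbed ι M (shifted (V t₀) μ)) := by
    have h3 : Tendsto (fun μ : ℝ => (t₀, μ)) (𝓝 κ) (𝓝 (t₀, κ)) :=
      (Continuous.prodMk_right t₀).tendsto κ
    filter_upwards [h3.eventually (hev κ (hs κ le_rfl))] with μ hμ
    exact hμ ht₀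
  obtain ⟨δ, hδ, hball⟩ := Metric.eventually_nhds_iff.1 h2
  refine ⟨κ - δ / 2, by linarith, ?_⟩
  have h4 : ∀ᶠ t in 𝓝 t₀, ∀ μ ∈ Set.Icc (κ - δ / 2) b, t ∈ I →
      Function.Surjective (perturbed ι M (shifted (V t) μ)) := by
    apply isCompact_Icc.eventually_forall_of_forall_eventually
    intro μ hμ
    apply hev
    rcases le_or_gt κ μ with h5 | h5
    · exact hs μ h5
    · apply hball
      rw [Real.dist_eq, abs_lt]
      constructor <;> linarith [hμ.1]
  rw [eventually_nhdsWithin_iff]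
  filter_upwards [h4] with t ht htI μ hμ
  exact ht μ hμ htI

theorem crossCount_eq_morseCount (h : TraceFamily J ι M V Tr G I) (ht : t ∈ I)
    (hs : ∀ μ ∈ Set.Icc c 0, Function.Surjective (perturbed ι M (shifted (V t) μ)))
    (hlow : ∀ μ < c, kerOn ι M (Tr t) (shifted (V t) μ) (G t) = ⊥) :
    crossCount (fun μ => pairUnitary J ι M (V t) (Tr t) (G t) μ) c 0 =
      morseCount ι M (V t) (Tr t) (G t) := by
  refine finsum_congr fun μ => ?_
  by_cases h1 : μ < 0
  · by_cases h2 : c ≤ μ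
    · rw [finsum_eq_if, finsum_eq_if, if_pos ⟨h2, h1⟩, if_pos (Set.mem_Iio.2 h1)]
      exact (h.pairUnitaryEquiv ht (hs μ ⟨h2, h1.le⟩)).finrank_eq
    · rw [hlow μ (not_le.1 h2)]
      simp [h2]
  · simp [h1]

theorem finite_negative (h : TraceFamily J ι M V Tr G I) (ht : t ∈ I)
    (hs : ∀ μ ∈ Set.Icc c 0, Function.Surjective (perturbed ι M (shifted (V t) μ)))
    (hlow : ∀ μ ≤ c, kerOn ι M (Tr t) (shifted (V t) μ) (G t) = ⊥) (hc : c ≤ 0) :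
    {μ : ℝ | μ < 0 ∧ kerOn ι M (Tr t) (shifted (V t) μ) (G t) ≠ ⊥}.Finite := by
  have hM := (h.mono (Set.singleton_subset_iff.2 ht)).monotoneFamily (c := c) (d := 0)
    (by rintro μ hμ _ rfl; exact hs μ hμ) (by rintro _ rfl; exact hlow c le_rfl) hc
  refine (hM.curve t rfl).finite_crossings.subset ?_
  rintro μ ⟨h1, h2⟩
  have h3 : c ≤ μ := by
    by_contra h4
    exact h2 (hlow μ (not_le.1 h4).le)
  refine ⟨⟨h3, h1.le⟩, fun hbot => h2 ?_⟩
  have e := h.pairUnitaryEquiv ht (hs μ ⟨h3, h1.le⟩)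
  change circleEigenspace (pairUnitary J ι M (V t) (Tr t) (G t) μ) 0 = ⊥ at hbot
  rw [hbot] at e
  rw [Submodule.eq_bot_iff]
  intro x hx
  have : e.symm ⟨x, hx⟩ = 0 := Subsingleton.elim _ _
  exact congrArg Subtype.val (e.symm.map_eq_zero_iff.1 this)

theorem eventually_morseCount_add (h : TraceFamily J ι M V Tr G I) (ht₀ : t₀ ∈ I)
    (hκ : κ ≤ 0) (hs : ∀ μ, κ ≤ μ → Function.Surjective (perturbed ι M (shifted (V t₀) μ)))
    (hlow : ∀ t ∈ I, ∀ μ < κ, kerOn ι M (Tr t) (shifted (V t) μ) (G t) = ⊥) {ε : ℝ}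
    (hε : ε ∈ Set.Ioo 0 Real.pi)
    (hadm : AdmArc (pairUnitary J ι M (V t₀) (Tr t₀) (G t₀) 0) (-ε) ε) :
    ∀ᶠ t in 𝓝[I] t₀, morseCount ι M (V t) (Tr t) (G t) +
      arcCount (pairUnitary J ι M (V t) (Tr t) (G t) 0) ε =
      morseCount ι M (V t₀) (Tr t₀) (G t₀) +
        arcCount (pairUnitary J ι M (V t₀) (Tr t₀) (G t₀) 0) ε := by
  obtain ⟨c, hcκ, hev⟩ := h.exists_lt_eventually_surjective ht₀ hs 0
  -- The start `c` depends on `t₀`; on `I'` the family is monotone over `[c, 0]`, and `I'` agrees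
  -- with `I` near `t₀`.
  set I' := {t | ∀ μ ∈ Set.Icc c 0, Function.Surjective (perturbed ι M (shifted (V t) μ))} ∩ I
    with hI'
  have hnhds : 𝓝[I'] t₀ = 𝓝[I] t₀ := nhdsWithin_inter_of_mem hev
  have ht₀' : t₀ ∈ I' := ⟨hev.self_of_nhdsWithin ht₀, ht₀⟩
  have hM := (h.mono (I' := I') Set.inter_subset_right).monotoneFamily (c := c) (d := 0)
    (fun μ hμ t ht => ht.1 μ hμ) (fun t ht => hlow t ht.2 c hcκ) (hcκ.le.trans hκ)
  have hloc := hM.locConst (hcκ.le.trans hκ) ht₀' hε hadm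
  have hcount : ∀ t ∈ I', crossCount (fun μ => pairUnitary J ι M (V t) (Tr t) (G t) μ) c 0 =
      morseCount ι M (V t) (Tr t) (G t) := fun t ht =>
    h.crossCount_eq_morseCount ht.2 ht.1 fun μ hμ => hlow t ht.2 μ (hμ.trans hcκ)
  rw [← hnhds]
  filter_upwards [hloc, self_mem_nhdsWithin] with t h1 h2
  rw [← hcount t h2, ← hcount t₀ ht₀']
  exact h1

theorem hasMaslovIndexPair {α β : ℝ} (h : TraceFamily J ι M V Tr G (Set.Icc α β)) (hαβ : α < β)
    (hκ : κ ≤ 0) (hs : ∀ t ∈ Set.Icc α β, ∀ μ, κ ≤ μ →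
      Function.Surjective (perturbed ι M (shifted (V t) μ)))
    (hlow : ∀ t ∈ Set.Icc α β, ∀ μ < κ, kerOn ι M (Tr t) (shifted (V t) μ) (G t) = ⊥)
    {K : ℝ → Submodule ℂ X} (hK : ∀ t ∈ Set.Icc α β, K t = tracePlane ι M (Tr t) (shifted (V t) 0)) :
    HasMaslovIndexPair J K G α β
      ((morseCount ι M (V α) (Tr α) (G α) : ℤ) - morseCount ι M (V β) (Tr β) (G β)) := by
  have hJ2 := isComplexStructure_doubleJ h.isComplexStructure
  have hZ := isLagrangian_diagPlane h.isComplexStructure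
  have hs0 : ∀ t ∈ Set.Icc α β, Function.Surjective (perturbed ι M (shifted (V t) 0)) :=
    fun t ht => hs t ht 0 hκ
  have hL : ∀ t ∈ Set.Icc α β, IsLagrangian J (K t) := fun t ht => by
    rw [hK t ht]
    exact h.isLagrangian_tracePlane ht (hs0 t ht)
  have hLS : ∀ t ∈ Set.Icc α β, IsLagrangian (doubleJ J) (planeSum (K t) (G t)) :=
    fun t ht => (hL t ht).planeSum (h.lagrangian t ht)
  have hc : ContinuousOn (fun t => planeProj (K t)) (Set.Icc α β) := by
    have hc' := ContinuousOn.comp (f := fun t : ℝ => ((0 : ℝ), t)) (s := Set.Icc α β)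
      (g := fun p : ℝ × ℝ => planeProj (tracePlane ι M (Tr p.2) (shifted (V p.2) p.1)))
      (h.continuousOn_tracePlane (s := {0}) (by rintro _ rfl; exact hs0)) (by fun_prop)
      fun t ht => ⟨rfl, ht⟩
    exact hc'.congr fun t ht => by rw [hK t ht]; rfl
  have hcS := continuousOn_planeProj_planeSum (fun t ht => (hL t ht).isClosed)
    (fun t ht => (h.lagrangian t ht).isClosed) hc h.cont_G
  have hfp : ∀ t ∈ Set.Icc α β, IsFredholmPair (K t) (G t) := fun t ht => by
    rw [hK t ht]
    exact h.isFredholmPair ht (hs0 t ht)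
  have hfpS : ∀ t ∈ Set.Icc α β, IsFredholmPair (planeSum (K t) (G t)) (diagPlane X) :=
    fun t ht => (hfp t ht).planeSum (hL t ht).isClosed (h.lagrangian t ht).isClosed
  have hW : ∀ t ∈ Set.Icc α β, souriau (doubleJ J) (planeSum (K t) (G t)) (diagPlane X) =
      pairUnitary J ι M (V t) (Tr t) (G t) 0 := fun t ht => by rw [hK t ht]; rfl
  refine ⟨⟨hL, hc⟩, ⟨h.lagrangian, h.cont_G⟩, hfp, hZ, ⟨hLS, hcS⟩, hfpS, ?_, fun p => ?_⟩
  · exact nonempty_maslovPartition hαβ (fun t ht => souriau_mem_unitary hJ2 (hLS t ht) hZ)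
      (continuousOn_souriau hJ2 hLS hZ hcS)
      fun t ht => exists_admArc_souriau hJ2 (hLS t ht) hZ (hfpS t ht)
  · refine p.flow_eq (fun t => morseCount ι M (V t) (Tr t) (G t)) fun t₀ ht₀ ε hε hadm => ?_
    rw [hW t₀ ht₀] at hadm ⊢
    filter_upwards [h.eventually_morseCount_add ht₀ hκ (hs t₀ ht₀) hlow hε hadm,
      self_mem_nhdsWithin] with t h1 ht
    rw [hW t ht]
    exact h1

end TraceFamily

end MorseMaslov

/-! ### The domain as a Hilbert space with the graph norm. -/

section GraphDomain

variable {H : Type*} [NormedAddCommGroup H] [InnerProductSpace ℂ H]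

/-- Adjoints of operators on the domain are needed for the right inverses `Ψ*(Ψ Ψ*)⁻¹`. -/
instance (T : H →ₗ.[ℂ] H) : InnerProductSpace ℂ (GraphDomain T) where
  inner x y := inner ℂ (GraphDomain.toGraph T x) (GraphDomain.toGraph T y)
  norm_sq_eq_re_inner x := norm_sq_eq_re_inner (𝕜 := ℂ) (GraphDomain.toGraph T x)
  conj_inner_symm x y := inner_conj_symm _ _
  add_left x y z := by rw [map_add, inner_add_left]
  smul_left x y r := by rw [map_smul, inner_smul_left]

/-- The graph map as an isometry. -/
def GraphDomain.toGraphIsometry (T : H →ₗ.[ℂ] H) : GraphDomain T →ₗᵢ[ℂ] WithLp 2 (H × H) where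
  toLinearMap := GraphDomain.toGraph T
  norm_map' _ := rfl

/-- The embedding of the domain. -/
def GraphDomain.incl (T : H →ₗ.[ℂ] H) : GraphDomain T →L[ℂ] H :=
  WithLp.fstL 2 ℂ H H ∘L (GraphDomain.toGraphIsometry T).toContinuousLinearMap

/-- `T` as a bounded operator on its domain with the graph norm. -/
def GraphDomain.act (T : H →ₗ.[ℂ] H) : GraphDomain T →L[ℂ] H :=
  WithLp.sndL 2 ℂ H H ∘L (GraphDomain.toGraphIsometry T).toContinuousLinearMap

variable {T : H →ₗ.[ℂ] H}

theorem GraphDomain.incl_of (u : T.domain) :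
    GraphDomain.incl T (GraphDomain.of T u) = u := rfl

theorem GraphDomain.act_of (u : T.domain) :
    GraphDomain.act T (GraphDomain.of T u) = T u := rfl

theorem GraphDomain.norm_le (d : GraphDomain T) :
    ‖d‖ ≤ ‖GraphDomain.incl T d‖ + ‖GraphDomain.act T d‖ := by
  obtain ⟨u, rfl⟩ := (GraphDomain.of T).surjective d
  rw [incl_of, act_of]
  apply le_of_sq_le_sq _ (by positivity)
  rw [GraphDomain.norm_sq]
  nlinarith [norm_nonneg (u : H), norm_nonneg (T u)]

variable [CompleteSpace H]

theorem GraphDomain.completeSpace (hT : T.IsClosed) : CompleteSpace (GraphDomain T) := by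
  rw [completeSpace_iff_isComplete_range
    (GraphDomain.toGraphIsometry T).isometry.isUniformInducing]
  apply IsClosed.isComplete
  have h1 : Set.range (GraphDomain.toGraphIsometry T) =
      (fun x : WithLp 2 (H × H) => (WithLp.ofLp x)) ⁻¹' (T.graph : Set (H × H)) := by
    ext x
    constructor
    · rintro ⟨d, rfl⟩
      obtain ⟨u, rfl⟩ := (GraphDomain.of T).surjective d
      exact T.mem_graph u
    · intro hx
      obtain ⟨u, h1, h2⟩ := (LinearPMap.mem_graph_iff T).1 hx
      exact ⟨GraphDomain.of T u, withLp_prod_ext h1 h2⟩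
  rw [h1]
  exact IsClosed.preimage (WithLp.prod_continuous_ofLp 2 H H) hT

end GraphDomain

/-! ### Closed operators and eigenspaces. -/

section SymmetricOperators

variable {H : Type*} [NormedAddCommGroup H] [InnerProductSpace ℂ H] [CompleteSpace H]
variable {A : H →ₗ.[ℂ] H}

/-- A closed densely defined operator is the adjoint of its adjoint. -/
theorem mem_domain_of_adjoint (hd : Dense (A.domain : Set H)) (hcl : A.IsClosed) {u v : H}
    (h : ∀ g : A†.domain, inner ℂ (g : H) v = inner ℂ (A† g) u) : u ∈ A.domain := by
  let S : Submodule ℂ (WithLp 2 (H × H)) :=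
    A.graph.comap (WithLp.linearEquiv 2 ℂ (H × H)).toLinearMap
  have hS : IsClosed (S : Set (WithLp 2 (H × H))) :=
    IsClosed.preimage (WithLp.prod_continuous_ofLp 2 H H) hcl
  have hmem : WithLp.toLp 2 (u, v) ∈ S := by
    rw [← IsClosed.submodule_topologicalClosure_eq hS,
      ← Submodule.orthogonal_orthogonal_eq_closure]
    intro y hy
    -- Orthogonality of `y` to the graph of `A` says that `y.snd` is in the domain of the adjoint
    -- with value `-y.fst`; the hypothesis then makes `(u, v)` orthogonal to `y`.
    have h1 : ∀ x : A.domain, inner ℂ (-y.fst) (x : H) = inner ℂ y.snd (A x) := by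
      intro x
      have h2 : inner ℂ y (WithLp.toLp 2 ((x : H), A x)) = 0 :=
        Submodule.inner_left_of_mem_orthogonal
          (show WithLp.toLp 2 ((x : H), A x) ∈ S from A.mem_graph x) hy
      rw [WithLp.prod_inner_apply] at h2
      rw [inner_neg_left, eq_comm]
      exact eq_neg_of_add_eq_zero_right h2
    have h3 : y.snd ∈ A†.domain := A.mem_adjoint_domain_of_exists _ ⟨_, h1⟩
    have h4 : A† ⟨y.snd, h3⟩ = -y.fst := LinearPMap.adjoint_apply_eq hd _ h1
    have h5 := h ⟨y.snd, h3⟩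
    rw [h4, inner_neg_left] at h5
    rw [WithLp.prod_inner_apply]
    exact (add_comm _ _).trans (eq_neg_iff_add_eq_zero.1 h5)
  obtain ⟨x, hx, -⟩ := (LinearPMap.mem_graph_iff A).1 hmem
  change (x : H) = u at hx
  rw [← hx]
  exact x.2

theorem mem_opEigenspace {T : H →ₗ.[ℂ] H} {μ : ℂ} {x : H} :
    x ∈ opEigenspace T μ ↔ ∃ h : x ∈ T.domain, T ⟨x, h⟩ = μ • x := by
  constructor
  · rintro ⟨u, hu, rfl⟩
    exact ⟨u.2, sub_eq_zero.1 hu⟩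
  · rintro ⟨h, hx⟩
    exact ⟨⟨x, h⟩, sub_eq_zero.2 hx, rfl⟩

theorem mem_opEigenspace_addBounded {T : H →ₗ.[ℂ] H} {B : H →L[ℂ] H} {μ : ℝ} {x : H} :
    x ∈ opEigenspace (addBounded T B) μ ↔ ∃ h : x ∈ T.domain, T ⟨x, h⟩ + shifted B μ x = 0 := by
  rw [mem_opEigenspace]
  refine exists_congr fun h => ?_
  change B x + T ⟨x, h⟩ = _ ↔ _
  rw [shifted_apply, ← sub_eq_zero]
  apply Eq.congr_left
  abel

end SymmetricOperators

/-! ### Boundary triples as trace systems. -/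

section BoundaryTriples

variable {H : Type*} [NormedAddCommGroup H] [InnerProductSpace ℂ H] [CompleteSpace H]
variable {𝔥 : Type*} [NormedAddCommGroup 𝔥] [InnerProductSpace ℂ 𝔥] [CompleteSpace 𝔥]
variable {A : H →ₗ.[ℂ] H} {Γ₁ Γ₂ : A†.domain →ₗ[ℂ] 𝔥}
variable {L : GraphDomain A† →L[ℂ] WithLp 2 (𝔥 × 𝔥)} {G : Submodule ℂ (WithLp 2 (𝔥 × 𝔥))}
variable {B : H →L[ℂ] H}

theorem IsBoundaryTriple.green_sympForm (h : IsBoundaryTriple A Γ₁ Γ₂) (f g : A†.domain) :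
    inner ℂ (g : H) (A† f) - inner ℂ (A† g) (f : H) =
      sympForm (stdJ 𝔥) (boundaryTrace Γ₁ Γ₂ f) (boundaryTrace Γ₁ Γ₂ g) := by
  rw [h.green, sympForm_stdJ]
  rfl

/-- Zero trace kills the boundary term in Green's identity, which places `u` in the domain of the
double adjoint of `A`, and that is `A`. -/
theorem IsBoundaryTriple.mem_domain (h : IsBoundaryTriple A Γ₁ Γ₂)
    (hd : Dense (A.domain : Set H)) (hcl : A.IsClosed) {u : A†.domain}
    (hu : boundaryTrace Γ₁ Γ₂ u = 0) : (u : H) ∈ A.domain := by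
  apply mem_domain_of_adjoint hd hcl (v := A† u)
  intro g
  have := h.green_sympForm u g
  rwa [hu, sympForm_zero_left, sub_eq_zero] at this

theorem IsBoundaryTriple.trace_eq_zero (h : IsBoundaryTriple A Γ₁ Γ₂)
    (hd : Dense (A.domain : Set H)) (hsymm : A.IsFormalAdjoint A) {u : A†.domain}
    (hu : (u : H) ∈ A.domain) : boundaryTrace Γ₁ Γ₂ u = 0 := by
  apply eq_zero_of_sympForm (isComplexStructure_stdJ 𝔥)
  intro v
  obtain ⟨g, rfl⟩ := h.surjective v
  rw [← h.green_sympForm, sub_eq_zero]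
  have h1 : A† u = A ⟨u, hu⟩ :=
    ((LinearPMap.IsFormalAdjoint.le_adjoint hd hsymm).2 (x := ⟨u, hu⟩) (y := u) rfl).symm
  rw [h1]
  exact (LinearPMap.adjoint_isFormalAdjoint hd g ⟨u, hu⟩).symm

/-- Since the trace vanishes on `dom A`, the last field only has to be tested there, where it is the
definition of the adjoint. -/
theorem IsBoundaryTriple.traceSystem (h : IsBoundaryTriple A Γ₁ Γ₂)
    (hd : Dense (A.domain : Set H)) (hsymm : A.IsFormalAdjoint A)
    (hL : ∀ u, L (GraphDomain.of A† u) = boundaryTrace Γ₁ Γ₂ u) :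
    TraceSystem (stdJ 𝔥) (GraphDomain.incl A†) (GraphDomain.act A†) L where
  green f g := by
    obtain ⟨f, rfl⟩ := (GraphDomain.of A†).surjective f
    obtain ⟨g, rfl⟩ := (GraphDomain.of A†).surjective g
    rw [hL, hL]
    exact h.green_sympForm f g
  surjective x := by
    obtain ⟨u, rfl⟩ := h.surjective x
    exact ⟨GraphDomain.of A† u, hL u⟩
  injective d hd0 := by
    obtain ⟨u, rfl⟩ := (GraphDomain.of A†).surjective d
    rw [GraphDomain.incl_of] at hd0
    rw [show u = 0 from Subtype.ext hd0, map_zero]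
  norm_le := GraphDomain.norm_le
  exists_of_adjoint u v huv := by
    have h1 : ∀ x : A.domain, inner ℂ v (x : H) = inner ℂ u (A x) := by
      intro x
      obtain ⟨h2, h3⟩ := LinearPMap.IsFormalAdjoint.le_adjoint hd hsymm
      have h4 : A x = A† ⟨x, h2 x.2⟩ := h3 rfl
      rw [h4]
      refine (huv (GraphDomain.of A† ⟨x, h2 x.2⟩) ?_).symm
      rw [hL]
      exact h.trace_eq_zero hd hsymm x.2
    exact ⟨GraphDomain.of A† ⟨u, A.mem_adjoint_domain_of_exists _ ⟨_, h1⟩⟩, rfl,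
      LinearPMap.adjoint_apply_eq hd _ h1⟩

theorem mem_domain_extensionOf {Tr : A†.domain →ₗ[ℂ] WithLp 2 (𝔥 × 𝔥)} {x : H} :
    x ∈ (extensionOf A Tr G).domain ↔ ∃ h : x ∈ A†.domain, Tr ⟨x, h⟩ ∈ G := by
  constructor
  · rintro ⟨⟨u, hu, rfl⟩, h2⟩
    exact ⟨u.2, hu⟩
  · rintro ⟨h, hx⟩
    exact ⟨⟨⟨x, h⟩, hx, rfl⟩, h⟩

theorem extensionOf_apply {Tr : A†.domain →ₗ[ℂ] WithLp 2 (𝔥 × 𝔥)} {x : H}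
    (hx : x ∈ (extensionOf A Tr G).domain) (h : x ∈ A†.domain) :
    extensionOf A Tr G ⟨x, hx⟩ = A† ⟨x, h⟩ := LinearPMap.domRestrict_apply rfl

theorem HasCompactResolvent.compactResolventOn
    (hL : ∀ u, L (GraphDomain.of A† u) = boundaryTrace Γ₁ Γ₂ u)
    (hcomp : HasCompactResolvent (extensionOf A (boundaryTrace Γ₁ Γ₂) G)) :
    CompactResolventOn (GraphDomain.incl A†) (GraphDomain.act A†) L G := by
  obtain ⟨z, R, hR, hright, hleft⟩ := hcomp
  refine ⟨z, R, hR, fun y => ?_, fun d hd => ?_⟩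
  · obtain ⟨h1, h2⟩ := hright y
    obtain ⟨h3, h4⟩ := mem_domain_extensionOf.1 h1
    rw [extensionOf_apply h1 h3] at h2
    exact ⟨GraphDomain.of A† ⟨R y, h3⟩, by rwa [hL], rfl, h2⟩
  · obtain ⟨u, rfl⟩ := (GraphDomain.of A†).surjective d
    rw [hL] at hd
    have h1 : (u : H) ∈ (extensionOf A (boundaryTrace Γ₁ Γ₂) G).domain :=
      mem_domain_extensionOf.2 ⟨u.2, hd⟩
    have h2 := hleft ⟨u, h1⟩
    rw [extensionOf_apply h1 u.2] at h2
    exact h2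

theorem opEigenspace_extensionOf (hL : ∀ u, L (GraphDomain.of A† u) = boundaryTrace Γ₁ Γ₂ u)
    (μ : ℝ) :
    opEigenspace (addBounded (extensionOf A (boundaryTrace Γ₁ Γ₂) G) B) μ =
      (kerOn (GraphDomain.incl A†) (GraphDomain.act A†) L (shifted B μ) G).map
        (GraphDomain.incl A† : GraphDomain A† →ₗ[ℂ] H) := by
  ext x
  rw [mem_opEigenspace_addBounded]
  constructor
  · rintro ⟨h1, h2⟩
    obtain ⟨h3, h4⟩ := mem_domain_extensionOf.1 h1
    rw [extensionOf_apply h1 h3] at h2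
    refine ⟨GraphDomain.of A† ⟨x, h3⟩, ⟨h2, ?_⟩, rfl⟩
    change L _ ∈ G
    rwa [hL]
  · rintro ⟨d, ⟨h1, h2⟩, rfl⟩
    obtain ⟨u, rfl⟩ := (GraphDomain.of A†).surjective d
    change L _ ∈ G at h2
    rw [hL] at h2
    have h3 : (u : H) ∈ (extensionOf A (boundaryTrace Γ₁ Γ₂) G).domain :=
      mem_domain_extensionOf.2 ⟨u.2, h2⟩
    refine ⟨h3, ?_⟩
    change extensionOf A (boundaryTrace Γ₁ Γ₂) G ⟨u, h3⟩ + shifted B μ (u : H) = 0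
    rw [extensionOf_apply h3 u.2]
    exact h1

theorem solutionTraces_eq (hL : ∀ u, L (GraphDomain.of A† u) = boundaryTrace Γ₁ Γ₂ u) (μ : ℝ) :
    solutionTraces A B (boundaryTrace Γ₁ Γ₂) μ =
      tracePlane (GraphDomain.incl A†) (GraphDomain.act A†) L (shifted B μ) := by
  ext x
  constructor
  · rintro ⟨u, hu, rfl⟩
    obtain ⟨_, h1⟩ := mem_opEigenspace_addBounded.1 hu
    exact ⟨GraphDomain.of A† u, h1, hL u⟩
  · rintro ⟨d, hd, rfl⟩
    obtain ⟨u, rfl⟩ := (GraphDomain.of A†).surjective d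
    exact ⟨u, mem_opEigenspace_addBounded.2 ⟨u.2, hd⟩, (hL u).symm⟩

end BoundaryTriples

/-! ### Kernels of boundary value problems and eigenspaces of extensions. -/

section BoundaryTriples

variable {H : Type*} [NormedAddCommGroup H] [InnerProductSpace ℂ H] [CompleteSpace H]
variable {𝔥 : Type*} [NormedAddCommGroup 𝔥] [InnerProductSpace ℂ 𝔥] [CompleteSpace 𝔥]
variable {A : H →ₗ.[ℂ] H} {Γ₁ Γ₂ : A†.domain →ₗ[ℂ] 𝔥}
variable {L : GraphDomain A† →L[ℂ] WithLp 2 (𝔥 × 𝔥)} {G : Submodule ℂ (WithLp 2 (𝔥 × 𝔥))}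
variable {B : H →L[ℂ] H}

theorem TraceSystem.kerOn_eq_bot_iff [CompleteSpace (GraphDomain A†)] {J}
    (h : TraceSystem J (GraphDomain.incl A†) (GraphDomain.act A†) L)
    (hL : ∀ u, L (GraphDomain.of A† u) = boundaryTrace Γ₁ Γ₂ u) (μ : ℝ) :
    kerOn (GraphDomain.incl A†) (GraphDomain.act A†) L (shifted B μ) G = ⊥ ↔
      opEigenspace (addBounded (extensionOf A (boundaryTrace Γ₁ Γ₂) G) B) μ = ⊥ := by
  have hinj : Function.Injective (GraphDomain.incl A† : GraphDomain A† →ₗ[ℂ] H) :=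
    (injective_iff_map_eq_zero _).2 h.injective
  rw [opEigenspace_extensionOf hL, ← Submodule.map_bot
    (GraphDomain.incl A† : GraphDomain A† →ₗ[ℂ] H), (Submodule.map_injective_of_injective hinj).eq_iff]

theorem hasMorseIndex_morseCount [CompleteSpace (GraphDomain A†)] {J}
    (h : TraceSystem J (GraphDomain.incl A†) (GraphDomain.act A†) L)
    (hL : ∀ u, L (GraphDomain.of A† u) = boundaryTrace Γ₁ Γ₂ u)
    (hcomp : CompactResolventOn (GraphDomain.incl A†) (GraphDomain.act A†) L G)
    (hfin : {μ : ℝ | μ < 0 ∧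
      kerOn (GraphDomain.incl A†) (GraphDomain.act A†) L (shifted B μ) G ≠ ⊥}.Finite) :
    HasMorseIndex (addBounded (extensionOf A (boundaryTrace Γ₁ Γ₂) G) B)
      (morseCount (GraphDomain.incl A†) (GraphDomain.act A†) B L G) := by
  refine ⟨?_, fun μ _ => ?_, ?_⟩
  · simpa only [ne_eq, h.kerOn_eq_bot_iff hL] using hfin
  · have := h.finiteDimensional_ker_inf hcomp (shifted B μ)
    rw [opEigenspace_extensionOf hL]
    infer_instance
  · refine finsum_congr fun μ => finsum_congr fun _ => ?_
    rw [opEigenspace_extensionOf hL]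
    exact (Submodule.equivMapOfInjective (GraphDomain.incl A† : GraphDomain A† →ₗ[ℂ] H)
      ((injective_iff_map_eq_zero _).2 h.injective) _).finrank_eq.symm

end BoundaryTriples

end

/-! ### The theorem. -/

theorem theorem5p5
    {H : Type*} [NormedAddCommGroup H] [InnerProductSpace ℂ H] [CompleteSpace H]
    [TopologicalSpace.SeparableSpace H]
    {𝔥 : Type*} [NormedAddCommGroup 𝔥] [InnerProductSpace ℂ 𝔥] [CompleteSpace 𝔥]
    [TopologicalSpace.SeparableSpace 𝔥]
    -- a densely defined, closed, symmetric operator with equal deficiency indices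
    (A : H →ₗ.[ℂ] H) (hA_dense : Dense (A.domain : Set H)) (hA_symm : A.IsFormalAdjoint A)
    (hA_closed : A.IsClosed) (hA_def : EqualDeficiencyIndices A)
    (α β : ℝ) (hαβ : α < β)
    -- the perturbations
    (V : ℝ → H →L[ℂ] H) (hV : ContDiffOn ℝ 1 V (Set.Icc α β))
    (hV_sa : ∀ t ∈ Set.Icc α β, IsSelfAdjoint (V t))
    -- abstract unique continuation
    (κ : ℝ) (hκ : κ < 0)
    (huc : ∀ t ∈ Set.Icc α β, ∀ μ : ℝ, κ ≤ μ →
      opEigenspace (addBounded A† (V t)) μ ⊓ A.domain = ⊥)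
    -- the boundary triples
    (Γ₁ Γ₂ : ℝ → A†.domain →ₗ[ℂ] 𝔥)
    (hΓ : ∀ t ∈ Set.Icc α β, IsBoundaryTriple A (Γ₁ t) (Γ₂ t))
    (hTr : IsC1GraphFamily A† (fun t => boundaryTrace (Γ₁ t) (Γ₂ t)) α β)
    -- the Lagrangian planes
    (G : ℝ → Submodule ℂ (WithLp 2 (𝔥 × 𝔥))) (hG : IsC1LagrangianPath (stdJ 𝔥) G α β)
    -- compact resolvents and the uniform lower bound
    (hcomp : ∀ t ∈ Set.Icc α β,
      HasCompactResolvent (extensionOf A (boundaryTrace (Γ₁ t) (Γ₂ t)) (G t)))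
    (lamInf : ℝ) (hlam : lamInf ∈ Set.Ico κ 0)
    (hlow : ∀ t ∈ Set.Icc α β, ∀ μ : ℝ, μ < lamInf →
      opEigenspace (addBounded (extensionOf A (boundaryTrace (Γ₁ t) (Γ₂ t)) (G t)) (V t)) μ = ⊥) :
    ∃ mα mβ : ℕ,
      HasMorseIndex
        (addBounded (extensionOf A (boundaryTrace (Γ₁ α) (Γ₂ α)) (G α)) (V α)) mα ∧
      HasMorseIndex
        (addBounded (extensionOf A (boundaryTrace (Γ₁ β) (Γ₂ β)) (G β)) (V β)) mβ ∧
      HasMaslovIndexPair (stdJ 𝔥)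
        (fun t => solutionTraces A (V t) (boundaryTrace (Γ₁ t) (Γ₂ t)) 0) G α β
        ((mα : ℤ) - (mβ : ℤ)) := by

  have : CompleteSpace (GraphDomain A†) :=
    GraphDomain.completeSpace (LinearPMap.adjoint_isClosed hA_dense)
  obtain ⟨L, hL, hLc⟩ := hTr
  have hsys : ∀ t ∈ Set.Icc α β, TraceSystem (stdJ 𝔥) (GraphDomain.incl A†)
      (GraphDomain.act A†) (L t) :=
    fun t ht => (hΓ t ht).traceSystem hA_dense hA_symm (hL t ht)
  have hfam : TraceFamily (stdJ 𝔥) (GraphDomain.incl A†) (GraphDomain.act A†) V L G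
      (Set.Icc α β) :=
    { isComplexStructure := isComplexStructure_stdJ 𝔥
      cont_V := hV.continuousOn
      symm_V := fun t ht x y => (hV_sa t ht).isSymmetric x y
      system := hsys
      cont_Tr := hLc.continuousOn
      lagrangian := hG.1
      cont_G := hG.2.continuousOn
      compact := fun t ht => (hcomp t ht).compactResolventOn (hL t ht) }
  -- A solution with zero trace lies in `dom A`, so the unique continuation hypothesis makes it
  -- vanish.
  have hs : ∀ t ∈ Set.Icc α β, ∀ μ, κ ≤ μ → Function.Surjective
      (perturbed (GraphDomain.incl A†) (GraphDomain.act A†) (shifted (V t) μ)) := by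
    intro t ht μ hμ
    apply hfam.surjective_perturbed ht
    intro d hd hd0
    obtain ⟨u, rfl⟩ := (GraphDomain.of A†).surjective d
    rw [hL t ht] at hd0
    have hu : (u : H) ∈ opEigenspace (addBounded A† (V t)) μ ⊓ A.domain :=
      ⟨mem_opEigenspace_addBounded.2 ⟨u.2, hd⟩, (hΓ t ht).mem_domain hA_dense hA_closed hd0⟩
    rw [huc t ht μ hμ, Submodule.mem_bot] at hu
    exact (hsys t ht).injective _ hu
  -- The lower bound `lamInf` is at least `κ`, so nothing below `κ` is an eigenvalue.
  have hker : ∀ t ∈ Set.Icc α β, ∀ μ < κ,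
      kerOn (GraphDomain.incl A†) (GraphDomain.act A†) (L t) (shifted (V t) μ) (G t) = ⊥ :=
    fun t ht μ hμ => ((hsys t ht).kerOn_eq_bot_iff (hL t ht) μ).2
      (hlow t ht μ (hμ.trans_le hlam.1))
  have hmorse : ∀ t ∈ Set.Icc α β, HasMorseIndex
      (addBounded (extensionOf A (boundaryTrace (Γ₁ t) (Γ₂ t)) (G t)) (V t))
      (morseCount (GraphDomain.incl A†) (GraphDomain.act A†) (V t) (L t) (G t)) := by
    intro t ht
    obtain ⟨c, hc, hev⟩ := hfam.exists_lt_eventually_surjective ht (hs t ht) 0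
    exact hasMorseIndex_morseCount (hsys t ht) (hL t ht) (hfam.compact t ht)
      (hfam.finite_negative ht (hev.self_of_nhdsWithin ht)
        (fun μ hμ => hker t ht μ (hμ.trans_lt hc)) (hc.trans hκ).le)
  refine ⟨_, _, hmorse α ⟨le_rfl, hαβ.le⟩, hmorse β ⟨hαβ.le, le_rfl⟩, ?_⟩
  refine hfam.hasMaslovIndexPair hαβ hκ.le hs hker fun t ht => ?_
  rw [← solutionTraces_eq (hL t ht), Complex.ofReal_zero]
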